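/- Let $n\ge 1$ and $k\ge 0$ be integers, let $K$ be a field of characteristic $0$ and let $q\in K$ be transcendental over $\mathbb{Q}$ (for instance $K=\mathbb{Q}(q)$). Let $V(z)=\bigl(\bigoplus_{m=1}^n K v_m\bigr)\otimes K[z,z^{-1}]$, with basis $(u_l)_{l\in\mathbb{Z}}$, $u_{m-nr}=z^r v_m$. The affine Hecke algebra $\widehat H_N(q^{-2})$ acts from the right on $V(z)^{\otimes N}$: $y_i$ acts as $z_i^{-1}$, i.e. as $u_l\mapsto u_{l+n}$ in the $i$-th factor, and, writing $v_{\mathbf m}z^{\mathbf r}=z^{r_1}v_{m_1}\otimes\cdots\otimes z^{r_N}v_{m_N}$, $$ (v_{\mathbf m} z^{\mathbf r})T_i=\begin{cases} -q^{-1}v_{\mathbf m\sigma_i}\sigma_i(z^{\mathbf r})+(q^{-2}-1)v_{\mathbf m}\,\partial_i(z_iz^{\mathbf r}) & m_i<m_{i+1},\\ -v_{\mathbf m}\sigma_i(z^{\mathbf r})+(q^{-2}-1)v_{\mathbf m}\,z_i\partial_i(z^{\mathbf r}) & m_i=m_{i+1},\\ -q^{-1}v_{\mathbf m\sigma_i}\sigma_i(z^{\mathbf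 r})+(q^{-2}-1)v_{\mathbf m}\,z_i\partial_i(z^{\mathbf r}) & m_i>m_{i+1}, \end{cases} $$ where $\sigma_i$ exchanges the $i$-th and $(i+1)$-st entries (or variables) and $\partial_i f=(f-\sigma_i f)/(z_i-z_{i+1})$. Let $A^{(N)}=\sum_{\sigma\in\mathfrak S_N}T_\sigma$ and $\bigwedge_q^N V(z)=V(z)^{\otimes N}/\ker A^{(N)}$, and let the $q$-wedge Fock space $\mathcal F_q$ be the inductive limit of the spaces $\bigwedge_q^N V(z)$ along the maps $w\mapsto w\wedge_q u_{-N}$. For a partition $\lambda$ put $|\lambda\rangle=u_{\lambda_1}\wedge_q u_{\lambda_2-1}\wedge_q u_{\lambda_3-2}\wedge_q\cdots\in\mathcal F_q$. Draw diagrams in the French convention. An $n$-ribbon is a connected skew shape with $n$ cells that contains no $2\times 2$ square; its initial cell is its rightmost and bottommost cell, its height is the number of rows that it meets, and its spin is (height $-1$)/2. For partitions $\alpha\subseteq\beta$ let $\mathrm{Tab}_n(\beta/\alpha,(k))$ be the set of tilings $T$ of $\beta/\alpha$ by $k$ $n$-ribbons each of whose initial cells is the bottom cell of $\beta/\alpha$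 in its column (horizontal $n$-ribbon strips of weight $k$). The spin $s(T)$ of a tiling is the sum of the spins of its ribbons, and $T'$ denotes the conjugate tiling, obtained from $T$ by exchanging rows and columns. **Lemma.** There are unique linear operators $\tilde U_k=e_k(y_1^{-1},y_2^{-1},\ldots)$ and $\tilde V_k=e_k(y_1,y_2,\ldots)$ on $\mathcal F_q$ that are the limits of the operators $e_k(y_1^{-1},\ldots,y_N^{-1})$ and $e_k(y_1,\ldots,y_N)$, in the following sense: for all $N$ and all $w\in V(z)^{\otimes N}$, the operator on $\mathcal F_q$ maps the class of $w$ to the class of the image of $w\otimes u_{-N}\otimes\cdots\otimes u_{-M+1}$ under the corresponding operator on $V(z)^{\otimes M}$, for all sufficiently large $M$. For every partition $\lambda$ they satisfy $$ \tilde U_k|\lambda\rangle=\sum_\nu\Bigl(\sum_{T\in\mathrm{Tab}_n(\lambda'/\nu',(k))}(-q)^{-2s(T')}\Bigr)|\nu\rangle,\qquad \tilde V_k|\lambda\rangle=\sum_\mu\Bigl(\sum_{T\in\mathrm{Tab}_n(\mu'/\lambda',(k))}(-q)^{-2s(T')}\Bigr)|\mu\rangle , $$ where each sum over partitions has only finitely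 many nonzero coefficients. Here $T'$ is a tiling of $\lambda/\nu$, respectively of $\mu/\lambda$. -/

import Mathlib

noncomputable section

namespace QFock

/-! ### The tensor powers of `V(z)` and the action of the affine Hecke algebra

`V(z)` has the basis `(u_l)_{l ∈ ℤ}`; it is identified with
`(⨁_{m=1}^n K v_m) ⊗ K[z, z⁻¹]` through `z^r v_m = u_{m - n r}`. -/

/-- The `N`-th tensor power of `V(z)`: the basis vector indexed by `l : Fin N → ℤ` is
`u_{l 0} ⊗ u_{l 1} ⊗ ⋯ ⊗ u_{l (N-1)}`. -/
abbrev Tensor (K : Type*) [Field K] (N : ℕ) : Type _ := (Fin N → ℤ) →₀ K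

/-- The index `m ∈ {1, …, n}` in `u_l = z^r v_m`. -/
def vIndex (n : ℕ) (l : ℤ) : ℤ := (l - 1) % (n : ℤ) + 1

/-- The exponent `r` in `u_l = z^r v_m`. -/
def zExponent (n : ℕ) (l : ℤ) : ℤ := -((l - 1) / (n : ℤ))

theorem vIndex_sub_mul_zExponent (n : ℕ) (l : ℤ) :
    vIndex n l - (n : ℤ) * zExponent n l = l := by
  unfold vIndex zExponent
  have h := Int.emod_add_mul_ediv (l - 1) (n : ℤ)
  linarith

variable {K : Type*} [Field K]

/-- Laurent polynomials in two variables: `Finsupp.single (a, b) 1` is `z₁^a z₂^b`. -/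
abbrev Laurent₂ (K : Type*) [Field K] : Type _ := (ℤ × ℤ) →₀ K

/-- The divided difference `(f - σ f) / (z₁ - z₂)` of the monomial `f = z₁^a z₂^b`. -/
def dividedDifference (a b : ℤ) : Laurent₂ K :=
  ∑ s ∈ Finset.range (a - b).toNat, Finsupp.single (a - 1 - (s : ℤ), b + (s : ℤ)) 1
    - ∑ s ∈ Finset.range (b - a).toNat, Finsupp.single (b - 1 - (s : ℤ), a + (s : ℤ)) 1

/-- Multiplication by `z₁`. -/
def mulZ₁ : Laurent₂ K →ₗ[K] Laurent₂ K :=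
  Finsupp.lmapDomain K K fun r => (r.1 + 1, r.2)

/-- `f ↦ (v_m ⊗ v_{m'}) · f(z_a, z_b)`, placed in the tensor factors `a` and `b`; the other
factors are those of `u_{l 0} ⊗ ⋯ ⊗ u_{l (N-1)}`. -/
def place (n : ℕ) {N : ℕ} (a b : Fin N) (l : Fin N → ℤ) (m m' : ℤ) :
    Laurent₂ K →ₗ[K] Tensor K N :=
  Finsupp.lmapDomain K K fun r =>
    Function.update (Function.update l a (m - (n : ℤ) * r.1)) b (m' - (n : ℤ) * r.2)

/-- The image of `u_{l 0} ⊗ ⋯ ⊗ u_{l (N-1)}` under the Hecke generator that acts on the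
consecutive tensor factors `a` and `b`. -/
def heckeOnBasis (q : K) (n : ℕ) {N : ℕ} (a b : Fin N) (l : Fin N → ℤ) : Tensor K N :=
  let m₁ := vIndex n (l a)
  let m₂ := vIndex n (l b)
  let r₁ := zExponent n (l a)
  let r₂ := zExponent n (l b)
  if m₁ < m₂ then
    (-q⁻¹) • place n a b l m₂ m₁ (Finsupp.single (r₂, r₁) 1)
      + (q⁻¹ ^ 2 - 1) • place n a b l m₁ m₂ (dividedDifference (r₁ + 1) r₂)
  else if m₁ = m₂ then
    -place n a b l m₁ m₂ (Finsupp.single (r₂, r₁) 1)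
      + (q⁻¹ ^ 2 - 1) • place n a b l m₁ m₂ (mulZ₁ (dividedDifference r₁ r₂))
  else
    (-q⁻¹) • place n a b l m₂ m₁ (Finsupp.single (r₂, r₁) 1)
      + (q⁻¹ ^ 2 - 1) • place n a b l m₁ m₂ (mulZ₁ (dividedDifference r₁ r₂))

/-- The generator `T_{i+1}` of the Hecke algebra `H_N(q⁻²)`, acting (from the right) on
`V(z)^{⊗ N}`; meaningful for `i + 1 < N`. -/
def heckeT (q : K) (n N i : ℕ) : Tensor K N →ₗ[K] Tensor K N :=
  if h : i + 1 < N then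
    Finsupp.linearCombination K
      (heckeOnBasis q n (⟨i, Nat.lt_of_succ_lt h⟩ : Fin N) (⟨i + 1, h⟩ : Fin N))
  else 0

/-- The right action of `T_{i₁} T_{i₂} ⋯ T_{iᵣ}`: `T_{i₁}` is applied first. -/
def heckeWord (q : K) (n N : ℕ) (w : List ℕ) : Tensor K N →ₗ[K] Tensor K N :=
  w.foldl (fun f i => heckeT q n N i ∘ₗ f) LinearMap.id

/-- The number of inversions of `σ` whose larger value is `j`. -/
def inversions {N : ℕ} (σ : Equiv.Perm (Fin N)) (j : Fin N) : ℕ :=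
  (Finset.univ.filter fun i : Fin N => i < j ∧ σ.symm j < σ.symm i).card

/-- A reduced decomposition of `σ`, in which the letter `i` stands for the transposition
`(i, i+1)`: the product, for `j = 1, …, N-1`, of the words
`(j-1, j) (j-2, j-1) ⋯ (j-c, j-c+1)`, `c` being the number of inversions of `σ` with larger
value `j`. -/
def reducedWord {N : ℕ} (σ : Equiv.Perm (Fin N)) : List ℕ :=
  (List.finRange N).flatMap fun j =>
    (List.range (inversions σ j)).map fun s => (j : ℕ) - 1 - s

/-- The `q`-antisymmetrizer `A^{(N)} = ∑_{σ ∈ S_N} T_σ`. -/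
def antisymmetrizer (q : K) (n N : ℕ) : Tensor K N →ₗ[K] Tensor K N :=
  ∑ σ : Equiv.Perm (Fin N), heckeWord q n N (reducedWord σ)

/-- The `q`-exterior power `⋀_q^N V(z) = V(z)^{⊗ N} / ker A^{(N)}`. -/
def QWedge (q : K) (n N : ℕ) : Type _ :=
  Tensor K N ⧸ LinearMap.ker (antisymmetrizer q n N)

instance (q : K) (n N : ℕ) : AddCommGroup (QWedge q n N) :=
  inferInstanceAs (AddCommGroup (Tensor K N ⧸ LinearMap.ker (antisymmetrizer q n N)))

instance (q : K) (n N : ℕ) : Module K (QWedge q n N) :=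
  inferInstanceAs (Module K (Tensor K N ⧸ LinearMap.ker (antisymmetrizer q n N)))

/-- The projection of `V(z)^{⊗ N}` onto `⋀_q^N V(z)`; it maps `u_{i₁} ⊗ ⋯ ⊗ u_{i_N}` to
`u_{i₁} ∧_q ⋯ ∧_q u_{i_N}`. -/
def toWedge (q : K) (n N : ℕ) : Tensor K N →ₗ[K] QWedge q n N :=
  (LinearMap.ker (antisymmetrizer q n N)).mkQ

/-! ### The thermodynamic limit -/

/-- `w ↦ w ⊗ u_{-N}`. -/
def extend (K : Type*) [Field K] (N : ℕ) : Tensor K N →ₗ[K] Tensor K (N + 1) :=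
  Finsupp.lmapDomain K K fun l => Fin.snoc (α := fun _ => ℤ) l (-(N : ℤ))

/-- `w ↦ w ⊗ u_{-N} ⊗ u_{-N-1} ⊗ ⋯ ⊗ u_{-N-d+1}`. -/
def extendBy (K : Type*) [Field K] (N : ℕ) :
    (d : ℕ) → Tensor K N →ₗ[K] Tensor K (N + d)
  | 0 => LinearMap.id
  | d + 1 => extend K (N + d) ∘ₗ extendBy K N d

/-- The relations identifying the class of `w` in `⋀_q^N V(z)` with the class of
`w ⊗ u_{-N}` in `⋀_q^{N+1} V(z)`. -/
def limitRelations (q : K) (n : ℕ) : Submodule K (DirectSum ℕ fun N => QWedge q n N) :=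
  Submodule.span K
    {x | ∃ (N : ℕ) (w : Tensor K N),
      x = DirectSum.lof K ℕ (fun N => QWedge q n N) N (toWedge q n N w)
        - DirectSum.lof K ℕ (fun N => QWedge q n N) (N + 1)
            (toWedge q n (N + 1) (extend K N w))}

/-- The `q`-wedge Fock space: the inductive limit of the `⋀_q^N V(z)` along the maps
`w ↦ w ∧_q u_{-N}`. -/
abbrev FockSpace (q : K) (n : ℕ) : Type _ :=
  (DirectSum ℕ fun N => QWedge q n N) ⧸ limitRelations q n

/-- The class of `w` in the Fock space; for `w = u_{i₁} ⊗ ⋯ ⊗ u_{i_N}` it is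
`u_{i₁} ∧_q ⋯ ∧_q u_{i_N} ∧_q u_{-N} ∧_q u_{-N-1} ∧_q ⋯`. -/
def toFock (q : K) (n N : ℕ) : Tensor K N →ₗ[K] FockSpace q n :=
  (limitRelations q n).mkQ ∘ₗ DirectSum.lof K ℕ (fun N => QWedge q n N) N ∘ₗ
    toWedge q n N

/-- `|λ⟩ = u_{λ₁} ∧_q u_{λ₂ - 1} ∧_q u_{λ₃ - 2} ∧_q ⋯`. -/
def ket (q : K) (n : ℕ) (lam : YoungDiagram) : FockSpace q n :=
  toFock q n (lam.colLen 0)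
    (Finsupp.single (fun i : Fin (lam.colLen 0) => (lam.rowLen i : ℤ) - (i : ℤ)) 1)

/-- The action of the monomial `y_1^{a_1} ⋯ y_N^{a_N}`, where `y_i` acts as `z_i⁻¹`, that is,
as `u_l ↦ u_{l+n}` in the `i`-th tensor factor. -/
def yMonomial (K : Type*) [Field K] (n : ℕ) {N : ℕ} (a : Fin N → ℤ) :
    Tensor K N →ₗ[K] Tensor K N :=
  Finsupp.lmapDomain K K fun l i => l i + (n : ℤ) * a i

/-- `e_k(y_1, …, y_N)`. -/
def esymmY (K : Type*) [Field K] (n k N : ℕ) : Tensor K N →ₗ[K] Tensor K N :=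
  ∑ S ∈ (Finset.univ : Finset (Fin N)).powersetCard k,
    yMonomial K n fun i => if i ∈ S then 1 else 0

/-- `e_k(y_1⁻¹, …, y_N⁻¹)`. -/
def esymmYInv (K : Type*) [Field K] (n k N : ℕ) : Tensor K N →ₗ[K] Tensor K N :=
  ∑ S ∈ (Finset.univ : Finset (Fin N)).powersetCard k,
    yMonomial K n fun i => if i ∈ S then -1 else 0

/-- `E` is the thermodynamic limit of the operators `X N` on `V(z)^{⊗ N}`: for every vector
`w` of `V(z)^{⊗ N}`, the image in the Fock space of
`X (N + d) (w ⊗ u_{-N} ⊗ ⋯ ⊗ u_{-N-d+1})` is, for all large `d`, equal to `E` applied to the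
class of `w`. As every vector of the Fock space is such a class, there is at most one
such `E`. -/
def IsThermodynamicLimit (q : K) (n : ℕ) (X : (N : ℕ) → Tensor K N →ₗ[K] Tensor K N)
    (E : FockSpace q n →ₗ[K] FockSpace q n) : Prop :=
  ∀ (N : ℕ) (w : Tensor K N), ∀ᶠ d in Filter.atTop,
    toFock q n (N + d) (X (N + d) (extendBy K N d w)) = E (toFock q n N w)

/-! ### Ribbons

The cell `(i, j)` lies in row `i` and column `j`. The bottom row is row `0` (French
convention), so rows are numbered upwards, and columns from left to right. -/

/-- `R` is an `n`-ribbon: a strip of `n` cells each of which (after the first) is directly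
above, or directly to the left of, the preceding one; equivalently, a connected skew shape
with `n` cells and without a `2 × 2` square. -/
def IsRibbon (n : ℕ) (R : Finset (ℕ × ℕ)) : Prop :=
  ∃ c : ℕ → ℕ × ℕ,
    (∀ i, i + 1 < n →
      ((c (i + 1)).1 = (c i).1 + 1 ∧ (c (i + 1)).2 = (c i).2) ∨
      ((c (i + 1)).1 = (c i).1 ∧ (c (i + 1)).2 + 1 = (c i).2)) ∧
    R = (Finset.range n).image c

/-- `x` is the initial cell of `R`: its rightmost and bottommost cell. -/
def IsInitialCell (R : Finset (ℕ × ℕ)) (x : ℕ × ℕ) : Prop :=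
  x ∈ R ∧ ∀ y ∈ R, x.1 ≤ y.1 ∧ y.2 ≤ x.2

/-- The height of a ribbon: the number of rows that it meets. -/
def height (R : Finset (ℕ × ℕ)) : ℕ := (R.image Prod.fst).card

/-- `T` is a tiling that makes `β / α` a horizontal `n`-ribbon strip of weight `k`: it consists
of `k` pairwise disjoint `n`-ribbons with union `β / α`, the initial cell of each of which is
the bottom cell of `β / α` in its column. -/
structure IsHorizontalStripTiling (n k : ℕ) (β α : YoungDiagram)
    (T : Finset (Finset (ℕ × ℕ))) : Prop where
  le : α ≤ β
  ribbon : ∀ R ∈ T, IsRibbon n R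
  disjoint : (T : Set (Finset (ℕ × ℕ))).PairwiseDisjoint id
  union : T.biUnion id = β.cells \ α.cells
  card : T.card = k
  initial : ∀ R ∈ T, ∃ x, IsInitialCell R x ∧ x.1 = α.colLen x.2

open Classical in
/-- `Tab_n(β/α, (k))`: the `n`-ribbon tableaux of shape `β / α` and weight `(k)`, each given by
its set of ribbons. -/
def ribbonTableaux (n k : ℕ) (β α : YoungDiagram) : Finset (Finset (Finset (ℕ × ℕ))) :=
  (β.cells \ α.cells).powerset.powerset.filter (IsHorizontalStripTiling n k β α)

/-- Twice the spin: the sum over the ribbons `R` of `T` of `height R - 1`. -/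
def twiceSpin (T : Finset (Finset (ℕ × ℕ))) : ℕ := ∑ R ∈ T, (height R - 1)

/-- The conjugate `T'` of a ribbon tableau `T`: rows and columns are exchanged. If `T` tiles
`λ' / ν'`, then `T'` tiles `λ / ν`. -/
def conjugate (T : Finset (Finset (ℕ × ℕ))) : Finset (Finset (ℕ × ℕ)) :=
  T.image fun R => R.image Prod.swap

/-- `∑_{T ∈ Tab_n(λ'/ν', (k))} (-q)^{-2 s(T')}`. -/
def ribbonCoeff (q : K) (n k : ℕ) (lam nu : YoungDiagram) : K :=
  ∑ T ∈ ribbonTableaux n k lam.transpose nu.transpose,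
    (-q) ^ (-(twiceSpin (conjugate T) : ℤ))

end QFock

end

/-! A tensor is determined by the values of its coefficients at points with distinct non-zero
coordinates. On these values the Hecke generators act as Demazure–Lusztig operators, and a symmetric
Laurent polynomial in the `y_i` acts as multiplication by a symmetric function. This gives the braid
and commutation relations (`heckeT_braid`, `heckeT_comm`) and shows that `e_k(y^{±1})` commutes with
the Hecke action, hence descends to the q-wedges.

Through the relations, the antisymmetrizer is a product of coset sums, and it kills every `f` with
`T_t f = -f` (`antisymmetrizer_eq_zero`). Only two consequences are needed: a wedge with two equal
neighbours vanishes, and `u_a ∧ u_b = -q⁻¹ u_b ∧ u_a` for `a < b < a + n`. The general straightening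
rule never enters: `e_k(y^{±1})` shifts `k` entries of a strictly decreasing sequence by `±n`, and
two entries that get out of order then differ by less than `n`. Sorting therefore yields either
zero, when an entry is repeated, or the factor `(-q)^{-a}`, where `a` is the number of pairs out of
order (`seqFock_eq_zero`, `seqFock_straighten`). Shifts deep in the vacuum produce repetitions, so
the operators stabilize and the limits exist.

It remains to recognize the coefficients. A partition is encoded by its beads `λ_{i+1} - i`, and the
number of beads above `d` tells how far the diagram extends along the diagonal of content `d`.
Moving a set `Y` of beads up by `n` adds one ribbon for each bead, and these ribbons form a
horizontal strip after conjugation; conversely, every such strip arises from exactly one `Y`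
(`isHorizontalStripTiling_image`, `IsHorizontalStripTiling.exists_beads`). The ribbon of `y` changes
row once for each unmoved bead that `y` passes. Hence `2 s(T')` counts the pairs of a moved bead and
an unmoved bead that it passes, which are exactly the pairs out of order. Lowering operators are
treated by reversing the moves. -/

noncomputable section

namespace QFock

variable {K : Type*} [Field K]

/-! ### Evaluation of tensors at points -/

/-- The value of `u_l` at the colour `m` and the point `x`. -/
def evFactor (n : ℕ) (l m : ℤ) (x : K) : K :=
  if vIndex n l = m then x ^ zExponent n l else 0

/-- The value of `u_{l 0} ⊗ ⋯ ⊗ u_{l (N-1)}` at the colours `m` and the point `z`. -/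
def evBasis (n : ℕ) {N : ℕ} (l m : Fin N → ℤ) (z : Fin N → K) : K :=
  ∏ i, evFactor n (l i) (m i) (z i)

/-- The coefficient of `v_m`, a Laurent polynomial, evaluated at the point `z`. -/
def ev (n : ℕ) {N : ℕ} (m : Fin N → ℤ) (z : Fin N → K) : Tensor K N →ₗ[K] K :=
  Finsupp.linearCombination K fun l => evBasis n l m z

@[simp] theorem ev_single (n : ℕ) {N : ℕ} (l m : Fin N → ℤ) (z : Fin N → K) (c : K) :
    ev n m z (Finsupp.single l c) = c * evBasis n l m z := by
  simp [ev]

/-- Evaluation of a Laurent polynomial in two variables. -/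
def laurentEval (x y : K) : Laurent₂ K →ₗ[K] K :=
  Finsupp.linearCombination K fun r => x ^ r.1 * y ^ r.2

@[simp] theorem laurentEval_single (x y : K) (r : ℤ × ℤ) (c : K) :
    laurentEval x y (Finsupp.single r c) = c * (x ^ r.1 * y ^ r.2) := by
  simp [laurentEval]

theorem laurentEval_mulZ₁ {x : K} (hx : x ≠ 0) (y : K) (f : Laurent₂ K) :
    laurentEval x y (mulZ₁ f) = x * laurentEval x y f := by
  induction f using Finsupp.induction_linear with
  | zero => simp
  | add f g hf hg => simp [hf, hg, mul_add]
  | single r c =>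
    simp only [mulZ₁, Finsupp.lmapDomain_apply, Finsupp.mapDomain_single, laurentEval_single]
    rw [zpow_add_one₀ hx]
    ring

/-- After multiplication by `x - y` the sum telescopes. For `a < b` the range is empty, since
`toNat` sends a negative difference to `0`; thus at most one of the two sums in `dividedDifference`
contributes. -/
theorem laurentEval_geom {x y : K} (hx : x ≠ 0) (hy : y ≠ 0) (a b : ℤ) :
    (x - y) * laurentEval x y
        (∑ s ∈ Finset.range (a - b).toNat, Finsupp.single (a - 1 - (s : ℤ), b + (s : ℤ)) 1) =
      if b ≤ a then x ^ a * y ^ b - x ^ b * y ^ a else 0 := by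
  split_ifs with h
  · obtain ⟨d, rfl⟩ : ∃ d : ℕ, a = b + d := ⟨(a - b).toNat, by omega⟩
    have hd : (b + (d : ℤ) - b).toNat = d := by omega
    rw [hd, map_sum, Finset.mul_sum]
    have key : ∀ s ∈ Finset.range d,
        (x - y) * laurentEval x y (Finsupp.single (b + (d : ℤ) - 1 - (s : ℤ), b + (s : ℤ)) 1) =
          x ^ (b + (d : ℤ) - s) * y ^ (b + (s : ℤ))
            - x ^ (b + (d : ℤ) - (s + 1 : ℕ)) * y ^ (b + ((s + 1 : ℕ) : ℤ)) := by
      intro s _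
      rw [laurentEval_single]
      have e1 : b + (d : ℤ) - s = (b + (d : ℤ) - 1 - s) + 1 := by ring
      have e2 : b + (d : ℤ) - ((s + 1 : ℕ) : ℤ) = b + (d : ℤ) - 1 - s := by push_cast; ring
      have e3 : b + ((s + 1 : ℕ) : ℤ) = (b + s) + 1 := by push_cast; ring
      rw [e2, e3, e1, zpow_add_one₀ hx, zpow_add_one₀ hy]
      ring
    rw [Finset.sum_congr rfl key,
      Finset.sum_range_sub' (fun s : ℕ => x ^ (b + (d : ℤ) - s) * y ^ (b + (s : ℤ)))]
    simp
  · have hd : (a - b).toNat = 0 := by omega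
    simp [hd]

theorem laurentEval_dividedDifference {x y : K} (hx : x ≠ 0) (hy : y ≠ 0) (a b : ℤ) :
    (x - y) * laurentEval x y (dividedDifference a b) = x ^ a * y ^ b - x ^ b * y ^ a := by
  rw [dividedDifference, map_sub, mul_sub, laurentEval_geom hx hy, laurentEval_geom hx hy]
  rcases lt_trichotomy a b with h | h | h
  · rw [if_neg (by omega), if_pos h.le]; ring
  · subst h; simp
  · rw [if_pos h.le, if_neg (by omega)]; ring

theorem vIndex_sub_mul {n : ℕ} {m : ℤ} (h1 : 1 ≤ m) (h2 : m ≤ n) (r : ℤ) :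
    vIndex n (m - n * r) = m := by
  unfold vIndex
  have : m - n * r - 1 = (m - 1) + n * (-r) := by ring
  rw [this, Int.add_mul_emod_self_left, Int.emod_eq_of_lt (by omega) (by omega)]
  ring

theorem zExponent_sub_mul {n : ℕ} {m : ℤ} (h1 : 1 ≤ m) (h2 : m ≤ n) (r : ℤ) :
    zExponent n (m - n * r) = r := by
  have h := vIndex_sub_mul_zExponent n (m - n * r)
  rw [vIndex_sub_mul h1 h2] at h
  have hn : (n : ℤ) ≠ 0 := by omega
  have : (n : ℤ) * zExponent n (m - n * r) = n * r := by linarith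
  exact mul_left_cancel₀ hn this

theorem one_le_vIndex {n : ℕ} (hn : 1 ≤ n) (l : ℤ) : 1 ≤ vIndex n l := by
  unfold vIndex
  have := Int.emod_nonneg (l - 1) (b := (n : ℤ)) (by omega)
  omega

theorem vIndex_le {n : ℕ} (hn : 1 ≤ n) (l : ℤ) : vIndex n l ≤ n := by
  unfold vIndex
  have := Int.emod_lt_of_pos (l - 1) (b := (n : ℤ)) (by omega)
  omega

theorem eq_of_vIndex_eq_of_zExponent_eq {n : ℕ} {l l' : ℤ} (h1 : vIndex n l = vIndex n l')
    (h2 : zExponent n l = zExponent n l') : l = l' := by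
  rw [← vIndex_sub_mul_zExponent n l, ← vIndex_sub_mul_zExponent n l', h1, h2]

/-- The factors of `evBasis` away from the positions `a` and `b`. -/
def evRest (n : ℕ) {N : ℕ} (a b : Fin N) (l m : Fin N → ℤ) (z : Fin N → K) : K :=
  ∏ i ∈ Finset.univ \ {a, b}, evFactor n (l i) (m i) (z i)

theorem evBasis_eq (n : ℕ) {N : ℕ} {a b : Fin N} (hab : a ≠ b) (l m : Fin N → ℤ)
    (z : Fin N → K) :
    evBasis n l m z =
      evRest n a b l m z * (evFactor n (l a) (m a) (z a) * evFactor n (l b) (m b) (z b)) := by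
  rw [evBasis, evRest, ← Finset.prod_sdiff (Finset.subset_univ {a, b}), Finset.prod_pair hab]

theorem evRest_congr (n : ℕ) {N : ℕ} {a b : Fin N} {l m l' m' : Fin N → ℤ} {z z' : Fin N → K}
    (hl : ∀ i, i ≠ a → i ≠ b → l i = l' i) (hm : ∀ i, i ≠ a → i ≠ b → m i = m' i)
    (hz : ∀ i, i ≠ a → i ≠ b → z i = z' i) :
    evRest n a b l m z = evRest n a b l' m' z' := by
  refine Finset.prod_congr rfl fun i hi => ?_
  simp only [Finset.mem_sdiff, Finset.mem_univ, true_and, Finset.mem_insert,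
    Finset.mem_singleton, not_or] at hi
  rw [hl i hi.1 hi.2, hm i hi.1 hi.2, hz i hi.1 hi.2]

theorem ev_place {n : ℕ} {N : ℕ} {a b : Fin N} (hab : a ≠ b) (l m : Fin N → ℤ) (z : Fin N → K)
    {p p' : ℤ} (hp1 : 1 ≤ p) (hp2 : p ≤ n) (hp1' : 1 ≤ p') (hp2' : p' ≤ n) (f : Laurent₂ K) :
    ev n m z (place n a b l p p' f) =
      evRest n a b l m z * if p = m a ∧ p' = m b then laurentEval (z a) (z b) f else 0 := by
  induction f using Finsupp.induction_linear with
  | zero => simp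
  | add f g hf hg => rw [map_add, map_add, hf, hg, map_add]; split_ifs <;> ring
  | single r c =>
    simp only [place, Finsupp.lmapDomain_apply, Finsupp.mapDomain_single, ev_single,
      laurentEval_single]
    rw [evBasis_eq n hab, evRest_congr n (l' := l) (m' := m) (z' := z)]
    · simp only [Function.update_self, Function.update_of_ne hab, evFactor,
        vIndex_sub_mul hp1 hp2, vIndex_sub_mul hp1' hp2', zExponent_sub_mul hp1 hp2,
        zExponent_sub_mul hp1' hp2']
      by_cases h1 : p = m a <;> by_cases h2 : p' = m b <;> simp [h1, h2]
      ring
    · intro i hi hi'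
      rw [Function.update_of_ne hi', Function.update_of_ne hi]
    · intros; rfl
    · intros; rfl

/-- The Demazure–Lusztig operator by which a Hecke generator acts on evaluations. -/
def demazure (q : K) {N : ℕ} (a b : Fin N) (F : (Fin N → ℤ) → (Fin N → K) → K)
    (m : Fin N → ℤ) (z : Fin N → K) : K :=
  if m a < m b then
    (-q⁻¹) * F (m ∘ Equiv.swap a b) (z ∘ Equiv.swap a b) +
      (q⁻¹ ^ 2 - 1) * ((z a * F m z - z b * F m (z ∘ Equiv.swap a b)) / (z a - z b))
  else if m a = m b then
    -F m (z ∘ Equiv.swap a b) +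
      (q⁻¹ ^ 2 - 1) * (z a * (F m z - F m (z ∘ Equiv.swap a b)) / (z a - z b))
  else
    (-q⁻¹) * F (m ∘ Equiv.swap a b) (z ∘ Equiv.swap a b) +
      (q⁻¹ ^ 2 - 1) * (z a * (F m z - F m (z ∘ Equiv.swap a b)) / (z a - z b))

/-- The cases of `heckeOnBasis` compare the colours of the input, those of `demazure` the colours at
which the output is read. They agree on the term with unchanged colours. On the term with exchanged
colours they are opposite, which is harmless because the factor `-q⁻¹` is the same in both strict
cases. -/
theorem ev_heckeOnBasis {q : K} {n : ℕ} (hn : 1 ≤ n) {N : ℕ} {a b : Fin N} (hab : a ≠ b)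
    (l m : Fin N → ℤ) {z : Fin N → K} (hz : z a ≠ z b) (ha : z a ≠ 0) (hb : z b ≠ 0) :
    ev n m z (heckeOnBasis q n a b l) = demazure q a b (fun m z => evBasis n l m z) m z := by
  have hsub : z a - z b ≠ 0 := sub_ne_zero.2 hz
  have p1 := one_le_vIndex hn (l a)
  have p2 := vIndex_le hn (l a)
  have p3 := one_le_vIndex hn (l b)
  have p4 := vIndex_le hn (l b)
  have hD : ∀ r s : ℤ, laurentEval (z a) (z b) (dividedDifference r s) =
      (z a ^ r * z b ^ s - z a ^ s * z b ^ r) / (z a - z b) := fun r s => by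
    rw [eq_div_iff hsub, mul_comm, laurentEval_dividedDifference ha hb]
  have R : ∀ (m' : Fin N → ℤ) (z' : Fin N → K), (∀ i, i ≠ a → i ≠ b → m' i = m i) →
      (∀ i, i ≠ a → i ≠ b → z' i = z i) → evRest n a b l m' z' = evRest n a b l m z :=
    fun m' z' h h' => evRest_congr n (fun _ _ _ => rfl) h h'
  have Rm : ∀ i, i ≠ a → i ≠ b → (m ∘ Equiv.swap a b) i = m i := fun i h h' => by
    simp [Equiv.swap_apply_of_ne_of_ne h h']
  have Rz : ∀ i, i ≠ a → i ≠ b → (z ∘ Equiv.swap a b) i = z i := fun i h h' => by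
    simp [Equiv.swap_apply_of_ne_of_ne h h']
  simp only [demazure, evBasis_eq n hab, R m (z ∘ Equiv.swap a b) (fun _ _ _ => rfl) Rz,
    R (m ∘ Equiv.swap a b) (z ∘ Equiv.swap a b) Rm Rz, Function.comp_apply,
    Equiv.swap_apply_left, Equiv.swap_apply_right, evFactor]
  have hL : ev n m z (heckeOnBasis q n a b l) = evRest n a b l m z *
      if vIndex n (l a) < vIndex n (l b) then
        (-q⁻¹) * (if vIndex n (l b) = m a ∧ vIndex n (l a) = m b then
            z a ^ zExponent n (l b) * z b ^ zExponent n (l a) else 0) +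
          (q⁻¹ ^ 2 - 1) * (if vIndex n (l a) = m a ∧ vIndex n (l b) = m b then
            (z a ^ zExponent n (l a) * z a * z b ^ zExponent n (l b) -
              z a ^ zExponent n (l b) * (z b ^ zExponent n (l a) * z b)) / (z a - z b) else 0)
      else if vIndex n (l a) = vIndex n (l b) then
        (if vIndex n (l a) = m a ∧ vIndex n (l b) = m b then
            -(z a ^ zExponent n (l b) * z b ^ zExponent n (l a)) +
          (q⁻¹ ^ 2 - 1) * (z a * ((z a ^ zExponent n (l a) * z b ^ zExponent n (l b) -
              z a ^ zExponent n (l b) * z b ^ zExponent n (l a)) / (z a - z b))) else 0)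
      else
        (-q⁻¹) * (if vIndex n (l b) = m a ∧ vIndex n (l a) = m b then
            z a ^ zExponent n (l b) * z b ^ zExponent n (l a) else 0) +
          (q⁻¹ ^ 2 - 1) * (if vIndex n (l a) = m a ∧ vIndex n (l b) = m b then
            z a * ((z a ^ zExponent n (l a) * z b ^ zExponent n (l b) -
              z a ^ zExponent n (l b) * z b ^ zExponent n (l a)) / (z a - z b)) else 0) := by
    have hL' : ∀ f : Laurent₂ K, _ := ev_place hab l m z p1 p2 p3 p4
    have hR' : ∀ f : Laurent₂ K, _ := ev_place hab l m z p3 p4 p1 p2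
    unfold heckeOnBasis
    simp only
    rcases lt_trichotomy (vIndex n (l a)) (vIndex n (l b)) with h | h | h
    · simp only [if_pos h, map_add, map_smul, smul_eq_mul, hL', hR', laurentEval_single, hD,
        zpow_add_one₀ ha, zpow_add_one₀ hb]
      ring_nf
    · simp only [if_neg h.not_lt, if_pos h, map_add, map_smul, map_neg, smul_eq_mul, hL',
        laurentEval_single, laurentEval_mulZ₁ ha, hD]
      split_ifs <;> ring
    · simp only [if_neg h.not_gt, if_neg h.ne', map_add, map_smul, smul_eq_mul, hL', hR',
        laurentEval_single, laurentEval_mulZ₁ ha, hD]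
      ring_nf
  rw [hL]
  generalize evRest n a b l m z = ρ
  generalize z a ^ zExponent n (l a) = x₁
  generalize z b ^ zExponent n (l a) = x₂
  generalize z a ^ zExponent n (l b) = y₁
  generalize z b ^ zExponent n (l b) = y₂
  generalize vIndex n (l a) = p
  generalize vIndex n (l b) = p'
  simp only [ite_zero_mul_ite_zero]
  -- Both sides vanish unless the colours read are those of the vector, in one order or the other.
  by_cases h1 : p = m a ∧ p' = m b
  · obtain ⟨rfl, rfl⟩ := h1
    rcases lt_trichotomy (m a) (m b) with h | h | h
    · simp [h, h.ne, h.ne']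
      ring
    · simp [h]
      ring
    · simp [h.not_gt, h.ne, h.ne']
      ring
  · by_cases h2 : p' = m a ∧ p = m b
    · obtain ⟨rfl, rfl⟩ := h2
      rcases lt_trichotomy (m a) (m b) with h | h | h
      · simp [h, h.ne, h.ne', h.not_gt]
        ring
      · simp [h] at h1
      · simp [h, h.not_gt, h.ne, h.ne']
        ring
    · have h2' : ¬(p = m b ∧ p' = m a) := fun h => h2 h.symm
      simp [h1, h2, h2']

theorem demazure_add (q : K) {N : ℕ} (a b : Fin N) (F G : (Fin N → ℤ) → (Fin N → K) → K)
    (m : Fin N → ℤ) (z : Fin N → K) :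
    demazure q a b (fun m z => F m z + G m z) m z = demazure q a b F m z + demazure q a b G m z := by
  unfold demazure
  split_ifs <;> ring

/-- Multiplication by a symmetric function commutes with the Demazure–Lusztig operators. -/
theorem demazure_mul (q : K) {N : ℕ} (a b : Fin N) (c : (Fin N → K) → K)
    (F : (Fin N → ℤ) → (Fin N → K) → K) (m : Fin N → ℤ) (z : Fin N → K)
    (hc : c (z ∘ Equiv.swap a b) = c z) :
    demazure q a b (fun m z => c z * F m z) m z = c z * demazure q a b F m z := by
  unfold demazure
  simp only [hc]
  split_ifs <;> ring

theorem ev_linearCombination_heckeOnBasis {q : K} {n : ℕ} (hn : 1 ≤ n) {N : ℕ} {a b : Fin N}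
    (hab : a ≠ b) (f : Tensor K N) (m : Fin N → ℤ) {z : Fin N → K} (hz : z a ≠ z b)
    (ha : z a ≠ 0) (hb : z b ≠ 0) :
    ev n m z (Finsupp.linearCombination K (heckeOnBasis q n a b) f) =
      demazure q a b (fun m z => ev n m z f) m z := by
  induction f using Finsupp.induction_linear with
  | zero => simp [demazure]
  | add f g hf hg => simp only [map_add, hf, hg, demazure_add]
  | single l c =>
    simp only [Finsupp.linearCombination_single, map_smul, smul_eq_mul, ev_single,
      ev_heckeOnBasis hn hab l m hz ha hb]
    rw [demazure_mul q a b (fun _ => c) (fun m z => evBasis n l m z) m z rfl]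

/-! ### A tensor is determined by its evaluations -/

/-- The monomial with exponents `r`, at the points whose coordinates are powers of the `p i`. -/
def monomialChar {N : ℕ} (p : Fin N → K) (r : Fin N → ℤ) :
    Multiplicative (Fin N → ℕ) →* K where
  toFun e := ∏ i, (p i ^ (e.toAdd i)) ^ r i
  map_one' := by simp
  map_mul' x y := by
    rw [← Finset.prod_mul_distrib]
    exact Finset.prod_congr rfl fun i _ => by rw [toAdd_mul, Pi.add_apply, pow_add, mul_zpow]

theorem monomialChar_injective [CharZero K] {N : ℕ} {p : Fin N → ℕ} (hp : ∀ i, 1 < p i) :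
    Function.Injective (monomialChar (fun i => (p i : K))) := by
  intro r s h
  funext i
  have h' := DFunLike.congr_fun h (Multiplicative.ofAdd (Pi.single i 1))
  simp only [monomialChar, MonoidHom.coe_mk, OneHom.coe_mk, toAdd_ofAdd] at h'
  rw [Finset.prod_eq_single i, Finset.prod_eq_single i] at h'
  · simp only [Pi.single_eq_same, pow_one] at h'
    -- The powers are compared in `ℚ`, where the order makes them distinct; characteristic zero
    -- allows the passage from `K`.
    have h2 : ((p i : ℚ) ^ r i) = (p i : ℚ) ^ s i := by
      have : (((p i : ℚ) ^ r i : ℚ) : K) = (((p i : ℚ) ^ s i : ℚ) : K) := by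
        push_cast; exact h'
      exact_mod_cast this
    have hp1 : (1 : ℚ) < p i := by exact_mod_cast hp i
    exact zpow_right_injective₀ (by linarith) hp1.ne' h2
  · intro j _ hj; simp [hj]
  · simp
  · intro j _ hj; simp [hj]
  · simp

/-- Dedekind's independence of characters: for fixed colours, distinct basis vectors restrict to
distinct characters of the monoid `ℕ^N` on the points whose `i`-th coordinate is a power of the
`i`-th prime. -/
theorem eq_zero_of_ev_eq_zero [CharZero K] (n : ℕ) {N : ℕ} (f : Tensor K N)
    (h : ∀ m (z : Fin N → K), Function.Injective z → (∀ i, z i ≠ 0) → ev n m z f = 0) :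
    f = 0 := by
  classical
  let p : Fin N → ℕ := fun i => Nat.nth Nat.Prime i
  have hp : ∀ i, (p i).Prime := fun i => Nat.prime_nth_prime i
  have hpinj : Function.Injective p := fun i j hij =>
    Fin.ext (Nat.nth_injective Nat.infinite_setOfPred_prime hij)
  ext l₀
  rw [Finsupp.zero_apply]
  let m : Fin N → ℤ := fun i => vIndex n (l₀ i)
  have hli := (linearIndependent_monoidHom (Multiplicative (Fin N → ℕ)) K).comp
    (fun l : {l : Fin N → ℤ // (fun i => vIndex n (l i)) = m} =>
      monomialChar (fun i => (p i : K)) (fun i => zExponent n (l.1 i)))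
    (by
      intro l l' hll
      have := monomialChar_injective (K := K) (fun i => (hp i).one_lt) hll
      apply Subtype.ext
      funext i
      exact eq_of_vIndex_eq_of_zExponent_eq
        ((congrFun l.2 i).trans (congrFun l'.2 i).symm) (congrFun this i))
  rw [linearIndependent_iff'] at hli
  by_contra hne
  have := hli (f.support.subtype _)
    (fun l => f l.1 * ∏ i, (p i : K) ^ zExponent n (l.1 i)) ?_ ⟨l₀, rfl⟩ (by simpa using hne)
  · refine (mul_ne_zero hne ?_) this
    exact Finset.prod_ne_zero_iff.2 fun i _ => zpow_ne_zero _ (by exact_mod_cast (hp i).ne_zero)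
  · funext e
    -- The exponents are raised by one so that the coordinates are distinct even where `e` vanishes;
    -- the extra factor `∏ p i ^ zExponent` has been put into the coefficients.
    have hev := h m (fun i => (p i : K) ^ (e.toAdd i + 1)) ?_ ?_
    · rw [ev, Finsupp.linearCombination_apply, Finsupp.sum] at hev
      rw [Finset.sum_apply, Pi.zero_apply, ← hev]
      rw [← Finset.sum_subset (Finset.filter_subset
        (fun l : Fin N → ℤ => (fun i => vIndex n (l i)) = m) f.support)]
      · rw [← Finset.subtype_map, Finset.sum_map]
        refine Finset.sum_congr rfl fun l _ => ?_
        simp only [Pi.smul_apply, Function.comp_apply, monomialChar, MonoidHom.coe_mk,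
          OneHom.coe_mk, smul_eq_mul, evBasis, Function.Embedding.subtype_apply, mul_assoc,
          ← Finset.prod_mul_distrib]
        congr 1
        refine Finset.prod_congr rfl fun i _ => ?_
        rw [evFactor, if_pos (congrFun l.2 i), ← mul_zpow, pow_succ']
      · intro l hl hl'
        simp only [Finset.mem_filter, hl, true_and] at hl'
        obtain ⟨i, hi⟩ := Function.ne_iff.1 hl'
        rw [evBasis, Finset.prod_eq_zero (Finset.mem_univ i), smul_zero]
        rw [evFactor, if_neg hi]
    · intro i j hij
      simp only at hij
      have h2 : p i ^ (e.toAdd i + 1) = p j ^ (e.toAdd j + 1) := by exact_mod_cast hij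
      have h3 : p i ∣ p j := (hp i).dvd_of_dvd_pow (h2 ▸ dvd_pow_self _ (Nat.succ_ne_zero _))
      exact hpinj ((Nat.prime_dvd_prime_iff_eq (hp i) (hp j)).1 h3)
    · intro i
      exact pow_ne_zero _ (by exact_mod_cast (hp i).ne_zero)

theorem eq_of_ev_eq [CharZero K] (n : ℕ) {N : ℕ} {f g : Tensor K N}
    (h : ∀ m (z : Fin N → K), Function.Injective z → (∀ i, z i ≠ 0) →
      ev n m z f = ev n m z g) : f = g :=
  sub_eq_zero.1 (eq_zero_of_ev_eq_zero n _ fun m z h1 h2 => by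
    rw [map_sub, h m z h1 h2, sub_self])

end QFock
end

/-! ### Braid and commutation relations of the Hecke generators -/

noncomputable section

namespace QFock

variable {K : Type*} [Field K]

/-- The Demazure–Lusztig operator in the first two of three factors. -/
def demazureLeft (α β : K) (G : ℤ → ℤ → ℤ → K → K → K → K) (a b c : ℤ) (x y w : K) : K :=
  if a < b then
    (-α) * G b a c y x w + β * ((x * G a b c x y w - y * G a b c y x w) / (x - y))
  else if a = b then
    -G a b c y x w + β * (x * (G a b c x y w - G a b c y x w) / (x - y))
  else
    (-α) * G b a c y x w + β * (x * (G a b c x y w - G a b c y x w) / (x - y))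

/-- The Demazure–Lusztig operator in the last two of three factors. -/
def demazureRight (α β : K) (G : ℤ → ℤ → ℤ → K → K → K → K) (a b c : ℤ) (x y w : K) : K :=
  if b < c then
    (-α) * G a c b x w y + β * ((y * G a b c x y w - w * G a b c x w y) / (y - w))
  else if b = c then
    -G a b c x w y + β * (y * (G a b c x y w - G a b c x w y) / (y - w))
  else
    (-α) * G a c b x w y + β * (y * (G a b c x y w - G a b c x w y) / (y - w))

-- Once the relative order of the three colours is fixed, all branches are known and both sides are
-- combinations of values of `G` at permuted arguments, with rational functions of `x, y, w` as
-- coefficients. The claim is then a rational identity.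
set_option maxHeartbeats 4000000 in
theorem demazure_braid_aux {α β : K} (hβ : β = α ^ 2 - 1) (G : ℤ → ℤ → ℤ → K → K → K → K)
    (a b c : ℤ) {x y w : K} (hxy : x ≠ y) (hxw : x ≠ w) (hyw : y ≠ w) :
    demazureLeft α β (demazureRight α β (demazureLeft α β G)) a b c x y w =
      demazureRight α β (demazureLeft α β (demazureRight α β G)) a b c x y w := by
  have h1 : x - y ≠ 0 := sub_ne_zero.2 hxy
  have h2 : x - w ≠ 0 := sub_ne_zero.2 hxw
  have h3 : y - w ≠ 0 := sub_ne_zero.2 hyw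
  have e1 : y - x = -(x - y) := by ring
  have e3 : w - y = -(y - w) := by ring
  rcases lt_trichotomy a b with hab | hab | hab <;>
  rcases lt_trichotomy b c with hbc | hbc | hbc <;>
  rcases lt_trichotomy a c with hac | hac | hac <;>
  first
  | (exfalso; omega)
  | (try subst hab
     try subst hbc
     try subst hac
     simp (disch := omega) only [demazureLeft, demazureRight, e1, e3, if_pos, if_neg, if_true]
     field_simp
     -- The relation `β = α ^ 2 - 1` is substituted only for those orders of the colours in which
     -- the identity fails for independent `α` and `β`.
     first
     | ring1
     | (subst hβ; ring1))

end QFock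
end

noncomputable section

namespace QFock

variable {K : Type*} [Field K]

theorem update_update_comp_swap {ι X : Type*} [DecidableEq ι] (m : ι → X) (i j : ι) (hij : i ≠ j)
    (a b : X) :
    Function.update (Function.update m i a) j b ∘ Equiv.swap i j =
      Function.update (Function.update m i b) j a := by
  funext t
  by_cases hi : t = i
  · subst hi; simp [hij]
  · by_cases hj : t = j
    · subst hj; simp [hij]
    · simp [Equiv.swap_apply_of_ne_of_ne hi hj, hi, hj]

/-- `m` with the entries at `i`, `j`, `k` replaced by `a`, `b`, `c`. -/
def update₃ {ι X : Type*} [DecidableEq ι] (m : ι → X) (i j k : ι) (a b c : X) : ι → X :=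
  Function.update (Function.update (Function.update m i a) j b) k c

theorem update₃_comp_swap_left {ι X : Type*} [DecidableEq ι] (m : ι → X) {i j k : ι}
    (hij : i ≠ j) (hik : i ≠ k) (hjk : j ≠ k) (a b c : X) :
    update₃ m i j k a b c ∘ Equiv.swap i j = update₃ m i j k b a c := by
  have h : ∀ a b, update₃ m i j k a b c = 
      Function.update (Function.update (Function.update m k c) i a) j b := fun a b => by
    rw [update₃, Function.update_comm hjk, Function.update_comm hik]
  rw [h, h, update_update_comp_swap _ _ _ hij]

theorem update₃_comp_swap_right {ι X : Type*} [DecidableEq ι] (m : ι → X) {i j k : ι}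
    (hjk : j ≠ k) (a b c : X) :
    update₃ m i j k a b c ∘ Equiv.swap j k = update₃ m i j k a c b :=
  update_update_comp_swap _ _ _ hjk _ _

theorem demazure_update₃_left (q : K) {N : ℕ} {i j k : Fin N} (hij : i ≠ j) (hik : i ≠ k)
    (hjk : j ≠ k) (F : (Fin N → ℤ) → (Fin N → K) → K) (m : Fin N → ℤ) (z : Fin N → K) :
    (fun a b c x y w => demazure q i j F (update₃ m i j k a b c) (update₃ z i j k x y w)) =
      demazureLeft q⁻¹ (q⁻¹ ^ 2 - 1)
        (fun a b c x y w => F (update₃ m i j k a b c) (update₃ z i j k x y w)) := by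
  funext a b c x y w
  simp only [demazure, demazureLeft, update₃_comp_swap_left _ hij hik hjk]
  simp [update₃, hij, hik, hjk]

theorem demazure_update₃_right (q : K) {N : ℕ} {i j k : Fin N} (hjk : j ≠ k)
    (F : (Fin N → ℤ) → (Fin N → K) → K) (m : Fin N → ℤ) (z : Fin N → K) :
    (fun a b c x y w => demazure q j k F (update₃ m i j k a b c) (update₃ z i j k x y w)) =
      demazureRight q⁻¹ (q⁻¹ ^ 2 - 1)
        (fun a b c x y w => F (update₃ m i j k a b c) (update₃ z i j k x y w)) := by
  funext a b c x y w
  simp only [demazure, demazureRight, update₃_comp_swap_right _ hjk]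
  simp [update₃, hjk]

/-- Only the entries at `i`, `j`, `k` are touched. Freezing the others turns `F` into a function of
three colours and three points. -/
theorem demazure_braid (q : K) {N : ℕ} {i j k : Fin N} (hij : i ≠ j) (hik : i ≠ k)
    (hjk : j ≠ k) (F : (Fin N → ℤ) → (Fin N → K) → K) (m : Fin N → ℤ) {z : Fin N → K}
    (hz : Function.Injective z) :
    demazure q i j (demazure q j k (demazure q i j F)) m z =
      demazure q j k (demazure q i j (demazure q j k F)) m z := by
  have key := demazure_braid_aux (α := q⁻¹) rfl
    (fun a b c x y w => F (update₃ m i j k a b c) (update₃ z i j k x y w)) (m i) (m j) (m k)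
    (hz.ne hij) (hz.ne hik) (hz.ne hjk)
  rw [← demazure_update₃_left q hij hik hjk, ← demazure_update₃_right q hjk,
    ← demazure_update₃_left q hij hik hjk, ← demazure_update₃_right q hjk,
    ← demazure_update₃_left q hij hik hjk, ← demazure_update₃_right q hjk] at key
  simpa [update₃] using key

theorem comp_swap_comm {ι X : Type*} [DecidableEq ι] {a b c d : ι} (hac : a ≠ c) (had : a ≠ d)
    (hbc : b ≠ c) (hbd : b ≠ d) (f : ι → X) :
    (f ∘ Equiv.swap c d) ∘ Equiv.swap a b = (f ∘ Equiv.swap a b) ∘ Equiv.swap c d := by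
  have hd : Equiv.Perm.Disjoint (Equiv.swap a b) (Equiv.swap c d) := by
    intro t
    by_cases ha : t = a
    · right; rw [ha, Equiv.swap_apply_of_ne_of_ne hac had]
    · by_cases hb : t = b
      · right; rw [hb, Equiv.swap_apply_of_ne_of_ne hbc hbd]
      · left; exact Equiv.swap_apply_of_ne_of_ne ha hb
  funext t
  exact congrArg f (DFunLike.congr_fun hd.commute.eq t).symm

theorem demazure_comm (q : K) {N : ℕ} {a b c d : Fin N} (hac : a ≠ c) (had : a ≠ d)
    (hbc : b ≠ c) (hbd : b ≠ d) (F : (Fin N → ℤ) → (Fin N → K) → K) (m : Fin N → ℤ)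
    (z : Fin N → K) :
    demazure q a b (demazure q c d F) m z = demazure q c d (demazure q a b F) m z := by
  have h1 : Equiv.swap a b c = c := Equiv.swap_apply_of_ne_of_ne hac.symm hbc.symm
  have h2 : Equiv.swap a b d = d := Equiv.swap_apply_of_ne_of_ne had.symm hbd.symm
  have h3 : Equiv.swap c d a = a := Equiv.swap_apply_of_ne_of_ne hac had
  have h4 : Equiv.swap c d b = b := Equiv.swap_apply_of_ne_of_ne hbc hbd
  simp only [demazure, Function.comp_apply, h1, h2, h3, h4, comp_swap_comm hac had hbc hbd m,
    comp_swap_comm hac had hbc hbd z]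
  split_ifs <;> ring

/-- The set of points with distinct non-zero coordinates is stable under exchanges, so identities
known only there may be used inside the operators and iterated. -/
theorem demazure_congr (q : K) {N : ℕ} (a b : Fin N) {F G : (Fin N → ℤ) → (Fin N → K) → K}
    (h : ∀ m (z : Fin N → K), Function.Injective z → (∀ i, z i ≠ 0) → F m z = G m z)
    (m : Fin N → ℤ) {z : Fin N → K} (hz : Function.Injective z) (h0 : ∀ i, z i ≠ 0) :
    demazure q a b F m z = demazure q a b G m z := by
  have hz' : Function.Injective (z ∘ Equiv.swap a b) := hz.comp (Equiv.injective _)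
  simp only [demazure, h _ z hz h0, h _ _ hz' fun i => h0 _]

theorem ev_heckeT {q : K} {n : ℕ} (hn : 1 ≤ n) {N i : ℕ} (hi : i + 1 < N) (f : Tensor K N)
    (m : Fin N → ℤ) {z : Fin N → K} (hz : Function.Injective z) (h0 : ∀ i, z i ≠ 0) :
    ev n m z (heckeT q n N i f) =
      demazure q ⟨i, Nat.lt_of_succ_lt hi⟩ ⟨i + 1, hi⟩ (fun m z => ev n m z f) m z := by
  have hne : (⟨i, Nat.lt_of_succ_lt hi⟩ : Fin N) ≠ ⟨i + 1, hi⟩ := by simp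
  rw [heckeT, dif_pos hi]
  exact ev_linearCombination_heckeOnBasis hn hne f m (hz.ne hne) (h0 _) (h0 _)

theorem heckeT_braid [CharZero K] (q : K) {n : ℕ} (hn : 1 ≤ n) {N i : ℕ} (hi : i + 2 < N)
    (f : Tensor K N) :
    heckeT q n N i (heckeT q n N (i + 1) (heckeT q n N i f)) =
      heckeT q n N (i + 1) (heckeT q n N i (heckeT q n N (i + 1) f)) := by
  have hi' : i + 1 < N := by omega
  refine eq_of_ev_eq n fun m z hz h0 => ?_
  have e1 : ∀ m (z : Fin N → K), Function.Injective z → (∀ i, z i ≠ 0) →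
      ev n m z (heckeT q n N (i + 1) (heckeT q n N i f)) = _ := fun m z hz h0 =>
    (ev_heckeT hn hi _ m hz h0).trans
      (demazure_congr q _ _ (fun m z hz h0 => ev_heckeT hn hi' f m hz h0) m hz h0)
  have e2 : ∀ m (z : Fin N → K), Function.Injective z → (∀ i, z i ≠ 0) →
      ev n m z (heckeT q n N i (heckeT q n N (i + 1) f)) = _ := fun m z hz h0 =>
    (ev_heckeT hn hi' _ m hz h0).trans
      (demazure_congr q _ _ (fun m z hz h0 => ev_heckeT hn hi f m hz h0) m hz h0)
  rw [ev_heckeT hn hi' _ m hz h0, ev_heckeT hn hi _ m hz h0, demazure_congr q _ _ e1 m hz h0,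
    demazure_congr q _ _ e2 m hz h0]
  refine demazure_braid q ?_ ?_ ?_ _ m hz <;> rw [Ne, Fin.mk.injEq] <;> omega

theorem heckeT_comm [CharZero K] (q : K) {n : ℕ} (hn : 1 ≤ n) {N i j : ℕ} (hij : i + 1 < j)
    (f : Tensor K N) :
    heckeT q n N i (heckeT q n N j f) = heckeT q n N j (heckeT q n N i f) := by
  by_cases hj : j + 1 < N
  · have hi : i + 1 < N := by omega
    refine eq_of_ev_eq n fun m z hz h0 => ?_
    rw [ev_heckeT hn hi _ m hz h0, ev_heckeT hn hj _ m hz h0,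
      demazure_congr q _ _ (fun m z hz h0 => ev_heckeT hn hj f m hz h0) m hz h0,
      demazure_congr q _ _ (fun m z hz h0 => ev_heckeT hn hi f m hz h0) m hz h0]
    refine demazure_comm q ?_ ?_ ?_ ?_ _ m z <;> rw [Ne, Fin.mk.injEq] <;> omega
  · rw [show heckeT q n N j = 0 from dif_neg hj]
    simp

/-! ### The antisymmetrizer as a product -/

theorem heckeWord_foldl (q : K) (n N : ℕ) (w : List ℕ) (g : Tensor K N →ₗ[K] Tensor K N) :
    w.foldl (fun f i => heckeT q n N i ∘ₗ f) g = heckeWord q n N w ∘ₗ g := by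
  induction w generalizing g with
  | nil => rfl
  | cons i w ih =>
    rw [heckeWord, List.foldl_cons, List.foldl_cons, ih, ih]
    rfl

theorem heckeWord_cons (q : K) (n N i : ℕ) (w : List ℕ) :
    heckeWord q n N (i :: w) = heckeWord q n N w ∘ₗ heckeT q n N i := by
  rw [heckeWord, List.foldl_cons, heckeWord_foldl]
  rfl

theorem heckeWord_append (q : K) (n N : ℕ) (w w' : List ℕ) :
    heckeWord q n N (w ++ w') = heckeWord q n N w' ∘ₗ heckeWord q n N w := by
  rw [heckeWord, List.foldl_append, heckeWord_foldl]
  rfl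

/-- `1 + T_{j-1} + T_{j-1} T_{j-2} + ⋯ + T_{j-1} ⋯ T_0`, for the right action. -/
def cosetSum (q : K) (n N : ℕ) : ℕ → Tensor K N →ₗ[K] Tensor K N
  | 0 => LinearMap.id
  | j + 1 => LinearMap.id + cosetSum q n N j ∘ₗ heckeT q n N j

/-- The product of the first `j` of the sums `cosetSum`. -/
def cosetProd (q : K) (n N : ℕ) : ℕ → Tensor K N →ₗ[K] Tensor K N
  | 0 => LinearMap.id
  | j + 1 => cosetSum q n N j ∘ₗ cosetProd q n N j

theorem cosetSum_apply (q : K) (n N j : ℕ) (f : Tensor K N) :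
    cosetSum q n N j f =
      ∑ c : Fin (j + 1), heckeWord q n N ((List.range c).map fun s => j - 1 - s) f := by
  induction j generalizing f with
  | zero => simp [cosetSum, heckeWord]
  | succ j ih =>
    rw [Fin.sum_univ_succ, cosetSum, LinearMap.add_apply, LinearMap.comp_apply, ih]
    refine congrArg₂ _ rfl (Finset.sum_congr rfl fun c _ => ?_)
    rw [Fin.val_succ, List.range_succ_eq_map, List.map_cons, heckeWord_cons, List.map_map,
      LinearMap.comp_apply]
    have : (fun s => j + 1 - 1 - s) ∘ Nat.succ = fun s => j - 1 - s := by
      funext s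
      simp only [Function.comp_apply]
      omega
    rw [this]
    rfl

/-- Expanding the product amounts to choosing a length `c i ≤ i` in each factor. Such tuples are the
inversion tables of permutations, and the concatenated words are those of `reducedWord`. -/
theorem cosetProd_apply (q : K) (n N j : ℕ) (f : Tensor K N) :
    cosetProd q n N j f =
      ∑ c : ∀ i : Fin j, Fin (i + 1), heckeWord q n N ((List.finRange j).flatMap fun i =>
        (List.range (c i)).map fun s => (i : ℕ) - 1 - s) f := by
  induction j generalizing f with
  | zero => simp [cosetProd, heckeWord]
  | succ j ih =>
    rw [cosetProd, LinearMap.comp_apply, ih, cosetSum_apply,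
      ← (Fin.snocEquiv fun i : Fin (j + 1) => Fin (i + 1)).sum_comp, Fintype.sum_prod_type]
    refine Finset.sum_congr rfl fun a _ => ?_
    rw [map_sum]
    refine Finset.sum_congr rfl fun c _ => ?_
    rw [List.finRange_succ_last, List.flatMap_append, heckeWord_append, LinearMap.comp_apply,
      List.flatMap_map]
    simp [Fin.snocEquiv]

/-! ### Inversion numbers determine a permutation -/

theorem inversions_lt {N : ℕ} (σ : Equiv.Perm (Fin N)) (j : Fin N) : inversions σ j < j + 1 := by
  rw [Nat.lt_succ_iff]
  calc inversions σ j ≤ (Finset.Iio j).card :=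
        Finset.card_le_card fun i hi => by simpa using (Finset.mem_filter.1 hi).2.1
    _ = j := by simp

/-- If `σ⁻¹` and `τ⁻¹` agree beyond `j` and `σ⁻¹ j < τ⁻¹ j`, then `j` has more inversions in
`σ` than in `τ`. -/
theorem inversions_lt_inversions {N : ℕ} {σ τ : Equiv.Perm (Fin N)} {j : Fin N}
    (h : ∀ i, j < i → σ.symm i = τ.symm i) (hj : σ.symm j < τ.symm j) :
    inversions τ j < inversions σ j := by
  -- Counting positions instead of values: those to the right of `j` that are not occupied by a
  -- value above `j`. In this form only the positions of `j` and of larger values matter.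
  have key : ∀ ρ : Equiv.Perm (Fin N), inversions ρ j =
      (Finset.univ.filter fun v => ρ.symm j < v ∧ ∀ i, j < i → v ≠ ρ.symm i).card := by
    intro ρ
    rw [inversions]
    refine Finset.card_bij (fun i _ => ρ.symm i) ?_ (fun i _ i' _ h => ρ.symm.injective h) ?_
    · intro i hi
      simp only [Finset.mem_filter, Finset.mem_univ, true_and] at hi ⊢
      exact ⟨hi.2, fun i' hi' he => (hi.1.trans hi').ne (ρ.symm.injective he)⟩
    · intro v hv
      simp only [Finset.mem_filter, Finset.mem_univ, true_and] at hv
      refine ⟨ρ v, ?_, by simp⟩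
      simp only [Finset.mem_filter, Finset.mem_univ, true_and, Equiv.symm_apply_apply]
      refine ⟨?_, hv.1⟩
      rcases lt_trichotomy (ρ v) j with h | h | h
      · exact h
      · rw [← h] at hv; simp at hv
      · exact absurd (by simp) (hv.2 _ h)
  rw [key, key]
  refine Finset.card_lt_card (Finset.ssubset_iff_of_subset ?_ |>.2 ⟨τ.symm j, ?_, ?_⟩)
  · intro v hv
    simp only [Finset.mem_filter, Finset.mem_univ, true_and] at hv ⊢
    exact ⟨hj.trans hv.1, fun i hi => h i hi ▸ hv.2 i hi⟩
  · simp only [Finset.mem_filter, Finset.mem_univ, true_and]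
    refine ⟨hj, fun i hi he => ?_⟩
    rw [h i hi] at he
    exact hi.ne (τ.symm.injective he)
  · simp

theorem inversions_injective {N : ℕ} {σ τ : Equiv.Perm (Fin N)}
    (h : ∀ j, inversions σ j = inversions τ j) : σ = τ := by
  -- Descending induction on `j`: the position of the largest value is found first.
  have key : ∀ d : ℕ, ∀ j : Fin N, N ≤ j + d → σ.symm j = τ.symm j := by
    intro d
    induction d with
    | zero => intro j hj; have := j.2; omega
    | succ d ih =>
      intro j _
      have hgt : ∀ i, j < i → σ.symm i = τ.symm i := fun i hi =>
        ih i (by have : (j : ℕ) < i := hi; omega)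
      rcases lt_trichotomy (σ.symm j) (τ.symm j) with hlt | he | hlt
      · exact absurd (h j) (inversions_lt_inversions hgt hlt).ne'
      · exact he
      · exact absurd (h j) (inversions_lt_inversions (fun i hi => (hgt i hi).symm) hlt).ne
  have : σ.symm = τ.symm := Equiv.ext fun j => key N j (by omega)
  exact Equiv.symm_bijective.injective this

/-- A permutation is determined by its inversion numbers, which are arbitrary. -/
def inversionsEquiv (N : ℕ) : Equiv.Perm (Fin N) ≃ ∀ j : Fin N, Fin (j + 1) :=
  Equiv.ofBijective (fun σ j => ⟨inversions σ j, inversions_lt σ j⟩) <| by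
    rw [Fintype.bijective_iff_injective_and_card]
    refine ⟨fun σ τ h => inversions_injective fun j => ?_, ?_⟩
    · simpa using congrFun h j
    · rw [Fintype.card_perm, Fintype.card_pi]
      simp only [Fintype.card_fin]
      rw [Fin.prod_univ_eq_prod_range (fun j => j + 1), Finset.prod_range_add_one_eq_factorial]

theorem antisymmetrizer_eq_cosetProd (q : K) (n N : ℕ) :
    antisymmetrizer q n N = cosetProd q n N N := by
  refine LinearMap.ext fun f => ?_
  rw [cosetProd_apply,
    ← (inversionsEquiv N).sum_comp, antisymmetrizer, LinearMap.sum_apply]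
  rfl

/-! ### The kernel of the antisymmetrizer -/

theorem cosetSum_comm [CharZero K] (q : K) {n : ℕ} (hn : 1 ≤ n) {N i j : ℕ} (hij : i < j)
    (f : Tensor K N) :
    cosetSum q n N i (heckeT q n N j f) = heckeT q n N j (cosetSum q n N i f) := by
  induction i generalizing f with
  | zero => rfl
  | succ i ih =>
    simp only [cosetSum, LinearMap.add_apply, LinearMap.comp_apply, LinearMap.id_apply, map_add,
      heckeT_comm q hn hij, ih (Nat.lt_of_succ_lt hij)]

theorem cosetProd_comm [CharZero K] (q : K) {n : ℕ} (hn : 1 ≤ n) {N i j : ℕ} (hij : i ≤ j)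
    (f : Tensor K N) :
    cosetProd q n N i (heckeT q n N j f) = heckeT q n N j (cosetProd q n N i f) := by
  induction i generalizing f with
  | zero => rfl
  | succ i ih =>
    simp only [cosetProd, LinearMap.comp_apply, ih (Nat.le_of_succ_le hij),
      cosetSum_comm q hn (Nat.lt_of_succ_le hij)]

/-- Write `S_j` for the coset sums, so that `S_{j+1} = 1 + S_j T_j` as operators, and let `t = s +
1`. Then `S_{s+1} f = f + S_s T_s f`, and `T_{s+1}` sends this to `-f + T_{s+1} S_s T_s f`. Applying
`S_{s+1}` kills the second summand by induction, so `S_{s+2} S_{s+1} f` is the sum of `S_{s+1} f`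
and its negative. -/
theorem cosetSum_cosetSum_eq_zero [CharZero K] (q : K) {n : ℕ} (hn : 1 ≤ n) {N t : ℕ}
    (ht : t + 1 < N) {f : Tensor K N} (hf : heckeT q n N t f = -f) :
    cosetSum q n N (t + 1) (cosetSum q n N t f) = 0 := by
  induction t generalizing f with
  | zero => simp [cosetSum, hf]
  | succ s ih =>
    -- By the braid relation, `T_{s+1} T_s f` is an eigenvector of `T_s` for the eigenvalue `-1`, so
    -- the induction hypothesis applies to it.
    have h' := ih (Nat.lt_of_succ_lt ht)
      (f := heckeT q n N (s + 1) (heckeT q n N s f)) (by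
        rw [heckeT_braid q hn ht, hf, map_neg, map_neg])
    have e : ∀ g, cosetSum q n N (s + 1) g = g + cosetSum q n N s (heckeT q n N s g) :=
      fun _ => rfl
    have e' : ∀ g, cosetSum q n N (s + 2) g =
      g + cosetSum q n N (s + 1) (heckeT q n N (s + 1) g) := fun _ => rfl
    rw [cosetSum_comm q hn (Nat.lt_succ_self s)] at h'
    rw [e', e f, map_add, map_add, hf, h', map_neg, e f]
    abel

/-- The first `t` factors of the product involve only generators that commute with `T_t`, so they
preserve the eigenvector. The next two factors annihilate it. -/
theorem antisymmetrizer_eq_zero [CharZero K] (q : K) {n : ℕ} (hn : 1 ≤ n) {N t : ℕ}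
    (ht : t + 1 < N) {f : Tensor K N} (hf : heckeT q n N t f = -f) :
    antisymmetrizer q n N f = 0 := by
  rw [antisymmetrizer_eq_cosetProd]
  have h2 : cosetProd q n N (t + 2) f = 0 := by
    refine cosetSum_cosetSum_eq_zero q hn ht ?_
    rw [← cosetProd_comm q hn le_rfl, hf, map_neg]
  have : ∀ d, cosetProd q n N (t + 2 + d) f = 0 := by
    intro d
    induction d with
    | zero => exact h2
    | succ d ih => rw [← add_assoc, cosetProd, LinearMap.comp_apply, ih, map_zero]
  obtain ⟨d, rfl⟩ : ∃ d, N = t + 2 + d := ⟨N - (t + 2), by omega⟩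
  exact this d

theorem toWedge_eq_zero_iff (q : K) (n : ℕ) {N : ℕ} (f : Tensor K N) :
    toWedge q n N f = 0 ↔ antisymmetrizer q n N f = 0 :=
  (Submodule.Quotient.mk_eq_zero (LinearMap.ker (antisymmetrizer q n N))).trans LinearMap.mem_ker

/-! ### Symmetric Laurent polynomials in the `y_i` commute with the antisymmetrizer -/

theorem vIndex_add_mul (n : ℕ) (l a : ℤ) : vIndex n (l + n * a) = vIndex n l := by
  unfold vIndex
  rw [show l + n * a - 1 = l - 1 + n * a by ring, Int.add_mul_emod_self_left]

theorem zExponent_add_mul {n : ℕ} (hn : 1 ≤ n) (l a : ℤ) :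
    zExponent n (l + n * a) = zExponent n l - a := by
  unfold zExponent
  rw [show l + n * a - 1 = l - 1 + n * a by ring, Int.add_mul_ediv_left _ _ (by omega)]
  ring

theorem ev_yMonomial {n : ℕ} (hn : 1 ≤ n) {N : ℕ} (a m : Fin N → ℤ) {z : Fin N → K}
    (h0 : ∀ i, z i ≠ 0) (f : Tensor K N) :
    ev n m z (yMonomial K n a f) = (∏ i, z i ^ (-a i)) * ev n m z f := by
  induction f using Finsupp.induction_linear with
  | zero => simp
  | add f g hf hg => rw [map_add, map_add, hf, hg, map_add, mul_add]
  | single l c =>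
    rw [yMonomial, Finsupp.lmapDomain_apply, Finsupp.mapDomain_single, ev_single, ev_single,
      mul_left_comm, evBasis, evBasis, ← Finset.prod_mul_distrib]
    congr 1
    refine Finset.prod_congr rfl fun i _ => ?_
    rw [evFactor, evFactor, vIndex_add_mul, zExponent_add_mul hn, mul_ite, mul_zero,
      sub_eq_neg_add, zpow_add₀ (h0 i)]

/-- `e_k(y_1^ε, …, y_N^ε)`. -/
def esymmPow (K : Type*) [Field K] (n k : ℕ) (ε : ℤ) (N : ℕ) : Tensor K N →ₗ[K] Tensor K N :=
  ∑ S ∈ (Finset.univ : Finset (Fin N)).powersetCard k,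
    yMonomial K n fun i => if i ∈ S then ε else 0

/-- On evaluations the operator is multiplication by a symmetric function of `z`, which passes
through the Demazure–Lusztig operators. -/
theorem heckeT_esymmPow [CharZero K] (q : K) {n : ℕ} (hn : 1 ≤ n) (k : ℕ) (ε : ℤ) {N : ℕ}
    (i : ℕ) (f : Tensor K N) :
    heckeT q n N i (esymmPow K n k ε N f) = esymmPow K n k ε N (heckeT q n N i f) := by
  by_cases hi : i + 1 < N
  · let c : (Fin N → K) → K := fun z =>
      ∑ S ∈ (Finset.univ : Finset (Fin N)).powersetCard k, ∏ i, z i ^ (-if i ∈ S then ε else 0)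
    have hc : ∀ (g : Tensor K N) m (z : Fin N → K), (∀ i, z i ≠ 0) →
        ev n m z (esymmPow K n k ε N g) = c z * ev n m z g := by
      intro g m z h0
      rw [esymmPow, LinearMap.sum_apply, map_sum, Finset.sum_mul]
      exact Finset.sum_congr rfl fun S _ => ev_yMonomial hn _ m h0 g
    have hs : ∀ (s : Equiv.Perm (Fin N)) (z : Fin N → K), c (z ∘ s) = c z := by
      intro s z
      refine Finset.sum_equiv (Equiv.finsetCongr s) (fun S => ?_) fun S _ => ?_
      · simp [Finset.mem_powersetCard]
      · refine Fintype.prod_equiv s _ _ fun i => ?_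
        simp
    refine eq_of_ev_eq n fun m z hz h0 => ?_
    rw [ev_heckeT hn hi _ m hz h0, hc _ m z h0, ev_heckeT hn hi _ m hz h0,
      ← demazure_mul q _ _ c _ m z (hs _ z)]
    exact demazure_congr q _ _ (fun m z _ h0 => hc f m z h0) m hz h0
  · rw [show heckeT q n N i = 0 from dif_neg hi]
    simp

theorem antisymmetrizer_comm (q : K) (n : ℕ) {N : ℕ} (X : Tensor K N →ₗ[K] Tensor K N)
    (hX : ∀ i f, heckeT q n N i (X f) = X (heckeT q n N i f)) (f : Tensor K N) :
    antisymmetrizer q n N (X f) = X (antisymmetrizer q n N f) := by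
  have hw : ∀ (w : List ℕ) f, heckeWord q n N w (X f) = X (heckeWord q n N w f) := by
    intro w
    induction w with
    | nil => intro f; rfl
    | cons i w ih =>
      intro f
      rw [heckeWord_cons, LinearMap.comp_apply, LinearMap.comp_apply, hX, ih]
  rw [antisymmetrizer, LinearMap.sum_apply, LinearMap.sum_apply, map_sum]
  exact Finset.sum_congr rfl fun σ _ => hw _ f

/-! ### Extension by a vacuum vector -/

theorem extend_single (N : ℕ) (l : Fin N → ℤ) (c : K) :
    extend K N (Finsupp.single l c) =
      Finsupp.single (Fin.snoc (α := fun _ => ℤ) l (-(N : ℤ))) c := by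
  rw [extend, Finsupp.lmapDomain_apply, Finsupp.mapDomain_single]

theorem place_castSucc (n : ℕ) {N : ℕ} (a b : Fin N) (l : Fin N → ℤ) (m m' : ℤ)
    (f : Laurent₂ K) :
    place n a.castSucc b.castSucc (Fin.snoc (α := fun _ => ℤ) l (-(N : ℤ))) m m' f =
      extend K N (place n a b l m m' f) := by
  induction f using Finsupp.induction_linear with
  | zero => simp
  | add f g hf hg => simp only [map_add, hf, hg]
  | single r c =>
    simp only [place, Finsupp.lmapDomain_apply, Finsupp.mapDomain_single, extend_single,
      Fin.snoc_update]

theorem heckeT_extend (q : K) (n : ℕ) {N i : ℕ} (hi : i + 1 < N) (f : Tensor K N) :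
    heckeT q n (N + 1) i (extend K N f) = extend K N (heckeT q n N i f) := by
  rw [heckeT, heckeT, dif_pos hi, dif_pos (Nat.lt_succ_of_lt hi)]
  induction f using Finsupp.induction_linear with
  | zero => simp
  | add f g hf hg => simp only [map_add, hf, hg]
  | single l c =>
    rw [extend_single, Finsupp.linearCombination_single, Finsupp.linearCombination_single,
      map_smul]
    congr 1
    have ha : (⟨i, by omega⟩ : Fin (N + 1)) = Fin.castSucc ⟨i, by omega⟩ := rfl
    have hb : (⟨i + 1, by omega⟩ : Fin (N + 1)) = Fin.castSucc ⟨i + 1, hi⟩ := rfl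
    rw [ha, hb]
    simp only [heckeOnBasis, Fin.snoc_castSucc, place_castSucc]
    split_ifs <;> simp only [map_add, map_smul, map_neg]

theorem cosetSum_extend (q : K) (n : ℕ) {N i : ℕ} (hi : i < N) (f : Tensor K N) :
    cosetSum q n (N + 1) i (extend K N f) = extend K N (cosetSum q n N i f) := by
  induction i generalizing f with
  | zero => rfl
  | succ i ih =>
    simp only [cosetSum, LinearMap.add_apply, LinearMap.comp_apply, LinearMap.id_apply, map_add,
      heckeT_extend q n hi, ih (Nat.lt_of_succ_lt hi)]

theorem cosetProd_extend (q : K) (n : ℕ) {N i : ℕ} (hi : i ≤ N) (f : Tensor K N) :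
    cosetProd q n (N + 1) i (extend K N f) = extend K N (cosetProd q n N i f) := by
  induction i generalizing f with
  | zero => rfl
  | succ i ih =>
    simp only [cosetProd, LinearMap.comp_apply, ih (Nat.le_of_succ_le hi), cosetSum_extend q n hi]

/-- Only the last coset sum touches the new factor. Hence the kernel of the antisymmetrizer is
preserved when a vacuum vector is appended. -/
theorem antisymmetrizer_extend (q : K) (n : ℕ) {N : ℕ} (f : Tensor K N) :
    antisymmetrizer q n (N + 1) (extend K N f) =
      cosetSum q n (N + 1) N (extend K N (antisymmetrizer q n N f)) := by
  rw [antisymmetrizer_eq_cosetProd, antisymmetrizer_eq_cosetProd, ← cosetProd_extend q n le_rfl]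
  rfl

end QFock
end

noncomputable section

namespace QFock

variable {K : Type*} [Field K]

/-! ### Straightening of two adjacent factors -/

theorem place_congr (n : ℕ) {N : ℕ} {a b : Fin N} {l l' : Fin N → ℤ}
    (h : ∀ i, i ≠ a → i ≠ b → l i = l' i) (m m' : ℤ) (f : Laurent₂ K) :
    place n a b l m m' f = place n a b l' m m' f := by
  unfold place
  congr 2
  funext r
  funext i
  by_cases hb : i = b
  · subst hb; simp
  · by_cases ha : i = a
    · subst ha; simp [hb]
    · simp [ha, hb, h i ha hb]

theorem place_self (n : ℕ) {N : ℕ} (a b : Fin N) (l : Fin N → ℤ) :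
    place n a b l (vIndex n (l a)) (vIndex n (l b))
      (Finsupp.single (zExponent n (l a), zExponent n (l b)) (1 : K)) = Finsupp.single l 1 := by
  rw [place, Finsupp.lmapDomain_apply, Finsupp.mapDomain_single, vIndex_sub_mul_zExponent,
    vIndex_sub_mul_zExponent, Function.update_eq_self, Function.update_eq_self]

theorem place_swap (n : ℕ) {N : ℕ} (a b : Fin N) (l : Fin N → ℤ) :
    place n a b l (vIndex n (l b)) (vIndex n (l a))
      (Finsupp.single (zExponent n (l b), zExponent n (l a)) (1 : K)) =
        Finsupp.single (l ∘ Equiv.swap a b) 1 := by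
  have h := place_self (K := K) n a b (l ∘ Equiv.swap a b)
  simp only [Function.comp_apply, Equiv.swap_apply_left, Equiv.swap_apply_right] at h
  rw [← h]
  refine place_congr n (fun i ha hb => ?_) _ _ _
  simp [Equiv.swap_apply_of_ne_of_ne ha hb]

theorem dividedDifference_self (a : ℤ) : (dividedDifference a a : Laurent₂ K) = 0 := by
  simp [dividedDifference]

theorem dividedDifference_succ (a : ℤ) :
    (dividedDifference (a + 1) a : Laurent₂ K) = Finsupp.single (a, a) 1 := by
  simp [dividedDifference]

theorem mulZ₁_single (r : ℤ × ℤ) (c : K) :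
    mulZ₁ (Finsupp.single r c) = Finsupp.single (r.1 + 1, r.2) c := by
  simp [mulZ₁]

theorem heckeOnBasis_of_eq (q : K) (n : ℕ) {N : ℕ} {a b : Fin N} {l : Fin N → ℤ}
    (h : l a = l b) : heckeOnBasis q n a b l = -Finsupp.single l 1 := by
  have := place_self (K := K) n a b l
  rw [h] at this
  simp [heckeOnBasis, h, dividedDifference_self, this]

/-- Indices less than `n` apart lie in the same block of length `n` or in adjacent blocks. The
divided difference in the Hecke action then has at most one term, and no vectors besides `l` and its
exchange appear. -/
theorem zExponent_cases {n : ℕ} (hn : 1 ≤ n) {l l' : ℤ} (h1 : l < l') (h2 : l' < l + n) :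
    (vIndex n l < vIndex n l' ∧ zExponent n l' = zExponent n l) ∨
      (vIndex n l' < vIndex n l ∧ zExponent n l = zExponent n l' + 1) := by
  have e1 := vIndex_sub_mul_zExponent n l
  have e2 := vIndex_sub_mul_zExponent n l'
  have a1 := one_le_vIndex hn l
  have a2 := one_le_vIndex hn l'
  have b1 := vIndex_le hn l
  have b2 := vIndex_le hn l'
  generalize vIndex n l = p at *
  generalize vIndex n l' = p' at *
  generalize zExponent n l = r at *
  generalize zExponent n l' = r' at *
  have hn' : (0 : ℤ) < n := by omega
  have hr1 : r' < r + 1 := by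
    by_contra hcon
    have : (n : ℤ) * (r + 1) ≤ n * r' := mul_le_mul_of_nonneg_left (by omega) hn'.le
    rw [mul_add, mul_one] at this
    omega
  have hr2 : r < r' + 2 := by
    by_contra hcon
    have : (n : ℤ) * (r' + 2) ≤ n * r := mul_le_mul_of_nonneg_left (by omega) hn'.le
    rw [mul_add] at this
    omega
  rcases (by omega : r' = r ∨ r = r' + 1) with h | h
  · subst h; left; omega
  · subst h
    right
    rw [mul_add, mul_one] at e1
    omega

theorem heckeOnBasis_of_lt (q : K) {n : ℕ} (hn : 1 ≤ n) {N : ℕ} {a b : Fin N} {l : Fin N → ℤ}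
    (h1 : l a < l b) (h2 : l b < l a + n) :
    heckeOnBasis q n a b l =
      (-q⁻¹) • Finsupp.single (l ∘ Equiv.swap a b) 1 + (q⁻¹ ^ 2 - 1) • Finsupp.single l 1 := by
  have e1 := place_self (K := K) n a b l
  have e2 := place_swap (K := K) n a b l
  rcases zExponent_cases hn h1 h2 with ⟨h, h'⟩ | ⟨h, h'⟩
  · simp only [heckeOnBasis]
    rw [if_pos h, e2, h', dividedDifference_succ]
    rw [h'] at e1
    rw [e1]
  · simp only [heckeOnBasis]
    rw [if_neg h.not_gt, if_neg h.ne', e2, h', dividedDifference_succ, mulZ₁_single]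
    rw [h'] at e1
    rw [e1]

theorem heckeOnBasis_of_gt (q : K) {n : ℕ} (hn : 1 ≤ n) {N : ℕ} {a b : Fin N} {l : Fin N → ℤ}
    (h1 : l b < l a) (h2 : l a < l b + n) :
    heckeOnBasis q n a b l = (-q⁻¹) • Finsupp.single (l ∘ Equiv.swap a b) 1 := by
  have e2 := place_swap (K := K) n a b l
  rcases zExponent_cases hn h1 h2 with ⟨h, h'⟩ | ⟨h, h'⟩
  · simp only [heckeOnBasis]
    rw [if_neg h.not_gt, if_neg h.ne', e2, h', dividedDifference_self]
    simp
  · simp only [heckeOnBasis]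
    rw [if_pos h, e2, ← h', dividedDifference_self]
    simp

/-! ### Vectors of the Fock space given by sequences -/

/-- `u_{J 0} ⊗ ⋯ ⊗ u_{J (N-1)}`. -/
def seqTensor (K : Type*) [Field K] (N : ℕ) (J : ℕ → ℤ) : Tensor K N :=
  Finsupp.single (fun i => J i) 1

/-- `u_{J 0} ∧_q ⋯ ∧_q u_{J (N-1)} ∧_q u_{-N} ∧_q u_{-N-1} ∧_q ⋯`. -/
def seqFock (q : K) (n N : ℕ) (J : ℕ → ℤ) : FockSpace q n :=
  toFock q n N (seqTensor K N J)

theorem seqTensor_congr {N : ℕ} {J J' : ℕ → ℤ} (h : ∀ i < N, J i = J' i) :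
    seqTensor K N J = seqTensor K N J' := by
  unfold seqTensor
  congr 1
  funext i
  exact h i i.2

theorem seqFock_congr (q : K) (n : ℕ) {N : ℕ} {J J' : ℕ → ℤ} (h : ∀ i < N, J i = J' i) :
    seqFock q n N J = seqFock q n N J' :=
  congrArg (toFock q n N) (seqTensor_congr h)

theorem toFock_eq_zero {q : K} {n N : ℕ} {f : Tensor K N} (h : antisymmetrizer q n N f = 0) :
    toFock q n N f = 0 := by
  rw [toFock, LinearMap.comp_apply, LinearMap.comp_apply, (toWedge_eq_zero_iff q n f).2 h,
    map_zero, map_zero]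

theorem toFock_extend (q : K) (n : ℕ) {N : ℕ} (f : Tensor K N) :
    toFock q n (N + 1) (extend K N f) = toFock q n N f := by
  refine ((Submodule.Quotient.eq (limitRelations q n)).2 ?_).symm
  exact Submodule.subset_span ⟨N, f, rfl⟩

theorem extend_seqTensor {N : ℕ} {J : ℕ → ℤ} (h : J N = -(N : ℤ)) :
    extend K N (seqTensor K N J) = seqTensor K (N + 1) J := by
  rw [seqTensor, extend_single, seqTensor]
  congr 1
  funext i
  refine Fin.lastCases ?_ (fun i => ?_) i
  · simp [h]
  · simp

theorem seqFock_succ (q : K) (n : ℕ) {N : ℕ} {J : ℕ → ℤ} (h : J N = -(N : ℤ)) :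
    seqFock q n (N + 1) J = seqFock q n N J := by
  rw [seqFock, ← extend_seqTensor h, toFock_extend]
  rfl

theorem seqFock_add (q : K) (n : ℕ) {N : ℕ} {J : ℕ → ℤ} (h : ∀ i, N ≤ i → J i = -(i : ℤ))
    (d : ℕ) : seqFock q n (N + d) J = seqFock q n N J := by
  induction d with
  | zero => rfl
  | succ d ih => rw [← add_assoc, seqFock_succ q n (h _ (Nat.le_add_right _ _)), ih]

theorem toFock_eq_zero_of_heckeT [CharZero K] {q : K} {n : ℕ} (hn : 1 ≤ n) {N t : ℕ}
    (ht : t + 1 < N) {f : Tensor K N} (hf : heckeT q n N t f = -f) : toFock q n N f = 0 :=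
  toFock_eq_zero (antisymmetrizer_eq_zero q hn ht hf)

theorem heckeT_seqTensor (q : K) (n : ℕ) {N t : ℕ} (ht : t + 1 < N) (J : ℕ → ℤ) :
    heckeT q n N t (seqTensor K N J) =
      heckeOnBasis q n ⟨t, Nat.lt_of_succ_lt ht⟩ ⟨t + 1, ht⟩ fun i => J i := by
  rw [heckeT, dif_pos ht, seqTensor, Finsupp.linearCombination_single, one_smul]

theorem seqFock_eq_zero_of_eq [CharZero K] (q : K) {n : ℕ} (hn : 1 ≤ n) {N t : ℕ}
    (ht : t + 1 < N) {J : ℕ → ℤ} (h : J t = J (t + 1)) : seqFock q n N J = 0 := by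
  refine toFock_eq_zero_of_heckeT hn ht ?_
  rw [heckeT_seqTensor q n ht, heckeOnBasis_of_eq q n (by simpa using h)]
  rfl

theorem comp_swap_val {N t : ℕ} (ht : t + 1 < N) (J : ℕ → ℤ) :
    (fun i : Fin N => J i) ∘ Equiv.swap ⟨t, Nat.lt_of_succ_lt ht⟩ ⟨t + 1, ht⟩ =
      fun i : Fin N => (J ∘ Equiv.swap t (t + 1)) i := by
  funext i
  simp only [Function.comp_apply, Equiv.swap_apply_def, Fin.ext_iff]
  split_ifs <;> rfl

/-- The combination `u_J + q⁻¹ u_{J'}`, with `J'` the exchanged sequence, is an eigenvector of `T_t`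
for `-1`: the contributions `±q⁻²` to the coefficient of `u_J` cancel. -/
theorem seqFock_swap [CharZero K] (q : K) {n : ℕ} (hn : 1 ≤ n) {N t : ℕ} (ht : t + 1 < N)
    {J : ℕ → ℤ} (h1 : J t < J (t + 1)) (h2 : J (t + 1) < J t + n) :
    seqFock q n N J = (-q⁻¹) • seqFock q n N (J ∘ Equiv.swap t (t + 1)) := by
  have e1 : heckeT q n N t (seqTensor K N J) =
      (-q⁻¹) • seqTensor K N (J ∘ Equiv.swap t (t + 1)) + (q⁻¹ ^ 2 - 1) • seqTensor K N J := by
    rw [heckeT_seqTensor q n ht, heckeOnBasis_of_lt q hn (by simpa using h1) (by simpa using h2),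
      comp_swap_val ht]
    rfl
  have e2 : heckeT q n N t (seqTensor K N (J ∘ Equiv.swap t (t + 1))) =
      (-q⁻¹) • seqTensor K N J := by
    rw [heckeT_seqTensor q n ht, heckeOnBasis_of_gt q hn (by simpa using h1) (by simpa using h2),
      comp_swap_val ht]
    congr 2
    funext i
    simp
  have key : toFock q n N (seqTensor K N J +
      q⁻¹ • seqTensor K N (J ∘ Equiv.swap t (t + 1))) = 0 := by
    refine toFock_eq_zero_of_heckeT hn ht ?_
    rw [map_add, map_smul, e1, e2]
    module
  rw [map_add, map_smul] at key
  rw [neg_smul]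
  exact eq_neg_of_add_eq_zero_left key

/-! ### Straightening of sequences -/

/-- The number of pairs of positions in `[a, b)` at which `J` increases. -/
def ascents (a b : ℕ) (J : ℕ → ℤ) : ℕ :=
  ((Finset.Ico a b ×ˢ Finset.Ico a b).filter fun p => p.1 < p.2 ∧ J p.1 < J p.2).card

theorem ascents_swap {a b t : ℕ} (ha : a ≤ t) (hb : t + 1 < b) {J : ℕ → ℤ}
    (h : J t < J (t + 1)) : ascents a b (J ∘ Equiv.swap t (t + 1)) + 1 = ascents a b J := by
  unfold ascents
  set s := Equiv.swap t (t + 1) with hs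
  set A := (Finset.Ico a b ×ˢ Finset.Ico a b).filter
    fun p : ℕ × ℕ => p.1 < p.2 ∧ (J ∘ s) p.1 < (J ∘ s) p.2 with hA
  have hmem : ∀ i j, (i, j) ∈ A.map (Equiv.prodCongr s s).toEmbedding ↔
      ((a ≤ s i ∧ s i < b) ∧ (a ≤ s j ∧ s j < b)) ∧ s i < s j ∧ J i < J j := by
    intro i j
    rw [Finset.mem_map_equiv]
    simp [hA, hs, Equiv.prodCongr_symm]
  have hsv : ∀ i, s i = if i = t then t + 1 else if i = t + 1 then t else i :=
    Equiv.swap_apply_def t (t + 1)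
  rw [← Finset.card_map (Equiv.prodCongr s s).toEmbedding,
    ← Finset.card_insert_of_notMem (a := (t, t + 1))]
  · congr 1
    ext ⟨i, j⟩
    rw [Finset.mem_insert, hmem]
    simp only [Finset.mem_filter, Finset.mem_product, Finset.mem_Ico, Prod.mk.injEq]
    constructor
    · rintro (⟨rfl, rfl⟩ | ⟨h1, h2, h3⟩)
      · exact ⟨by omega, by omega, h⟩
      · have hne : ¬(i = t + 1 ∧ j = t) := by
          rintro ⟨rfl, rfl⟩
          exact absurd h3 h.not_gt
        rw [hsv, hsv] at h1 h2
        refine ⟨?_, ?_, h3⟩ <;> split_ifs at h1 h2 <;> omega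
    · rintro ⟨h1, h2, h3⟩
      by_cases he : i = t ∧ j = t + 1
      · exact Or.inl he
      · right
        refine ⟨?_, ?_, h3⟩ <;> rw [hsv, hsv] <;> split_ifs <;> omega
  · rw [hmem, hsv, hsv]
    simp

/-- Any two entries of `J` in `[a, b)` that are not decreasing differ by less than `n`. -/
def IsClose (n a b : ℕ) (J : ℕ → ℤ) : Prop :=
  ∀ i j, a ≤ i → i < j → j < b → J i ≤ J j → J j < J i + n

/-- Apart from the exchanged pair itself, every pair of entries keeps its relative order of
position. -/
theorem IsClose.swap {n a b t : ℕ} {J : ℕ → ℤ} (hJ : IsClose n a b J) (ha : a ≤ t)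
    (hb : t + 1 < b) (h : J t ≤ J (t + 1)) : IsClose n a b (J ∘ Equiv.swap t (t + 1)) := by
  intro i j hi hij hj hle
  have hn := hJ t (t + 1) ha (by omega) hb h
  simp only [Function.comp_apply] at hle ⊢
  by_cases he : i = t ∧ j = t + 1
  · obtain ⟨rfl, rfl⟩ := he
    simp only [Equiv.swap_apply_left, Equiv.swap_apply_right] at hle ⊢
    omega
  · have hsv : ∀ i, Equiv.swap t (t + 1) i = if i = t then t + 1 else if i = t + 1 then t else i :=
      Equiv.swap_apply_def t (t + 1)
    refine hJ _ _ ?_ ?_ ?_ hle <;> simp only [hsv] <;> split_ifs <;> omega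

theorem exists_ascent_of_not_anti {a b i j : ℕ} {J : ℕ → ℤ} (ha : a ≤ i) (hij : i < j)
    (hb : j < b) (h : J i ≤ J j) : ∃ t, a ≤ t ∧ t + 1 < b ∧ J t ≤ J (t + 1) := by
  by_contra hcon
  push Not at hcon
  have : ∀ d, i + d + 1 ≤ j → J (i + d + 1) < J i := by
    intro d
    induction d with
    | zero => intro _; exact hcon i ha (by omega)
    | succ d ih =>
      intro hd
      exact (hcon (i + (d + 1)) (by omega) (by omega)).trans (ih (by omega))
  have h2 := this (j - i - 1) (by omega)
  rw [show i + (j - i - 1) + 1 = j by omega] at h2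
  omega

/-- Two equal entries cannot be joined by a strict descent, so there is an adjacent pair that does
not decrease. Either it is an equality, which kills the wedge, or exchanging it lowers the number of
ascents. -/
theorem seqFock_eq_zero [CharZero K] (q : K) {n : ℕ} (hn : 1 ≤ n) {N a b : ℕ} (hb : b ≤ N)
    {J : ℕ → ℤ} (hJ : IsClose n a b J) {i j : ℕ} (hi : a ≤ i) (hij : i < j) (hj : j < b)
    (h : J i = J j) : seqFock q n N J = 0 := by
  induction hm : ascents a b J generalizing J i j with
  | zero =>
    obtain ⟨t, h1, h2, h3⟩ := exists_ascent_of_not_anti hi hij hj h.le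
    rcases h3.lt_or_eq with h3 | h3
    · have := ascents_swap h1 h2 h3
      omega
    · exact seqFock_eq_zero_of_eq q hn (by omega) h3
  | succ m ih =>
    obtain ⟨t, h1, h2, h3⟩ := exists_ascent_of_not_anti hi hij hj h.le
    rcases h3.lt_or_eq with h3 | h3
    · have hasc := ascents_swap h1 h2 h3
      rw [seqFock_swap q hn (by omega) h3 (hJ t (t + 1) h1 (by omega) h2 h3.le)]
      have hsv : ∀ i, Equiv.swap t (t + 1) i =
        if i = t then t + 1 else if i = t + 1 then t else i := Equiv.swap_apply_def t (t + 1)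
      have hz : seqFock q n N (J ∘ Equiv.swap t (t + 1)) = 0 := by
        have hne : ¬(i = t ∧ j = t + 1) := by
          rintro ⟨rfl, rfl⟩
          exact h3.ne h
        -- The two equal entries are not the exchanged pair, so they stay in the same order and
        -- inside the window.
        refine ih (hJ.swap h1 h2 h3.le) (i := Equiv.swap t (t + 1) i)
          (j := Equiv.swap t (t + 1) j) ?_ ?_ ?_ (by simpa using h) (by omega) <;>
        simp only [hsv] <;> split_ifs <;> omega
      rw [hz, smul_zero]
    · exact seqFock_eq_zero_of_eq q hn (by omega) h3

/-- The number of elements of `X` that exceed `c`. -/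
def countGT (X : Finset ℤ) (c : ℤ) : ℕ := (X.filter (c < ·)).card

theorem countGT_lt_countGT {X : Finset ℤ} {c d : ℤ} (hd : d ∈ X) (h : c < d) :
    countGT X d < countGT X c := by
  refine Finset.card_lt_card (Finset.ssubset_iff_of_subset ?_ |>.2 ⟨d, ?_, ?_⟩)
  · exact fun x hx => by
      simp only [Finset.mem_filter] at hx ⊢
      exact ⟨hx.1, h.trans hx.2⟩
  · simp [hd, h]
  · simp

theorem countGT_injOn {X : Finset ℤ} {c d : ℤ} (hc : c ∈ X) (hd : d ∈ X)
    (h : countGT X c = countGT X d) : c = d := by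
  rcases lt_trichotomy c d with hlt | he | hlt
  · exact absurd h (countGT_lt_countGT hd hlt).ne'
  · exact he
  · exact absurd h (countGT_lt_countGT hc hlt).ne

theorem countGT_image {M : ℕ} {B : ℕ → ℤ} (hB : ∀ i j, i < j → j < M → B j < B i) {i : ℕ}
    (hi : i < M) : countGT ((Finset.range M).image B) (B i) = i := by
  have hinj : ∀ x y, x < M → y < M → B x = B y → x = y := by
    intro x y hx hy he
    rcases lt_trichotomy x y with h | h | h
    · have := hB x y h hy; omega
    · exact h
    · have := hB y x h hx; omega
  have : ((Finset.range M).image B).filter (B i < ·) = (Finset.range i).image B := by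
    ext x
    simp only [Finset.mem_filter, Finset.mem_image, Finset.mem_range]
    constructor
    · rintro ⟨⟨j, hj, rfl⟩, hlt⟩
      refine ⟨j, ?_, rfl⟩
      by_contra hcon
      rcases (not_lt.1 hcon).lt_or_eq with h | h
      · have := hB i j h hj; omega
      · subst h; omega
    · rintro ⟨j, hj, rfl⟩
      exact ⟨⟨j, by omega, rfl⟩, hB j i hj hi⟩
  rw [countGT, this, Finset.card_image_of_injOn, Finset.card_range]
  intro x hx y hy
  simp only [Finset.coe_range, Set.mem_Iio] at hx hy
  exact hinj x y (by omega) (by omega)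

theorem eq_of_image_eq {M : ℕ} {J B : ℕ → ℤ} (hJ : ∀ i j, i < j → j < M → J j < J i)
    (hB : ∀ i j, i < j → j < M → B j < B i)
    (h : (Finset.range M).image J = (Finset.range M).image B) : ∀ i < M, J i = B i := by
  intro i hi
  have h1 := countGT_image hJ hi
  rw [h] at h1
  refine countGT_injOn (h ▸ Finset.mem_image_of_mem J (Finset.mem_range.2 hi))
    (Finset.mem_image_of_mem B (Finset.mem_range.2 hi)) ?_
  rw [h1, countGT_image hB hi]

theorem image_comp_swap {M t : ℕ} (ht : t + 1 < M) (J : ℕ → ℤ) :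
    (Finset.range M).image (J ∘ Equiv.swap t (t + 1)) = (Finset.range M).image J := by
  rw [← Finset.image_image]
  congr 1
  ext x
  simp only [Finset.mem_image, Finset.mem_range]
  have hsv : ∀ i, Equiv.swap t (t + 1) i =
    if i = t then t + 1 else if i = t + 1 then t else i := Equiv.swap_apply_def t (t + 1)
  constructor
  · rintro ⟨y, hy, rfl⟩
    rw [hsv]
    split_ifs <;> omega
  · intro hx
    refine ⟨Equiv.swap t (t + 1) x, ?_, Equiv.swap_apply_self _ _ _⟩
    rw [hsv]
    split_ifs <;> omega

/-- Bubble sort: each exchange of an adjacent ascent removes exactly one ascent and costs a factor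
`(-q)⁻¹`. Closeness guarantees that the simple exchange rule always applies. -/
theorem seqFock_straighten [CharZero K] {q : K} (hq : q ≠ 0) {n : ℕ} (hn : 1 ≤ n) {M : ℕ}
    {J B : ℕ → ℤ} (hJ : IsClose n 0 M J) (hB : ∀ i j, i < j → j < M → B j < B i)
    (h : (Finset.range M).image J = (Finset.range M).image B) :
    seqFock q n M J = ((-q) ^ (-(ascents 0 M J : ℤ))) • seqFock q n M B := by
  have hBinj : Set.InjOn B (Finset.range M) := by
    intro x hx y hy he
    simp only [Finset.coe_range, Set.mem_Iio] at hx hy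
    rcases lt_trichotomy x y with h | h | h
    · have := hB x y h hy; omega
    · exact h
    · have := hB y x h hx; omega
  have hinj : ∀ J' : ℕ → ℤ, (Finset.range M).image J' = (Finset.range M).image B →
      ∀ x y, x < M → y < M → J' x = J' y → x = y := by
    intro J' h' x y hx hy
    have : Set.InjOn J' (Finset.range M) := by
      rw [← Finset.card_image_iff, h', Finset.card_image_of_injOn hBinj]
    exact fun he => this (by simpa using hx) (by simpa using hy) he
  have step : ∀ J' : ℕ → ℤ, (Finset.range M).image J' = (Finset.range M).image B →
      ¬(∀ i j, i < j → j < M → J' j < J' i) → ∃ t, t + 1 < M ∧ J' t < J' (t + 1) := by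
    intro J' h' hanti
    push Not at hanti
    obtain ⟨i, j, hij, hj, hle⟩ := hanti
    obtain ⟨t, _, h2, h3⟩ := exists_ascent_of_not_anti (Nat.zero_le i) hij hj hle
    refine ⟨t, h2, lt_of_le_of_ne h3 fun he => ?_⟩
    have := hinj J' h' t (t + 1) (by omega) h2 he
    omega
  induction hm : ascents 0 M J generalizing J with
  | zero =>
    have hanti : ∀ i j, i < j → j < M → J j < J i := by
      by_contra hcon
      obtain ⟨t, h2, h3⟩ := step J h hcon
      have := ascents_swap (Nat.zero_le t) h2 h3
      omega
    rw [seqFock_congr q n (eq_of_image_eq hanti hB h)]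
    simp
  | succ m ih =>
    have hanti : ¬∀ i j, i < j → j < M → J j < J i := by
      intro hcon
      have : ascents 0 M J = 0 := by
        rw [ascents, Finset.card_eq_zero, Finset.filter_eq_empty_iff]
        rintro ⟨i, j⟩ hp ⟨h1, h2⟩
        simp only [Finset.mem_product, Finset.mem_Ico] at hp
        exact absurd h2 (hcon i j h1 hp.2.2).not_gt
      omega
    obtain ⟨t, h2, h3⟩ := step J h hanti
    have hasc := ascents_swap (Nat.zero_le t) h2 h3
    rw [seqFock_swap q hn h2 h3 (hJ t (t + 1) (Nat.zero_le t) (by omega) h2 h3.le),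
      ih (hJ.swap (Nat.zero_le t) h2 h3.le) ((image_comp_swap h2 J).trans h) (by omega), smul_smul]
    congr 1
    push_cast
    rw [neg_add, zpow_add₀ (neg_ne_zero.2 hq), zpow_neg_one, mul_comm, inv_neg]

/-! ### Action of the elementary symmetric polynomials on sequences -/

/-- `J` with the entries at the positions in `S` increased by `n ε`. -/
def shiftSeq (n : ℕ) (ε : ℤ) (S : Finset ℕ) (J : ℕ → ℤ) (i : ℕ) : ℤ :=
  if i ∈ S then J i + n * ε else J i

theorem esymmPow_seqTensor (n k : ℕ) (ε : ℤ) (N : ℕ) (J : ℕ → ℤ) :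
    esymmPow K n k ε N (seqTensor K N J) =
      ∑ S ∈ (Finset.range N).powersetCard k, seqTensor K N (shiftSeq n ε S J) := by
  have hr : Finset.range N = (Finset.univ : Finset (Fin N)).map Fin.valEmbedding := by
    ext x
    simp only [Finset.mem_range, Finset.mem_map, Finset.mem_univ, true_and,
      Fin.valEmbedding_apply]
    exact ⟨fun h => ⟨⟨x, h⟩, rfl⟩, by rintro ⟨y, rfl⟩; exact y.2⟩
  rw [hr, Finset.powersetCard_map, Finset.sum_map, esymmPow, LinearMap.sum_apply]
  refine Finset.sum_congr rfl fun S _ => ?_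
  rw [yMonomial, seqTensor, Finsupp.lmapDomain_apply, Finsupp.mapDomain_single, seqTensor]
  congr 1
  funext i
  have : (i : ℕ) ∈ (Finset.mapEmbedding Fin.valEmbedding).toEmbedding S ↔ i ∈ S :=
    Finset.mem_map' Fin.valEmbedding
  simp only [shiftSeq, this]
  split_ifs <;> ring

/-- The image of `u_{J 0} ∧_q ⋯ ∧_q u_{J (N-1)}` under `e_k(y_1^ε, …, y_N^ε)`. -/
def esymmFock (q : K) (n k : ℕ) (ε : ℤ) (N : ℕ) (J : ℕ → ℤ) : FockSpace q n :=
  ∑ S ∈ (Finset.range N).powersetCard k, seqFock q n N (shiftSeq n ε S J)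

theorem toFock_esymmPow_seqTensor (q : K) (n k : ℕ) (ε : ℤ) (N : ℕ) (J : ℕ → ℤ) :
    toFock q n N (esymmPow K n k ε N (seqTensor K N J)) = esymmFock q n k ε N J := by
  rw [esymmPow_seqTensor, map_sum]
  rfl

theorem esymmFock_succ (q : K) (n k : ℕ) (ε : ℤ) {N : ℕ} {J : ℕ → ℤ} (hJ : J N = -(N : ℤ))
    (h : ∀ S ⊆ Finset.range (N + 1), S.card = k → N ∈ S →
      seqFock q n (N + 1) (shiftSeq n ε S J) = 0) :
    esymmFock q n k ε (N + 1) J = esymmFock q n k ε N J := by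
  unfold esymmFock
  have hsub : (Finset.range N).powersetCard k ⊆ (Finset.range (N + 1)).powersetCard k :=
    Finset.powersetCard_mono (Finset.range_subset_range.2 (Nat.le_succ N))
  rw [← Finset.sum_subset hsub]
  · refine Finset.sum_congr rfl fun S hS => seqFock_succ q n ?_
    have hN : N ∉ S := fun hN => by
      simpa using (Finset.mem_powersetCard.1 hS).1 hN
    rw [shiftSeq, if_neg hN, hJ]
  · intro S hS hS'
    rw [Finset.mem_powersetCard] at hS hS'
    refine h S hS.1 hS.2 ?_
    by_contra hN
    refine hS' ⟨fun x hx => ?_, hS.2⟩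
    have h1 := Finset.mem_range.1 (hS.1 hx)
    have h2 : x ≠ N := fun he => hN (he ▸ hx)
    rw [Finset.mem_range]
    omega

/-- A particle deep in the vacuum cannot move up. -/
theorem esymmFock_one_succ [CharZero K] (q : K) {n : ℕ} (hn : 1 ≤ n) (k : ℕ) {N N₀ : ℕ}
    {J : ℕ → ℤ} (hJ : ∀ i, N₀ ≤ i → J i = -(i : ℤ)) (hN : N₀ + n * k ≤ N) :
    esymmFock q n k 1 (N + 1) J = esymmFock q n k 1 N J := by
  refine esymmFock_succ q n k 1 (hJ N (by omega)) fun S hS hk hNS => ?_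
  obtain ⟨N', rfl⟩ : ∃ N', N = N' + n * k := ⟨N - n * k, by omega⟩
  -- Pigeonhole on the `k + 1` positions `N', N' + n, …, N' + n k = N`: the last is in `S`, and `S`
  -- has only `k` elements, so somewhere a position in `S` is preceded by one outside `S`.
  obtain ⟨u, hu, hu1, hu2⟩ : ∃ u < k, N' + n * (u + 1) ∈ S ∧ N' + n * u ∉ S := by
    by_contra hcon
    push Not at hcon
    have hall : ∀ t ≤ k, N' + n * (k - t) ∈ S := by
      intro t
      induction t with
      | zero => intro _; simpa using hNS
      | succ t ih =>
        intro ht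
        refine hcon _ (by omega) ?_
        rw [show k - (t + 1) + 1 = k - t by omega]
        exact ih (by omega)
    have hsub : (Finset.range (k + 1)).image (fun u => N' + n * u) ⊆ S := by
      intro x hx
      obtain ⟨u, hu, rfl⟩ := Finset.mem_image.1 hx
      have hu' := Finset.mem_range.1 hu
      have := hall (k - u) (by omega)
      rwa [show k - (k - u) = u by omega] at this
    have hc := Finset.card_le_card hsub
    rw [Finset.card_image_of_injective, Finset.card_range] at hc
    · omega
    · intro x y hxy
      have : n * x = n * y := by simpa using hxy
      exact Nat.eq_of_mul_eq_mul_left (by omega) this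
  have hle : n * (u + 1) ≤ n * k := Nat.mul_le_mul_left n hu
  have hmul : n * (u + 1) = n * u + n := by ring
  have hJ' : ∀ i, N' ≤ i → J i = -(i : ℤ) := fun i hi => hJ i (by omega)
  -- Raising the entry at `N' + n (u + 1)` by `n` makes it equal to the unmoved entry at `N' + n u`.
  refine seqFock_eq_zero q hn (a := N' + n * u) (b := N' + n * (u + 1) + 1) (by omega) ?_
    (i := N' + n * u) (j := N' + n * (u + 1)) le_rfl (by omega) (by omega) ?_
  · intro i j hi hij _ hle
    unfold shiftSeq at *
    rw [hJ' i (by omega), hJ' j (by omega)] at *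
    split_ifs at * <;> omega
  · rw [shiftSeq, shiftSeq, if_neg hu2, if_pos hu1, hJ' _ (by omega), hJ' _ (by omega), hmul]
    push_cast
    ring

/-- A particle deep in the vacuum cannot move down. -/
theorem seqFock_shiftSeq_neg_one_eq_zero [CharZero K] (q : K) {n : ℕ} (hn : 1 ≤ n) {N N₀ : ℕ}
    {J : ℕ → ℤ} (hJ : ∀ i, N₀ ≤ i → J i = -(i : ℤ)) (hN : N₀ ≤ N)
    {S : Finset ℕ} (hS : S ⊆ Finset.range (N + 1)) (hNS : N ∈ S) :
    seqFock q n (N + 1) (shiftSeq n (-1) S J) = 0 := by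
  have hout : ∀ i, N + 1 ≤ i → i ∉ S := fun i hi hiS => by
    have := Finset.mem_range.1 (hS hiS)
    omega
  -- The lowered entry is `-(N + n)`, which is the vacuum entry `n` places further on. Appending `n`
  -- vacuum factors brings that position into view.
  rw [← seqFock_add q n (N := N + 1) (J := shiftSeq n (-1) S J) (fun i hi => by
    rw [shiftSeq, if_neg (hout i hi), hJ i (by omega)]) n]
  refine seqFock_eq_zero q hn (a := N) (b := N + 1 + n) le_rfl ?_ (i := N) (j := N + n) le_rfl
    (by omega) (by omega) ?_
  · intro i j hi hij hj hle
    unfold shiftSeq at *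
    rw [if_neg (hout j (by omega))] at *
    rw [hJ i (by omega), hJ j (by omega)] at *
    split_ifs at * <;> omega
  · rw [shiftSeq, shiftSeq, if_pos hNS, if_neg (hout _ (by omega)), hJ _ hN, hJ _ (by omega)]
    push_cast
    ring

theorem esymmFock_neg_one_succ [CharZero K] (q : K) {n : ℕ} (hn : 1 ≤ n) (k : ℕ) {N N₀ : ℕ}
    {J : ℕ → ℤ} (hJ : ∀ i, N₀ ≤ i → J i = -(i : ℤ)) (hN : N₀ ≤ N) :
    esymmFock q n k (-1) (N + 1) J = esymmFock q n k (-1) N J :=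
  esymmFock_succ q n k (-1) (hJ N hN) fun _ hS _ hNS =>
    seqFock_shiftSeq_neg_one_eq_zero q hn hJ hN hS hNS

/-! ### Existence and uniqueness of the limits -/

/-- The entries of `l`, continued by those of the vacuum. -/
def vacuumTail {N : ℕ} (l : Fin N → ℤ) (i : ℕ) : ℤ :=
  if h : i < N then l ⟨i, h⟩ else -(i : ℤ)

theorem vacuumTail_of_le {N : ℕ} (l : Fin N → ℤ) (i : ℕ) (h : N ≤ i) :
    vacuumTail l i = -(i : ℤ) :=
  dif_neg h.not_gt

theorem seqTensor_vacuumTail {N : ℕ} (l : Fin N → ℤ) :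
    seqTensor K N (vacuumTail l) = Finsupp.single l 1 := by
  unfold seqTensor
  congr 1
  funext i
  exact dif_pos i.2

theorem extendBy_seqTensor {N : ℕ} {J : ℕ → ℤ} (hJ : ∀ i, N ≤ i → J i = -(i : ℤ)) (d : ℕ) :
    extendBy K N d (seqTensor K N J) = seqTensor K (N + d) J := by
  induction d with
  | zero => rfl
  | succ d ih =>
    rw [extendBy, LinearMap.comp_apply, ih, extend_seqTensor (hJ _ (Nat.le_add_right _ _))]
    rfl

theorem antisymmetrizer_extendBy (q : K) (n : ℕ) {N : ℕ} {f : Tensor K N}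
    (hf : antisymmetrizer q n N f = 0) (d : ℕ) :
    antisymmetrizer q n (N + d) (extendBy K N d f) = 0 := by
  induction d with
  | zero => exact hf
  | succ d ih =>
    have h := antisymmetrizer_extend q n (extendBy K N d f)
    rw [ih, map_zero, map_zero] at h
    exact h

theorem IsThermodynamicLimit.unique {q : K} {n : ℕ} {X : (N : ℕ) → Tensor K N →ₗ[K] Tensor K N}
    {E E' : FockSpace q n →ₗ[K] FockSpace q n} (h : IsThermodynamicLimit q n X E)
    (h' : IsThermodynamicLimit q n X E') : E = E' := by
  refine Submodule.linearMap_qext _ (DirectSum.linearMap_ext K fun N => ?_)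
  refine LinearMap.ext fun x => ?_
  obtain ⟨w, rfl⟩ := Submodule.Quotient.mk_surjective _ x
  obtain ⟨d, h1, h2⟩ := ((h N w).and (h' N w)).exists
  exact h1.symm.trans h2

theorem exists_isThermodynamicLimit [CharZero K] (q : K) {n : ℕ} (hn : 1 ≤ n) (k : ℕ) (ε : ℤ)
    (d₀ : ℕ) (hstable : ∀ (N N₀ : ℕ) (J : ℕ → ℤ), (∀ i, N₀ ≤ i → J i = -(i : ℤ)) → N₀ + d₀ ≤ N →
      esymmFock q n k ε (N + 1) J = esymmFock q n k ε N J) :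
    ∃ E : FockSpace q n →ₗ[K] FockSpace q n,
      IsThermodynamicLimit q n (esymmPow K n k ε) E := by
  have hcomm : ∀ {N : ℕ} {f : Tensor K N}, antisymmetrizer q n N f = 0 →
      antisymmetrizer q n N (esymmPow K n k ε N f) = 0 := fun {N f} hf => by
    rw [antisymmetrizer_comm q n _ (fun i f => heckeT_esymmPow q hn k ε i f), hf, map_zero]
  -- After `d₀` vacuum factors the value no longer changes, so the limit is read off at a fixed
  -- distance, uniformly in the vector.
  let φ : (N : ℕ) → Tensor K N →ₗ[K] FockSpace q n := fun N =>
    toFock q n (N + d₀) ∘ₗ esymmPow K n k ε (N + d₀) ∘ₗ extendBy K N d₀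
  have hφ : ∀ N, LinearMap.ker (antisymmetrizer q n N) ≤ LinearMap.ker (φ N) := fun N f hf =>
    LinearMap.mem_ker.2 (toFock_eq_zero (hcomm (antisymmetrizer_extendBy q n hf d₀)))
  have hφJ : ∀ (N : ℕ) (J : ℕ → ℤ), (∀ i, N ≤ i → J i = -(i : ℤ)) →
      φ N (seqTensor K N J) = esymmFock q n k ε (N + d₀) J := fun N J hJ => by
    rw [← toFock_esymmPow_seqTensor, ← extendBy_seqTensor hJ]
    rfl
  have hstab : ∀ (N : ℕ) (J : ℕ → ℤ), (∀ i, N ≤ i → J i = -(i : ℤ)) → ∀ d,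
      esymmFock q n k ε (N + d₀ + d) J = esymmFock q n k ε (N + d₀) J := fun N J hJ d => by
    induction d with
    | zero => rfl
    | succ d ih => rw [← add_assoc, hstable _ N J hJ (by omega), ih]
  let Φ : (DirectSum ℕ fun N => QWedge q n N) →ₗ[K] FockSpace q n :=
    DirectSum.toModule K ℕ _ fun N =>
      (LinearMap.ker (antisymmetrizer q n N)).liftQ (φ N) (hφ N)
  have hΦ : ∀ (N : ℕ) (w : Tensor K N),
      Φ (DirectSum.lof K ℕ (fun N => QWedge q n N) N (toWedge q n N w)) = φ N w := fun N w =>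
    DirectSum.toModule_lof (M := fun N => QWedge q n N) K N (toWedge q n N w)
  have hrel : limitRelations q n ≤ LinearMap.ker Φ := by
    refine Submodule.span_le.2 ?_
    rintro x ⟨N, w, rfl⟩
    rw [SetLike.mem_coe, LinearMap.mem_ker, map_sub, hΦ, hΦ, sub_eq_zero]
    have : φ N = φ (N + 1) ∘ₗ extend K N := by
      refine Finsupp.lhom_ext' fun l => LinearMap.ext_ring ?_
      change φ N (Finsupp.single l 1) = φ (N + 1) (extend K N (Finsupp.single l 1))
      have hl := vacuumTail_of_le l
      rw [← seqTensor_vacuumTail, extend_seqTensor (hl N le_rfl), hφJ N _ hl,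
        hφJ (N + 1) _ fun i hi => hl i (by omega), ← hstab N _ hl 1]
      congr 1
      omega
    exact LinearMap.congr_fun this w
  refine ⟨(limitRelations q n).liftQ Φ hrel, fun N w => ?_⟩
  filter_upwards [Filter.eventually_ge_atTop d₀] with d hd
  have : toFock q n (N + d) ∘ₗ esymmPow K n k ε (N + d) ∘ₗ extendBy K N d = φ N := by
    refine Finsupp.lhom_ext' fun l => LinearMap.ext_ring ?_
    change toFock q n (N + d) (esymmPow K n k ε (N + d) (extendBy K N d (Finsupp.single l 1))) =
      φ N (Finsupp.single l 1)
    have hl := vacuumTail_of_le l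
    rw [← seqTensor_vacuumTail, extendBy_seqTensor hl, toFock_esymmPow_seqTensor, hφJ N _ hl,
      ← hstab N _ hl (d - d₀)]
    congr 1
    omega
  exact (LinearMap.congr_fun this w).trans (hΦ N w).symm

theorem exists_isThermodynamicLimit_one [CharZero K] (q : K) {n : ℕ} (hn : 1 ≤ n) (k : ℕ) :
    ∃ E : FockSpace q n →ₗ[K] FockSpace q n,
      IsThermodynamicLimit q n (esymmPow K n k 1) E :=
  exists_isThermodynamicLimit q hn k 1 (n * k) fun _ _ _ hJ hN => esymmFock_one_succ q hn k hJ hN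

theorem exists_isThermodynamicLimit_neg_one [CharZero K] (q : K) {n : ℕ} (hn : 1 ≤ n) (k : ℕ) :
    ∃ E : FockSpace q n →ₗ[K] FockSpace q n,
      IsThermodynamicLimit q n (esymmPow K n k (-1)) E :=
  exists_isThermodynamicLimit q hn k (-1) 0 fun _ _ _ hJ hN =>
    esymmFock_neg_one_succ q hn k hJ (by omega)

theorem IsThermodynamicLimit.apply_seqFock {q : K} {n k : ℕ} {ε : ℤ}
    {E : FockSpace q n →ₗ[K] FockSpace q n} (hE : IsThermodynamicLimit q n (esymmPow K n k ε) E)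
    {N : ℕ} {J : ℕ → ℤ} (hJ : ∀ i, N ≤ i → J i = -(i : ℤ)) (M₀ : ℕ) :
    ∃ M, M₀ ≤ M ∧ N ≤ M ∧ E (seqFock q n N J) = esymmFock q n k ε M J := by
  obtain ⟨d, h1, h2⟩ := ((hE N (seqTensor K N J)).and (Filter.eventually_ge_atTop M₀)).exists
  refine ⟨N + d, by omega, by omega, ?_⟩
  rw [seqFock, ← h1, extendBy_seqTensor hJ, toFock_esymmPow_seqTensor]

end QFock
end

noncomputable section

namespace QFock

/-! ### Bead positions of a partition -/

/-- `λ_{i+1} - i`. -/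
def bead (lam : YoungDiagram) (i : ℕ) : ℤ := (lam.rowLen i : ℤ) - i

/-- The first `M` bead positions. -/
def beads (lam : YoungDiagram) (M : ℕ) : Finset ℤ := (Finset.range M).image (bead lam)

theorem bead_lt_bead (lam : YoungDiagram) {i j : ℕ} (h : i < j) : bead lam j < bead lam i := by
  have := lam.rowLen_anti i j h.le
  unfold bead
  omega

theorem bead_injective (lam : YoungDiagram) : Function.Injective (bead lam) :=
  (strictAnti_nat_of_succ_lt fun i => bead_lt_bead lam (Nat.lt_succ_self i)).injective

theorem neg_le_bead (lam : YoungDiagram) (i : ℕ) : -(i : ℤ) ≤ bead lam i := by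
  unfold bead
  omega

theorem card_beads (lam : YoungDiagram) (M : ℕ) : (beads lam M).card = M := by
  rw [beads, Finset.card_image_of_injective _ (bead_injective lam), Finset.card_range]

theorem neg_lt_of_mem_beads {lam : YoungDiagram} {M : ℕ} {x : ℤ} (hx : x ∈ beads lam M) :
    -(M : ℤ) < x := by
  obtain ⟨i, hi, rfl⟩ := Finset.mem_image.1 hx
  have := neg_le_bead lam i
  have := Finset.mem_range.1 hi
  omega

theorem rowLen_eq_zero {lam : YoungDiagram} {i : ℕ} (h : lam.colLen 0 ≤ i) : lam.rowLen i = 0 := by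
  by_contra hne
  have : (i, 0) ∈ lam := YoungDiagram.mem_iff_lt_rowLen.2 (Nat.pos_of_ne_zero hne)
  have := YoungDiagram.mem_iff_lt_colLen.1 this
  omega

theorem bead_eq_neg {lam : YoungDiagram} {i : ℕ} (h : lam.colLen 0 ≤ i) :
    bead lam i = -(i : ℤ) := by
  rw [bead, rowLen_eq_zero h]
  simp

theorem lt_of_mem {lam : YoungDiagram} {M : ℕ} (hM : lam.colLen 0 ≤ M) {i j : ℕ}
    (h : (i, j) ∈ lam) : i < M :=
  (YoungDiagram.mem_iff_lt_colLen.1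
    (lam.up_left_mem le_rfl (Nat.zero_le j) h)).trans_le hM

theorem countGT_bead (lam : YoungDiagram) {M i : ℕ} (hi : i < M) :
    countGT (beads lam M) (bead lam i) = i :=
  countGT_image (fun _ _ h _ => bead_lt_bead lam h) hi

theorem countGT_le_card (X : Finset ℤ) (c : ℤ) : countGT X c ≤ X.card :=
  Finset.card_le_card (Finset.filter_subset _ _)

theorem countGT_antitone (X : Finset ℤ) {c d : ℤ} (h : c ≤ d) : countGT X d ≤ countGT X c :=
  Finset.card_le_card fun x hx => by
    simp only [Finset.mem_filter] at hx ⊢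
    exact ⟨hx.1, h.trans_lt hx.2⟩

theorem lt_countGT_beads_iff (lam : YoungDiagram) {M i : ℕ} (hi : i < M) (c : ℤ) :
    i < countGT (beads lam M) c ↔ c < bead lam i := by
  constructor
  · intro h
    by_contra hcon
    have := countGT_antitone (beads lam M) (not_lt.1 hcon)
    rw [countGT_bead lam hi] at this
    omega
  · intro h
    have := countGT_lt_countGT (X := beads lam M)
      (Finset.mem_image_of_mem _ (Finset.mem_range.2 hi)) h
    rwa [countGT_bead lam hi] at this

/-- Row `i` reaches the diagonal of content `c` exactly if its bead exceeds `c`. As the beads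
decrease, this means that more than `i` of them exceed `c`, so one number per diagonal describes the
diagram. -/
theorem mem_iff_lt_countGT {lam : YoungDiagram} {M : ℕ} (hM : lam.colLen 0 ≤ M) (i j : ℕ) :
    (i, j) ∈ lam ↔ i < countGT (beads lam M) ((j : ℤ) - i) := by
  by_cases hi : i < M
  · rw [lt_countGT_beads_iff lam hi, YoungDiagram.mem_iff_lt_rowLen, bead]
    omega
  · refine ⟨fun h => absurd (lt_of_mem hM h) hi, fun h => ?_⟩
    have := countGT_le_card (beads lam M) ((j : ℤ) - i)
    rw [card_beads] at this
    omega

theorem neg_le_countGT_beads (lam : YoungDiagram) {M : ℕ} {c : ℤ} (hc : -(M : ℤ) ≤ c) :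
    -c ≤ countGT (beads lam M) c := by
  by_contra hcon
  have h1 : countGT (beads lam M) c < M := by omega
  have := (lt_countGT_beads_iff lam h1 c).not.1 (lt_irrefl _)
  have := neg_le_bead lam (countGT (beads lam M) c)
  omega

theorem countGT_beads_of_le (lam : YoungDiagram) {M : ℕ} {c : ℤ} (hc : c ≤ -(M : ℤ)) :
    countGT (beads lam M) c = M := by
  rw [countGT, Finset.filter_true_of_mem, card_beads]
  intro x hx
  have := neg_lt_of_mem_beads hx
  omega

theorem ext_of_beads_eq {lam mu : YoungDiagram} {M : ℕ} (hlam : lam.colLen 0 ≤ M)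
    (hmu : mu.colLen 0 ≤ M) (h : beads lam M = beads mu M) : lam = mu := by
  ext ⟨i, j⟩
  rw [YoungDiagram.mem_cells, YoungDiagram.mem_cells, mem_iff_lt_countGT hlam,
    mem_iff_lt_countGT hmu, h]

theorem countGT_beads_mono {lam mu : YoungDiagram} (h : lam ≤ mu) (M : ℕ) (d : ℤ) :
    countGT (beads lam M) d ≤ countGT (beads mu M) d := by
  by_contra hcon
  have h1 := countGT_le_card (beads lam M) d
  rw [card_beads] at h1
  have hi : countGT (beads mu M) d < M := by omega
  have h2 := (lt_countGT_beads_iff lam hi d).1 (not_le.1 hcon)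
  have h3 : lam.rowLen (countGT (beads mu M) d) ≤ mu.rowLen (countGT (beads mu M) d) :=
    le_of_forall_lt fun j hj => YoungDiagram.mem_iff_lt_rowLen.1
      (h (YoungDiagram.mem_iff_lt_rowLen.2 hj))
  have h4 := (lt_countGT_beads_iff mu hi d).2 (h2.trans_le (by unfold bead; omega))
  exact lt_irrefl _ h4

/-- The Young diagram whose first `M` rows have the given lengths. -/
def ofRowFun (f : ℕ → ℕ) (hf : Antitone f) (M : ℕ) : YoungDiagram where
  cells := (Finset.range M ×ˢ Finset.range (f 0)).filter fun p => p.2 < f p.1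
  isLowerSet := by
    rintro ⟨i, j⟩ ⟨i', j'⟩ hle h
    have h1 : i' ≤ i := hle.1
    have h2 : j' ≤ j := hle.2
    simp only [Finset.coe_filter, Finset.mem_product, Finset.mem_range, Set.mem_ofPred_eq] at h ⊢
    have := hf h1
    omega

theorem mem_ofRowFun (f : ℕ → ℕ) (hf : Antitone f) (M : ℕ) (hM : ∀ i, M ≤ i → f i = 0)
    (i j : ℕ) : (i, j) ∈ ofRowFun f hf M ↔ j < f i := by
  rw [← YoungDiagram.mem_cells]
  simp only [ofRowFun, Finset.mem_filter, Finset.mem_product, Finset.mem_range]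
  refine ⟨fun h => h.2, fun h => ⟨⟨?_, h.trans_le (hf (Nat.zero_le i))⟩, h⟩⟩
  by_contra hcon
  rw [hM i (not_lt.1 hcon)] at h
  omega

/-- In the decreasing enumeration the gaps are at least one and the last element exceeds `-M`. Hence
the entry `b i` is at least `-i`, and the numbers `b i + i` are the parts of a partition. -/
theorem exists_beads_eq {X : Finset ℤ} {M : ℕ} (hcard : X.card = M) (hX : ∀ x ∈ X, -(M : ℤ) < x) :
    ∃ mu : YoungDiagram, mu.colLen 0 ≤ M ∧ beads mu M = X := by
  let b : ℕ → ℤ := fun i => if h : i < M then X.orderEmbOfFin hcard ⟨M - 1 - i, by omega⟩ else -i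
  have hb : ∀ i < M, b i ∈ X := fun i hi => by
    simp only [b, dif_pos hi]
    exact X.orderEmbOfFin_mem hcard _
  have hanti : ∀ i, b (i + 1) < b i := by
    intro i
    by_cases h1 : i + 1 < M
    · simp only [b, dif_pos h1, dif_pos (Nat.lt_of_succ_lt h1)]
      refine (X.orderEmbOfFin hcard).strictMono ?_
      rw [Fin.mk_lt_mk]
      omega
    · by_cases h2 : i < M
      · have := hX _ (hb i h2)
        simp only [b, dif_neg h1] at this ⊢
        push_cast
        omega
      · simp only [b, dif_neg h1, dif_neg h2]
        push_cast
        omega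
  have hlow : ∀ i : ℕ, -(i : ℤ) ≤ b i := by
    intro i
    by_cases hi : i < M
    · have key : ∀ d, d + 1 ≤ M → -((M - 1 - d : ℕ) : ℤ) ≤ b (M - 1 - d) := by
        intro d
        induction d with
        | zero =>
          intro h
          have := hX _ (hb (M - 1) (by omega))
          simp only [Nat.sub_zero]
          omega
        | succ d ih =>
          intro h
          have h1 := ih (by omega)
          have h2 := hanti (M - 1 - (d + 1))
          rw [show M - 1 - (d + 1) + 1 = M - 1 - d by omega] at h2
          omega
      have := key (M - 1 - i) (by omega)
      rwa [show M - 1 - (M - 1 - i) = i by omega] at this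
    · simp [b, hi]
  have hf : Antitone fun i => (b i + i).toNat := antitone_nat_of_succ_le fun i => by
    have := hanti i
    push_cast
    omega
  have hM : ∀ i, M ≤ i → (b i + i).toNat = 0 := fun i hi => by
    simp [b, hi.not_gt]
  have hrow : ∀ i, (ofRowFun _ hf M).rowLen i = (b i + i).toNat := by
    intro i
    refine eq_of_forall_lt_iff fun j => ?_
    rw [← YoungDiagram.mem_iff_lt_rowLen, mem_ofRowFun _ hf M hM]
  have hbead : bead (ofRowFun _ hf M) = b := by
    funext i
    have := hlow i
    rw [bead, hrow]
    omega
  refine ⟨ofRowFun _ hf M, ?_, ?_⟩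
  · by_contra hcon
    have := (mem_ofRowFun _ hf M hM M 0).1
      (YoungDiagram.mem_iff_lt_colLen.2 (not_le.1 hcon))
    rw [hM M le_rfl] at this
    omega
  · rw [beads, hbead]
    refine Finset.eq_of_subset_of_card_le ?_ ?_
    · intro x hx
      obtain ⟨i, hi, rfl⟩ := Finset.mem_image.1 hx
      exact hb i (Finset.mem_range.1 hi)
    · rw [Finset.card_image_of_injective _ (strictAnti_nat_of_succ_lt hanti).injective,
        Finset.card_range, hcard]

/-! ### Moving beads -/

/-- The set `X` after the elements of `Y` have been increased by `c`. -/
def move (c : ℤ) (X Y : Finset ℤ) : Finset ℤ := (X \ Y) ∪ Y.image (· + c)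

theorem card_image_add (c : ℤ) (Y : Finset ℤ) : (Y.image (· + c)).card = Y.card :=
  Finset.card_image_of_injective _ (add_left_injective c)

theorem disjoint_of_card_move {c : ℤ} {X Y : Finset ℤ} (hY : Y ⊆ X)
    (h : (move c X Y).card = X.card) : Disjoint (X \ Y) (Y.image (· + c)) := by
  rw [← Finset.card_union_eq_card_add_card, card_image_add, Finset.card_sdiff_add_card_eq_card hY]
  exact h

/-- The elements of `Y` whose ribbons meet the diagonal of content `d`. -/
def active (n : ℕ) (Y : Finset ℤ) (d : ℤ) : Finset ℤ := Y.filter fun y => y ≤ d ∧ d < y + n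

/-- A moved bead starts to exceed `d` exactly if it is active at `d`. Beads are counted with
multiplicity here, so collisions are allowed. -/
theorem countGT_sdiff_add_image {n : ℕ} {X Y : Finset ℤ} (hY : Y ⊆ X) (d : ℤ) :
    countGT (X \ Y) d + countGT (Y.image (· + (n : ℤ))) d =
      countGT X d + (active n Y d).card := by
  have h1 : countGT X d = countGT (X \ Y) d + countGT Y d := by
    unfold countGT
    rw [← Finset.card_union_of_disjoint, ← Finset.filter_union, Finset.sdiff_union_of_subset hY]
    exact Finset.disjoint_filter_filter Finset.sdiff_disjoint
  have h2 : countGT (Y.image (· + (n : ℤ))) d = countGT Y d + (active n Y d).card := by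
    unfold countGT active
    rw [Finset.filter_image, card_image_add, ← Finset.card_union_of_disjoint]
    · congr 1
      ext y
      simp only [Finset.mem_filter, Finset.mem_union]
      by_cases hy : y ∈ Y <;> simp only [hy, true_and, false_and, or_self]
      omega
    · refine Finset.disjoint_filter.2 fun y _ h => ?_
      omega
  omega

theorem countGT_move {n : ℕ} {X Y : Finset ℤ} (hY : Y ⊆ X)
    (h : (move n X Y).card = X.card) (d : ℤ) :
    countGT (move n X Y) d = countGT X d + (active n Y d).card := by
  rw [← countGT_sdiff_add_image hY, countGT, move, Finset.filter_union,
    Finset.card_union_of_disjoint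
      (Finset.disjoint_filter_filter (disjoint_of_card_move hY h))]
  rfl

theorem countGT_sub_one (X : Finset ℤ) (d : ℤ) :
    countGT X (d - 1) = countGT X d + if d ∈ X then 1 else 0 := by
  unfold countGT
  split_ifs with h
  · rw [← Finset.card_insert_of_notMem (s := X.filter (d < ·)) (a := d) (by simp)]
    congr 1
    ext x
    simp only [Finset.mem_filter, Finset.mem_insert]
    constructor
    · rintro ⟨h1, h2⟩
      rcases (by omega : x = d ∨ d < x) with h | h
      · exact Or.inl h
      · exact Or.inr ⟨h1, h⟩
    · rintro (rfl | ⟨h1, h2⟩)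
      · exact ⟨h, by omega⟩
      · exact ⟨h1, by omega⟩
  · rw [add_zero]
    congr 1
    refine Finset.filter_congr fun x hx => ?_
    have : x ≠ d := fun he => h (he ▸ hx)
    omega

/-- A set is recovered from the jumps of its counting function. All jumps for `X'` are at most one,
which also excludes collisions in the move. -/
theorem eq_move_of_countGT {n : ℕ} {X Y X' : Finset ℤ} (hY : Y ⊆ X)
    (h : ∀ d, countGT X' d = countGT X d + (active n Y d).card) : move n X Y = X' := by
  ext d
  have h1 := h d
  have h2 := h (d - 1)
  rw [← countGT_sdiff_add_image hY] at h1 h2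
  rw [countGT_sub_one, countGT_sub_one (X \ Y), countGT_sub_one (Y.image _)] at h2
  rw [move, Finset.mem_union]
  split_ifs at h2 <;> first | omega | tauto

theorem countGT_lt_card {A : Finset ℤ} {y : ℤ} (hy : y ∈ A) : countGT A y < A.card :=
  Finset.card_lt_card (Finset.filter_ssubset.2 ⟨y, hy, lt_irrefl y⟩)

theorem exists_countGT_eq {A : Finset ℤ} {r : ℕ} (hr : r < A.card) :
    ∃ y ∈ A, countGT A y = r := by
  have : A.image (countGT A) = Finset.range A.card := by
    refine Finset.eq_of_subset_of_card_le ?_ ?_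
    · intro x hx
      obtain ⟨y, hy, rfl⟩ := Finset.mem_image.1 hx
      exact Finset.mem_range.2 (countGT_lt_card hy)
    · rw [Finset.card_range, Finset.card_image_of_injOn fun x hx y hy h => countGT_injOn hx hy h]
  have h := Finset.mem_range.2 hr
  rw [← this] at h
  exact Finset.mem_image.1 h

end QFock
end

noncomputable section

namespace QFock

/-! ### The ribbons traced out by moving beads -/

/-- The number of elements of `X \ Y` in `(y, d]`. -/
def passed (X Y : Finset ℤ) (y d : ℤ) : ℕ := ((X \ Y).filter fun x => y < x ∧ x ≤ d).card

/-- The row in which the ribbon of `y` meets the diagonal of content `d`. -/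
def ribbonRow (X Y : Finset ℤ) (y d : ℤ) : ℕ :=
  countGT X d + (Y.filter fun x => y < x ∧ x ≤ d).card

/-- The cell, column first, in which the ribbon of `y` meets the diagonal of content `d`. -/
def ribbonCell (X Y : Finset ℤ) (y d : ℤ) : ℕ × ℕ :=
  ((ribbonRow X Y y d + d).toNat, ribbonRow X Y y d)

/-- The ribbon, in transposed coordinates, that is added when the bead `y` moves to `y + n`. -/
def ribbonAt (n : ℕ) (X Y : Finset ℤ) (y : ℤ) : Finset (ℕ × ℕ) :=
  (Finset.range n).image fun t : ℕ => ribbonCell X Y y (y + t)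

/-- Each bead above `y` lies above `d`, or in `(y, d]` and moved, or in `(y, d]` and unmoved. So the
ribbon goes down one row precisely when `d` meets an unmoved bead: this is how the spin counts
crossings. -/
theorem ribbonRow_add_passed {X Y : Finset ℤ} (hY : Y ⊆ X) {y d : ℤ} (hd : y ≤ d) :
    ribbonRow X Y y d + passed X Y y d = countGT X y := by
  unfold ribbonRow passed countGT
  rw [add_assoc, ← Finset.card_union_of_disjoint, ← Finset.filter_union,
    Finset.union_sdiff_of_subset hY, ← Finset.card_union_of_disjoint]
  · congr 1
    ext x
    simp only [Finset.mem_union, Finset.mem_filter]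
    by_cases hx : x ∈ X <;> simp only [hx, true_and, false_and, or_self]
    omega
  · refine Finset.disjoint_filter.2 fun x _ h => ?_
    omega
  · exact Finset.disjoint_filter_filter Finset.disjoint_sdiff

theorem passed_le_succ (X Y : Finset ℤ) (y d : ℤ) : passed X Y y d ≤ passed X Y y (d + 1) :=
  Finset.card_le_card (Finset.monotone_filter_right _ fun x _ h => ⟨h.1, by omega⟩)

theorem passed_succ_le (X Y : Finset ℤ) (y d : ℤ) :
    passed X Y y (d + 1) ≤ passed X Y y d + 1 := by
  refine (Finset.card_le_card (t := insert (d + 1) _) fun x hx => ?_).trans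
    (Finset.card_insert_le (d + 1) _)
  simp only [Finset.mem_filter, Finset.mem_insert] at hx ⊢
  by_cases h : x = d + 1
  · exact Or.inl h
  · exact Or.inr ⟨hx.1, hx.2.1, by omega⟩

theorem ribbonRow_self (X Y : Finset ℤ) (y : ℤ) : ribbonRow X Y y y = countGT X y := by
  unfold ribbonRow
  rw [Finset.filter_false_of_mem, Finset.card_empty, add_zero]
  intro x _
  omega

/-- The ribbons that meet the diagonal of content `d` are stacked without gaps on the diagram of
`X`, those with larger `y` lower. -/
theorem ribbonRow_eq {n : ℕ} {X Y : Finset ℤ} {y d : ℤ} (hd : d < y + n) :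
    ribbonRow X Y y d = countGT X d + countGT (active n Y d) y := by
  unfold ribbonRow
  congr 1
  unfold countGT active
  rw [Finset.filter_filter]
  congr 1
  refine Finset.filter_congr fun x _ => ?_
  omega

theorem ribbonRow_antitone {X Y : Finset ℤ} (hY : Y ⊆ X) (y : ℤ) :
    Antitone fun t : ℕ => ribbonRow X Y y (y + t) := by
  refine antitone_nat_of_succ_le fun t => ?_
  have h1 := ribbonRow_add_passed hY (y := y) (d := y + t) (by omega)
  have h2 := ribbonRow_add_passed hY (y := y) (d := y + t + 1) (by omega)
  have h3 := passed_le_succ X Y y (y + t)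
  push_cast
  rw [← add_assoc]
  omega

section

variable {n M : ℕ} {lam mu : YoungDiagram} {Y : Finset ℤ}

theorem neg_le_ribbonRow (hY : Y ⊆ beads lam M) {y d : ℤ} (hy : y ∈ Y) (hd : y ≤ d) :
    0 ≤ (ribbonRow (beads lam M) Y y d : ℤ) + d := by
  have h1 := neg_lt_of_mem_beads (hY hy)
  have h2 := neg_le_countGT_beads lam (M := M) (c := d) (by omega)
  unfold ribbonRow
  push_cast
  omega

theorem ribbonCell_content (hY : Y ⊆ beads lam M) {y d : ℤ} (hy : y ∈ Y) (hd : y ≤ d) :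
    ((ribbonCell (beads lam M) Y y d).1 : ℤ) - (ribbonCell (beads lam M) Y y d).2 = d := by
  have := neg_le_ribbonRow hY hy hd
  simp only [ribbonCell]
  omega

theorem mem_ribbonAt_iff (hY : Y ⊆ beads lam M) {y : ℤ} (hy : y ∈ Y) {s r : ℕ} :
    (s, r) ∈ ribbonAt n (beads lam M) Y y ↔
      (y ≤ (s : ℤ) - r ∧ (s : ℤ) - r < y + n) ∧ r = ribbonRow (beads lam M) Y y (s - r) := by
  unfold ribbonAt
  rw [Finset.mem_image]
  constructor
  · rintro ⟨t, ht, he⟩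
    have ht := Finset.mem_range.1 ht
    have h1 := ribbonCell_content hY hy (d := y + t) (by omega)
    have h2 : ribbonRow (beads lam M) Y y (y + t) = r := congrArg Prod.snd he
    rw [he] at h1
    simp only at h1
    rw [h1]
    exact ⟨by omega, h2.symm⟩
  · rintro ⟨h1, h2⟩
    refine ⟨((s : ℤ) - r - y).toNat, Finset.mem_range.2 (by omega), ?_⟩
    rw [show y + (((s : ℤ) - r - y).toNat : ℤ) = s - r by omega, ribbonCell, ← h2]
    ext <;> simp

theorem isRibbon_ribbonAt (hY : Y ⊆ beads lam M) {y : ℤ} (hy : y ∈ Y) :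
    IsRibbon n (ribbonAt n (beads lam M) Y y) := by
  refine ⟨fun t => ribbonCell (beads lam M) Y y (y + t), fun t _ => ?_, rfl⟩
  have h1 := ribbonRow_add_passed hY (y := y) (d := y + t) (by omega)
  have h2 := ribbonRow_add_passed hY (y := y) (d := y + t + 1) (by omega)
  have h3 := passed_le_succ (beads lam M) Y y (y + t)
  have h4 := passed_succ_le (beads lam M) Y y (y + t)
  have h5 := neg_le_ribbonRow hY hy (d := y + t) (by omega)
  have h6 := neg_le_ribbonRow hY hy (d := y + t + 1) (by omega)
  simp only [ribbonCell]
  rw [show y + ((t + 1 : ℕ) : ℤ) = y + t + 1 by push_cast; ring]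
  omega

theorem isInitialCell_ribbonAt (hn : 1 ≤ n) (hY : Y ⊆ beads lam M) (y : ℤ) :
    IsInitialCell (ribbonAt n (beads lam M) Y y) (ribbonCell (beads lam M) Y y y) := by
  refine ⟨Finset.mem_image.2 ⟨0, Finset.mem_range.2 hn, by simp⟩, ?_⟩
  intro c hc
  obtain ⟨t, _, rfl⟩ := Finset.mem_image.1 hc
  have h1 := ribbonRow_antitone hY y (Nat.zero_le t)
  simp only [Nat.cast_zero, add_zero] at h1
  refine ⟨?_, h1⟩
  have h2 : ∀ t : ℕ, (ribbonRow (beads lam M) Y y y : ℤ) + y ≤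
      ribbonRow (beads lam M) Y y (y + t) + (y + t) := by
    intro t
    induction t with
    | zero => simp
    | succ t ih =>
      have h1 := ribbonRow_add_passed hY (y := y) (d := y + t) (by omega)
      have h2 := ribbonRow_add_passed hY (y := y) (d := y + t + 1) (by omega)
      have h4 := passed_succ_le (beads lam M) Y y (y + t)
      rw [show y + ((t + 1 : ℕ) : ℤ) = y + t + 1 by push_cast; ring]
      omega
  have := h2 t
  simp only [ribbonCell]
  omega

theorem ribbonCell_self {i : ℕ} (hi : i < M) :
    ribbonCell (beads lam M) Y (bead lam i) (bead lam i) = (lam.rowLen i, i) := by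
  rw [ribbonCell, ribbonRow_self, countGT_bead lam hi, bead]
  ext <;> simp

theorem mem_skew_iff (hlam : lam.colLen 0 ≤ M) (hmu : mu.colLen 0 ≤ M) (s r : ℕ) :
    (s, r) ∈ mu.transpose.cells \ lam.transpose.cells ↔
      countGT (beads lam M) ((s : ℤ) - r) ≤ r ∧ r < countGT (beads mu M) ((s : ℤ) - r) := by
  rw [Finset.mem_sdiff, YoungDiagram.mem_cells, YoungDiagram.mem_cells,
    YoungDiagram.mem_transpose, YoungDiagram.mem_transpose, Prod.swap_prod_mk,
    mem_iff_lt_countGT hlam, mem_iff_lt_countGT hmu]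
  omega

/-- The bead `y` is the smallest content of a cell of its ribbon. -/
theorem ribbonAt_injective (hn : 1 ≤ n) {Y' : Finset ℤ} (hY : Y ⊆ beads lam M)
    (hY' : Y' ⊆ beads lam M) {y y' : ℤ} (hy : y ∈ Y) (hy' : y' ∈ Y')
    (h : ribbonAt n (beads lam M) Y y = ribbonAt n (beads lam M) Y' y') : y = y' := by
  have key : ∀ {Y Y' : Finset ℤ}, Y ⊆ beads lam M → Y' ⊆ beads lam M → ∀ {y y' : ℤ}, y ∈ Y →
      y' ∈ Y' → ribbonAt n (beads lam M) Y y = ribbonAt n (beads lam M) Y' y' → y' ≤ y := by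
    intro Y Y' hY hY' y y' hy hy' h
    have h1 := (isInitialCell_ribbonAt hn hY y).1
    rw [h] at h1
    have h2 := (mem_ribbonAt_iff hY' hy').1 h1
    have h3 := ribbonCell_content hY hy le_rfl
    simp only [ribbonCell] at h3
    omega
  exact le_antisymm (key hY' hY hy' hy h.symm) (key hY hY' hy hy' h)

/-- On each diagonal the skew shape has as many cells as there are active beads, and the ribbons of
these beads fill them from below by rank. The initial cell of the ribbon of `bead lam i` is the
first cell beyond row `i` of `lam`, which is the strip condition. -/
theorem isHorizontalStripTiling_image (hn : 1 ≤ n) (hlam : lam.colLen 0 ≤ M)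
    (hmu : mu.colLen 0 ≤ M) (hY : Y ⊆ beads lam M) (hmove : move n (beads lam M) Y = beads mu M) :
    IsHorizontalStripTiling n Y.card mu.transpose lam.transpose
      (Y.image (ribbonAt n (beads lam M) Y)) := by
  have hcount : ∀ d, countGT (beads mu M) d =
      countGT (beads lam M) d + (active n Y d).card := fun d => by
    rw [← hmove, countGT_move hY]
    rw [hmove, card_beads, card_beads]
  refine ⟨?_, ?_, ?_, ?_, ?_, ?_⟩
  · refine YoungDiagram.transpose_mono ?_
    rw [← YoungDiagram.cells_subset_iff]
    rintro ⟨i, j⟩ h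
    rw [YoungDiagram.mem_cells, mem_iff_lt_countGT hlam] at h
    rw [YoungDiagram.mem_cells, mem_iff_lt_countGT hmu, hcount]
    omega
  · intro R hR
    obtain ⟨y, hy, rfl⟩ := Finset.mem_image.1 hR
    exact isRibbon_ribbonAt hY hy
  · intro R hR R' hR' hne
    obtain ⟨y, hy, rfl⟩ := Finset.mem_image.1 (Finset.mem_coe.1 hR)
    obtain ⟨y', hy', rfl⟩ := Finset.mem_image.1 (Finset.mem_coe.1 hR')
    refine Finset.disjoint_left.2 ?_
    rintro ⟨s, r⟩ h h'
    obtain ⟨h1, h2⟩ := (mem_ribbonAt_iff hY hy).1 h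
    obtain ⟨h1', h2'⟩ := (mem_ribbonAt_iff hY hy').1 h'
    rw [ribbonRow_eq h1.2] at h2
    rw [ribbonRow_eq h1'.2] at h2'
    refine hne (congrArg _ (countGT_injOn (X := active n Y ((s : ℤ) - r)) ?_ ?_ ?_))
    · exact Finset.mem_filter.2 ⟨hy, h1⟩
    · exact Finset.mem_filter.2 ⟨hy', h1'⟩
    · omega
  · ext ⟨s, r⟩
    rw [mem_skew_iff hlam hmu, hcount]
    simp only [Finset.mem_biUnion, Finset.mem_image, exists_exists_and_eq_and, id]
    constructor
    · rintro ⟨y, hy, h⟩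
      obtain ⟨h1, h2⟩ := (mem_ribbonAt_iff hY hy).1 h
      rw [ribbonRow_eq h1.2] at h2
      have := countGT_lt_card (A := active n Y ((s : ℤ) - r)) (Finset.mem_filter.2 ⟨hy, h1⟩)
      omega
    · rintro ⟨h1, h2⟩
      obtain ⟨y, hy, h3⟩ := exists_countGT_eq (A := active n Y ((s : ℤ) - r))
        (r := r - countGT (beads lam M) ((s : ℤ) - r)) (by omega)
      obtain ⟨hy, h4⟩ := Finset.mem_filter.1 hy
      refine ⟨y, hy, (mem_ribbonAt_iff hY hy).2 ⟨h4, ?_⟩⟩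
      rw [ribbonRow_eq h4.2]
      omega
  · exact Finset.card_image_of_injOn fun y hy y' hy' h => ribbonAt_injective hn hY hY hy hy' h
  · intro R hR
    obtain ⟨y, hy, rfl⟩ := Finset.mem_image.1 hR
    refine ⟨_, isInitialCell_ribbonAt hn hY _, ?_⟩
    obtain ⟨i, hi, rfl⟩ := Finset.mem_image.1 (hY hy)
    rw [ribbonCell_self (Finset.mem_range.1 hi), YoungDiagram.colLen_transpose]

theorem image_ribbonAt_injective (hn : 1 ≤ n) {Y' : Finset ℤ} (hY : Y ⊆ beads lam M)
    (hY' : Y' ⊆ beads lam M)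
    (h : Y.image (ribbonAt n (beads lam M) Y) = Y'.image (ribbonAt n (beads lam M) Y')) :
    Y = Y' := by
  have key : ∀ {Y Y' : Finset ℤ}, Y ⊆ beads lam M → Y' ⊆ beads lam M →
      Y.image (ribbonAt n (beads lam M) Y) = Y'.image (ribbonAt n (beads lam M) Y') →
      Y ⊆ Y' := by
    intro Y Y' hY hY' h y hy
    have h1 := Finset.mem_image_of_mem (ribbonAt n (beads lam M) Y) hy
    rw [h] at h1
    obtain ⟨y', hy', he⟩ := Finset.mem_image.1 h1
    rwa [← ribbonAt_injective hn hY' hY hy' hy he]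
  exact (key hY hY' h).antisymm (key hY' hY h.symm)

end

/-! ### The spin -/

theorem image_range_eq_Icc {f : ℕ → ℕ} {m : ℕ}
    (hf : ∀ t < m, f (t + 1) = f t ∨ f (t + 1) + 1 = f t) :
    (Finset.range (m + 1)).image f = Finset.Icc (f m) (f 0) ∧ f m ≤ f 0 := by
  induction m with
  | zero => simp
  | succ m ih =>
    obtain ⟨h1, h2⟩ := ih fun t ht => hf t (by omega)
    rw [Finset.range_add_one, Finset.image_insert, h1]
    rcases hf m (by omega) with h | h
    · refine ⟨?_, by omega⟩
      rw [h, Finset.insert_eq_self.2 (Finset.mem_Icc.2 ⟨le_rfl, h2⟩)]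
    · refine ⟨?_, by omega⟩
      ext x
      simp only [Finset.mem_insert, Finset.mem_Icc]
      omega

/-- The number of pairs of a moved bead `y` and an unmoved bead that it passes. -/
def crossings (n : ℕ) (X Y : Finset ℤ) : ℕ :=
  (((X \ Y) ×ˢ Y).filter fun p : ℤ × ℤ => p.2 < p.1 ∧ p.1 < p.2 + n).card

theorem crossings_eq_sum (n : ℕ) (X Y : Finset ℤ) :
    crossings n X Y = ∑ y ∈ Y, passed X Y y (y + n - 1) := by
  unfold crossings passed
  rw [Finset.card_filter, Finset.sum_product_right]
  refine Finset.sum_congr rfl fun y _ => ?_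
  rw [Finset.card_filter]
  refine Finset.sum_congr rfl fun x _ => ?_
  congr 1
  rw [eq_iff_iff]
  omega

/-- The rows of the conjugate ribbon descend by steps of `0` or `1`, so they fill an interval whose
length is one more than the number of unmoved beads passed. -/
theorem height_ribbonAt {n : ℕ} (hn : 1 ≤ n) {X Y : Finset ℤ} (hY : Y ⊆ X) (y : ℤ) :
    height ((ribbonAt n X Y y).image Prod.swap) = passed X Y y (y + n - 1) + 1 := by
  obtain ⟨m, rfl⟩ : ∃ m, n = m + 1 := ⟨n - 1, by omega⟩
  have hstep : ∀ t < m, ribbonRow X Y y (y + (t + 1 : ℕ)) = ribbonRow X Y y (y + t) ∨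
      ribbonRow X Y y (y + (t + 1 : ℕ)) + 1 = ribbonRow X Y y (y + t) := by
    intro t _
    have h1 := ribbonRow_add_passed hY (y := y) (d := y + t) (by omega)
    have h2 := ribbonRow_add_passed hY (y := y) (d := y + t + 1) (by omega)
    have h3 := passed_le_succ X Y y (y + t)
    have h4 := passed_succ_le X Y y (y + t)
    push_cast
    rw [← add_assoc]
    omega
  obtain ⟨h1, h2⟩ := image_range_eq_Icc (f := fun t => ribbonRow X Y y (y + t)) hstep
  have h3 := ribbonRow_add_passed hY (y := y) (d := y + m) (by omega)
  have h4 := ribbonRow_self X Y y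
  rw [height, ribbonAt, Finset.image_image, Finset.image_image]
  change ((Finset.range (m + 1)).image fun t : ℕ => ribbonRow X Y y (y + t)).card = _
  rw [h1, Nat.card_Icc]
  simp only [Nat.cast_zero, add_zero] at h2 ⊢
  rw [show y + ((m + 1 : ℕ) : ℤ) - 1 = y + m by push_cast; ring]
  omega

theorem twiceSpin_image {n M : ℕ} (hn : 1 ≤ n) {lam : YoungDiagram} {Y : Finset ℤ}
    (hY : Y ⊆ beads lam M) :
    twiceSpin (conjugate (Y.image (ribbonAt n (beads lam M) Y))) =
      crossings n (beads lam M) Y := by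
  rw [twiceSpin, conjugate, Finset.image_image, Finset.sum_image, crossings_eq_sum]
  · refine Finset.sum_congr rfl fun y _ => ?_
    rw [Function.comp_apply, height_ribbonAt hn hY, Nat.add_sub_cancel]
  · intro y hy y' hy' h
    exact ribbonAt_injective hn hY hY hy hy' (Finset.image_injective Prod.swap_injective h)

end QFock
end

noncomputable section

namespace QFock

/-! ### Every horizontal ribbon strip is traced out by moving beads -/

/-- The content grows by one along the path, so each diagonal is met at most once and the path must
start at the initial cell. -/
theorem IsRibbon.exists_path {n : ℕ} {R : Finset (ℕ × ℕ)} (hR : IsRibbon n R) {x : ℕ × ℕ}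
    (hx : IsInitialCell R x) :
    ∃ c : ℕ → ℕ × ℕ, c 0 = x ∧ R = (Finset.range n).image c ∧
      (∀ t < n, ((c t).1 : ℤ) - (c t).2 = (x.1 : ℤ) - x.2 + t) ∧
      ∀ t, t + 1 < n → (c (t + 1)).2 = (c t).2 ∨ (c (t + 1)).2 + 1 = (c t).2 := by
  obtain ⟨c, hc, rfl⟩ := hR
  have hmono : ∀ t < n, ((c t).1 : ℤ) - (c t).2 = ((c 0).1 : ℤ) - (c 0).2 + t ∧
      (c 0).1 ≤ (c t).1 ∧ (c t).2 ≤ (c 0).2 := by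
    intro t
    induction t with
    | zero => simp
    | succ t ih =>
      intro ht
      have h1 := ih (by omega)
      have h2 := hc t ht
      push_cast
      omega
  obtain ⟨hx1, hx2⟩ := hx
  obtain ⟨t, ht, rfl⟩ := Finset.mem_image.1 hx1
  have ht := Finset.mem_range.1 ht
  have h0 : c 0 = c t := by
    have h1 := hx2 (c 0) (Finset.mem_image_of_mem c (Finset.mem_range.2 (by omega)))
    have h2 := hmono t ht
    ext <;> omega
  refine ⟨c, h0, rfl, fun s hs => ?_, fun s hs => ?_⟩
  · rw [← h0]
    exact (hmono s hs).1
  · have := hc s hs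
    omega

section

variable {n k M : ℕ} {lam mu : YoungDiagram} {T : Finset (Finset (ℕ × ℕ))}

/-- The rows `g R d` of the cells of content `d` of the ribbons `R` of a strip, whose initial
cells have the contents `y R`. -/
theorem IsHorizontalStripTiling.exists_rows
    (hT : IsHorizontalStripTiling n k mu.transpose lam.transpose T) (hmu : mu.colLen 0 ≤ M) :
    ∃ (y : Finset (ℕ × ℕ) → ℤ) (g : Finset (ℕ × ℕ) → ℤ → ℕ),
      (∀ R ∈ T, ∀ s r : ℕ, (s, r) ∈ R ↔
        (y R ≤ (s : ℤ) - r ∧ (s : ℤ) - r < y R + n) ∧ r = g R (s - r)) ∧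
      (∀ R ∈ T, ∀ d, y R ≤ d → d < y R + n → 0 ≤ (g R d : ℤ) + d) ∧
      (∀ R ∈ T, ∀ d, y R ≤ d → d + 1 < y R + n →
        g R (d + 1) = g R d ∨ g R (d + 1) + 1 = g R d) ∧
      (∀ R ∈ T, g R (y R) < M ∧ y R = bead lam (g R (y R))) := by
  have hex : ∀ R ∈ T, ∃ c : ℕ → ℕ × ℕ, ((c 0).1 = lam.rowLen (c 0).2 ∧ (c 0).2 < M) ∧
      R = (Finset.range n).image c ∧
      (∀ t < n, ((c t).1 : ℤ) - (c t).2 = ((c 0).1 : ℤ) - (c 0).2 + t) ∧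
      ∀ t, t + 1 < n → (c (t + 1)).2 = (c t).2 ∨ (c (t + 1)).2 + 1 = (c t).2 := by
    intro R hR
    obtain ⟨x, hx, hx'⟩ := hT.initial R hR
    obtain ⟨c, h0, h1, h2, h3⟩ := (hT.ribbon R hR).exists_path hx
    rw [YoungDiagram.colLen_transpose] at hx'
    subst h0
    refine ⟨c, ⟨hx', ?_⟩, h1, h2, h3⟩
    have hmem : c 0 ∈ mu.transpose.cells \ lam.transpose.cells := by
      rw [← hT.union]
      exact Finset.mem_biUnion.2 ⟨R, hR, hx.1⟩
    have h4 := (Finset.mem_sdiff.1 hmem).1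
    rw [YoungDiagram.mem_cells, YoungDiagram.mem_transpose] at h4
    exact lt_of_mem hmu h4
  choose! c hc0 hcR hcont hstep using hex
  refine ⟨fun R => ((c R 0).1 : ℤ) - (c R 0).2,
    fun R d => (c R (d - (((c R 0).1 : ℤ) - (c R 0).2)).toNat).2, ?_, ?_, ?_, ?_⟩
  · intro R hR s r
    constructor
    · intro h
      rw [hcR R hR] at h
      obtain ⟨t, ht, he⟩ := Finset.mem_image.1 h
      have ht := Finset.mem_range.1 ht
      have h1 := hcont R hR t ht
      rw [he] at h1
      simp only at h1 ⊢
      rw [h1, add_sub_cancel_left, Int.toNat_natCast, he]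
      exact ⟨by omega, rfl⟩
    · rintro ⟨h1, h2⟩
      simp only at h1 h2
      rw [hcR R hR]
      obtain ⟨t, ht⟩ : ∃ t : ℕ, (s : ℤ) - r = ((c R 0).1 : ℤ) - (c R 0).2 + t :=
        ⟨((s : ℤ) - r - (((c R 0).1 : ℤ) - (c R 0).2)).toNat, by omega⟩
      rw [ht, add_sub_cancel_left, Int.toNat_natCast] at h2
      refine Finset.mem_image.2 ⟨t, Finset.mem_range.2 (by omega), ?_⟩
      have h3 := hcont R hR t (by omega)
      ext
      · simp only
        omega
      · exact h2.symm
  · intro R hR d h1 h2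
    simp only at h1 h2
    obtain ⟨t, rfl⟩ : ∃ t : ℕ, d = ((c R 0).1 : ℤ) - (c R 0).2 + t :=
      ⟨(d - (((c R 0).1 : ℤ) - (c R 0).2)).toNat, by omega⟩
    have h3 := hcont R hR t (by omega)
    simp only
    rw [add_sub_cancel_left, Int.toNat_natCast]
    omega
  · intro R hR d h1 h2
    simp only at h1 h2
    obtain ⟨t, rfl⟩ : ∃ t : ℕ, d = ((c R 0).1 : ℤ) - (c R 0).2 + t :=
      ⟨(d - (((c R 0).1 : ℤ) - (c R 0).2)).toNat, by omega⟩
    have h3 := hstep R hR t (by omega)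
    simp only
    rw [add_assoc, add_sub_cancel_left, add_sub_cancel_left, Int.toNat_natCast,
      Int.toNat_natCast_add_one]
    exact h3
  · intro R hR
    simp only [sub_self, Int.toNat_zero]
    refine ⟨(hc0 R hR).2, ?_⟩
    rw [bead, ← (hc0 R hR).1]

/-- The strip condition says that the initial content `y R` of each ribbon is a bead. Counting cells
on diagonals shows that these beads move to those of `mu`. The ribbons on a diagonal are then
ordered by their initial contents, so each coincides with the one traced out by its bead. -/
theorem IsHorizontalStripTiling.exists_beads (hn : 1 ≤ n)
    (hT : IsHorizontalStripTiling n k mu.transpose lam.transpose T) (hlam : lam.colLen 0 ≤ M)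
    (hmu : mu.colLen 0 ≤ M) :
    ∃ Y ⊆ beads lam M, Y.card = k ∧ move n (beads lam M) Y = beads mu M ∧
      Y.image (ribbonAt n (beads lam M) Y) = T := by
  obtain ⟨y, g, hmem, hnn, hstep, hinit⟩ := hT.exists_rows hmu
  have hcell : ∀ R ∈ T, ∀ d, y R ≤ d → d < y R + n → (((g R d : ℤ) + d).toNat, g R d) ∈ R := by
    intro R hR d h1 h2
    have h3 := hnn R hR d h1 h2
    rw [hmem R hR, show ((((g R d : ℤ) + d).toNat : ℕ) : ℤ) - g R d = d by omega]
    exact ⟨⟨h1, h2⟩, rfl⟩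
  have hginj : ∀ R ∈ T, ∀ R' ∈ T, ∀ d, y R ≤ d → d < y R + n → y R' ≤ d → d < y R' + n →
      g R d = g R' d → R = R' := by
    intro R hR R' hR' d h1 h2 h1' h2' he
    by_contra hne
    have hd : Disjoint R R' := hT.disjoint hR hR' hne
    have h3 := hcell R hR d h1 h2
    rw [he] at h3
    exact Finset.disjoint_left.1 hd h3 (hcell R' hR' d h1' h2')
  have hn' : (0 : ℤ) < n := by omega
  have hyinj : ∀ R ∈ T, ∀ R' ∈ T, y R = y R' → R = R' := by
    intro R hR R' hR' he
    refine hginj R hR R' hR' (y R) le_rfl (by omega) (by omega) (by omega) ?_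
    refine bead_injective lam ?_
    rw [← (hinit R hR).2]
    conv_rhs => rw [he, ← (hinit R' hR').2]
    exact he
  have hgmem : ∀ R ∈ T, ∀ d, y R ≤ d → d < y R + n →
      countGT (beads lam M) d ≤ g R d ∧ g R d < countGT (beads mu M) d := by
    intro R hR d h1 h2
    have h3 : (((g R d : ℤ) + d).toNat, g R d) ∈ mu.transpose.cells \ lam.transpose.cells := by
      rw [← hT.union]
      exact Finset.mem_biUnion.2 ⟨R, hR, hcell R hR d h1 h2⟩
    have h4 := hnn R hR d h1 h2
    rwa [mem_skew_iff hlam hmu,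
      show ((((g R d : ℤ) + d).toNat : ℕ) : ℤ) - g R d = d by omega] at h3
  let Y := T.image y
  have hYsub : Y ⊆ beads lam M := by
    intro x hx
    obtain ⟨R, hR, rfl⟩ := Finset.mem_image.1 hx
    rw [(hinit R hR).2]
    exact Finset.mem_image_of_mem _ (Finset.mem_range.2 (hinit R hR).1)
  have hYcard : Y.card = k := by
    rw [Finset.card_image_of_injOn fun R hR R' hR' h => hyinj R hR R' hR' h, hT.card]
  -- the ribbons that meet the diagonal of content `d`
  let A : ℤ → Finset (Finset (ℕ × ℕ)) := fun d => T.filter fun R => y R ≤ d ∧ d < y R + n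
  have hA : ∀ {d R}, R ∈ A d ↔ R ∈ T ∧ y R ≤ d ∧ d < y R + n := fun {d R} => Finset.mem_filter
  have hAinj : ∀ d, Set.InjOn (fun R => g R d) (A d) := by
    intro d R hR R' hR' he
    obtain ⟨h1, h2, h3⟩ := hA.1 hR
    obtain ⟨h1', h2', h3'⟩ := hA.1 hR'
    exact hginj R h1 R' h1' d h2 h3 h2' h3' he
  have hAimage : ∀ d, (A d).image (fun R => g R d) =
      Finset.Ico (countGT (beads lam M) d) (countGT (beads mu M) d) := by
    intro d
    ext r
    rw [Finset.mem_image, Finset.mem_Ico]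
    constructor
    · rintro ⟨R, hR, rfl⟩
      obtain ⟨h1, h2, h3⟩ := hA.1 hR
      exact hgmem R h1 d h2 h3
    · rintro ⟨h1, h2⟩
      -- Below content `-M` all `M` beads of either partition are counted, so the interval of rows
      -- is empty.
      have hd : -(M : ℤ) ≤ d := by
        by_contra hcon
        rw [countGT_beads_of_le lam (by omega)] at h1
        have := countGT_le_card (beads mu M) d
        rw [card_beads] at this
        omega
      have h3 := neg_le_countGT_beads lam hd
      have h4 : (((r : ℤ) + d).toNat, r) ∈ mu.transpose.cells \ lam.transpose.cells := by
        rw [mem_skew_iff hlam hmu, show ((((r : ℤ) + d).toNat : ℕ) : ℤ) - r = d by omega]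
        exact ⟨h1, h2⟩
      rw [← hT.union] at h4
      obtain ⟨R, hR, h5⟩ := Finset.mem_biUnion.1 h4
      have h6 := (hmem R hR _ _).1 h5
      rw [show ((((r : ℤ) + d).toNat : ℕ) : ℤ) - r = d by omega] at h6
      exact ⟨R, hA.2 ⟨hR, h6.1⟩, h6.2.symm⟩
  have hAY : ∀ d, (A d).image y = active n Y d := by
    intro d
    ext x
    simp only [active, Finset.mem_image, Finset.mem_filter, Y, A]
    constructor
    · rintro ⟨R, ⟨h1, h2⟩, rfl⟩
      exact ⟨⟨R, h1, rfl⟩, h2⟩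
    · rintro ⟨⟨R, h1, rfl⟩, h2⟩
      exact ⟨R, ⟨h1, h2⟩, rfl⟩
  have hyinjA : ∀ d, Set.InjOn y (A d) := fun d R hR R' hR' he =>
    hyinj R (hA.1 hR).1 R' (hA.1 hR').1 he
  have hle := countGT_beads_mono (YoungDiagram.transpose_le_iff.1 hT.le) M
  have hcount : ∀ d, countGT (beads mu M) d =
      countGT (beads lam M) d + (active n Y d).card := by
    intro d
    have h1 := congrArg Finset.card (hAimage d)
    rw [Finset.card_image_of_injOn (hAinj d), Nat.card_Ico] at h1
    rw [← hAY, Finset.card_image_of_injOn (hyinjA d), h1]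
    have := hle d
    omega
  refine ⟨Y, hYsub, hYcard, eq_move_of_countGT hYsub hcount, ?_⟩
  -- On its first diagonal `R'` occupies the lowest free row, so `R` is above it. Along the
  -- following diagonals both rows drop by at most one and never agree, so neither ribbon can
  -- overtake the other.
  have horder : ∀ R ∈ T, ∀ R' ∈ T, y R < y R' → ∀ t : ℕ, y R' + t < y R + n →
      g R' (y R' + t) < g R (y R' + t) := by
    intro R hR R' hR' hlt t
    have hne : ∀ d, y R' ≤ d → d < y R + n → g R' d ≠ g R d := fun d h1 h2 he => by
      have := hginj R' hR' R hR d h1 (by omega) (by omega) h2 he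
      subst this
      omega
    induction t with
    | zero =>
      intro h
      simp only [Nat.cast_zero, add_zero] at h ⊢
      have h1 := hgmem R hR (y R') hlt.le h
      have h2 := countGT_bead lam (hinit R' hR').1
      rw [← (hinit R' hR').2] at h2
      have h3 := hne (y R') le_rfl h
      omega
    | succ t ih =>
      intro h
      push_cast at h ⊢
      rw [← add_assoc] at h ⊢
      have h1 := ih (by omega)
      have h2 := hstep R hR (y R' + t) (by omega) h
      have h3 := hstep R' hR' (y R' + t) (by omega) (by omega)
      have h4 := hne (y R' + t + 1) (by omega) h
      omega
  have horder' : ∀ d, ∀ R ∈ A d, ∀ R' ∈ A d, (g R' d < g R d ↔ y R < y R') := by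
    have key : ∀ d, ∀ R ∈ A d, ∀ R' ∈ A d, y R < y R' → g R' d < g R d := by
      intro d R hR R' hR' hlt
      obtain ⟨h1, h2, h3⟩ := hA.1 hR
      obtain ⟨h1', h2', h3'⟩ := hA.1 hR'
      have := horder R h1 R' h1' hlt (d - y R').toNat
      rw [show y R' + ((d - y R').toNat : ℤ) = d by omega] at this
      exact this h3
    intro d R hR R' hR'
    refine ⟨fun h => ?_, key d R hR R' hR'⟩
    rcases lt_trichotomy (y R) (y R') with hlt | he | hlt
    · exact hlt
    · rw [hyinjA d hR hR' he] at h
      exact absurd h (lt_irrefl _)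
    · exact absurd h (key d R' hR' R hR hlt).not_gt
  -- The rows on the diagonal form an interval, so the row of `R` is its lower end plus the number
  -- of ribbons below `R`, which are those with larger initial content.
  have hrow : ∀ d, ∀ R ∈ A d, g R d = ribbonRow (beads lam M) Y (y R) d := by
    intro d R hR
    obtain ⟨h1, h2, h3⟩ := hA.1 hR
    have h4 := hgmem R h1 d h2 h3
    have h5 : countGT ((A d).image y) (y R) = ((A d).filter fun R' => g R' d < g R d).card := by
      rw [countGT, Finset.filter_image, Finset.card_image_of_injOn
        ((hyinjA d).mono (Finset.coe_subset.2 (Finset.filter_subset _ _)))]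
      exact congrArg _ (Finset.filter_congr fun R' hR' => (horder' d R hR R' hR').symm)
    have h6 : ((A d).filter fun R' => g R' d < g R d).card =
        (Finset.Ico (countGT (beads lam M) d) (g R d)).card := by
      rw [← Finset.card_image_of_injOn
        ((hAinj d).mono (Finset.coe_subset.2 (Finset.filter_subset _ _)))]
      have h7 : ((A d).filter fun R' => g R' d < g R d).image (fun R => g R d) =
          ((A d).image fun R => g R d).filter (· < g R d) := by
        rw [Finset.filter_image]
      rw [h7, hAimage]
      congr 1
      ext r
      simp only [Finset.mem_filter, Finset.mem_Ico]
      omega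
    rw [ribbonRow_eq h3, ← hAY, h5, h6, Nat.card_Ico]
    omega
  rw [Finset.image_image]
  refine (Finset.image_congr fun R hR => ?_).trans Finset.image_id
  ext ⟨s, r⟩
  rw [Function.comp_apply, mem_ribbonAt_iff hYsub (Finset.mem_image_of_mem y hR), id,
    hmem R hR]
  refine and_congr_right fun h => ?_
  rw [hrow _ R (hA.2 ⟨hR, h⟩)]

end

end QFock
end

noncomputable section

namespace QFock

/-! ### The coefficients in terms of bead moves -/

theorem mem_ribbonTableaux {n k : ℕ} {β α : YoungDiagram} {T : Finset (Finset (ℕ × ℕ))} :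
    T ∈ ribbonTableaux n k β α ↔ IsHorizontalStripTiling n k β α T := by
  classical
  unfold ribbonTableaux
  simp only [Finset.mem_filter, and_iff_right_iff_imp]
  intro hT
  rw [Finset.mem_powerset]
  intro R hR
  rw [Finset.mem_powerset, ← hT.union]
  exact Finset.subset_biUnion_of_mem id hR

theorem IsHorizontalStripTiling.card_le {n k : ℕ} {β α : YoungDiagram}
    {T : Finset (Finset (ℕ × ℕ))} (hT : IsHorizontalStripTiling n k β α T) :
    β.cells.card ≤ α.cells.card + k * n := by
  have h1 : (β.cells \ α.cells).card ≤ k * n := by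
    rw [← hT.union, ← hT.card]
    refine Finset.card_biUnion_le_card_mul _ _ _ fun R hR => ?_
    obtain ⟨c, _, rfl⟩ := hT.ribbon R hR
    exact Finset.card_image_le.trans (Finset.card_range n).le
  have h2 := Finset.card_le_card_sdiff_add_card (s := β.cells) (t := α.cells)
  omega

theorem rowLen_le_card (β : YoungDiagram) (i : ℕ) : β.rowLen i ≤ β.cells.card := by
  rw [YoungDiagram.rowLen_eq_card]
  exact Finset.card_le_card (Finset.filter_subset _ _)

theorem colLen_le_card (β : YoungDiagram) (i : ℕ) : β.colLen i ≤ β.cells.card := by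
  rw [YoungDiagram.colLen_eq_card]
  exact Finset.card_le_card (Finset.filter_subset _ _)

theorem finite_setOf_card_le (m : ℕ) : {β : YoungDiagram | β.cells.card ≤ m}.Finite := by
  refine Set.Finite.subset (Set.Finite.preimage (f := YoungDiagram.cells)
    (fun β _ β' _ h => YoungDiagram.ext h)
    ((Finset.range m ×ˢ Finset.range m).powerset.finite_toSet)) ?_
  intro β hβ
  rw [Set.mem_preimage, Finset.mem_coe, Finset.mem_powerset]
  rintro ⟨i, j⟩ h
  have h1 := YoungDiagram.mem_iff_lt_colLen.1 h
  have h2 := YoungDiagram.mem_iff_lt_rowLen.1 h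
  have h3 := colLen_le_card β j
  have h4 := rowLen_le_card β i
  have h5 : β.cells.card ≤ m := hβ
  rw [Finset.mem_product, Finset.mem_range, Finset.mem_range]
  exact ⟨by omega, by omega⟩

theorem finite_setOf_transpose_card_le (m : ℕ) :
    {mu : YoungDiagram | mu.transpose.cells.card ≤ m}.Finite :=
  (finite_setOf_card_le m).preimage fun _ _ _ _ h => YoungDiagram.transpose_eq_iff.1 h

/-- The partitions whose conjugates have at most `m` cells. -/
def partitionsLE (m : ℕ) : Finset YoungDiagram := (finite_setOf_transpose_card_le m).toFinset

theorem mem_partitionsLE {m : ℕ} {mu : YoungDiagram} :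
    mu ∈ partitionsLE m ↔ mu.transpose.cells.card ≤ m :=
  Set.Finite.mem_toFinset _

theorem colLen_le_of_mem_partitionsLE {m : ℕ} {mu : YoungDiagram} (h : mu ∈ partitionsLE m) :
    mu.colLen 0 ≤ m := by
  rw [← YoungDiagram.rowLen_transpose]
  exact (rowLen_le_card _ 0).trans (mem_partitionsLE.1 h)

variable {K : Type*} [Field K]

theorem ribbonCoeff_eq (q : K) {n : ℕ} (hn : 1 ≤ n) (k : ℕ) {M : ℕ} {lam mu : YoungDiagram}
    (hlam : lam.colLen 0 ≤ M) (hmu : mu.colLen 0 ≤ M) :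
    ribbonCoeff q n k mu lam =
      ∑ Y ∈ ((beads lam M).powersetCard k).filter fun Y => move n (beads lam M) Y = beads mu M,
        (-q) ^ (-(crossings n (beads lam M) Y : ℤ)) := by
  symm
  refine Finset.sum_bij (fun Y _ => Y.image (ribbonAt n (beads lam M) Y)) ?_ ?_ ?_ ?_
  · intro Y hY
    obtain ⟨h1, h2⟩ := Finset.mem_filter.1 hY
    obtain ⟨h3, rfl⟩ := Finset.mem_powersetCard.1 h1
    exact mem_ribbonTableaux.2 (isHorizontalStripTiling_image hn hlam hmu h3 h2)
  · intro Y hY Y' hY' h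
    exact image_ribbonAt_injective hn
      (Finset.mem_powersetCard.1 (Finset.mem_filter.1 hY).1).1
      (Finset.mem_powersetCard.1 (Finset.mem_filter.1 hY').1).1 h
  · intro T hT
    obtain ⟨Y, h1, h2, h3, h4⟩ := (mem_ribbonTableaux.1 hT).exists_beads hn hlam hmu
    exact ⟨Y, Finset.mem_filter.2 ⟨Finset.mem_powersetCard.2 ⟨h1, h2⟩, h3⟩, h4⟩
  · intro Y hY
    rw [twiceSpin_image hn (Finset.mem_powersetCard.1 (Finset.mem_filter.1 hY).1).1]

theorem exists_tiling_of_ribbonCoeff_ne_zero {q : K} {n k : ℕ} {lam mu : YoungDiagram}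
    (h : ribbonCoeff q n k mu lam ≠ 0) :
    ∃ T, IsHorizontalStripTiling n k mu.transpose lam.transpose T := by
  obtain ⟨T, hT, _⟩ := Finset.exists_ne_zero_of_sum_ne_zero h
  exact ⟨T, mem_ribbonTableaux.1 hT⟩

/-! ### Reversing bead moves -/

theorem move_sdiff {c : ℤ} {X Y : Finset ℤ} (hY : Y ⊆ X) (h : (move c X Y).card = X.card) :
    move c X Y \ Y.image (· + c) = X \ Y := by
  rw [move, Finset.union_sdiff_right]
  exact Finset.sdiff_eq_self_of_disjoint (disjoint_of_card_move hY h)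

theorem image_add_image_neg (c : ℤ) (Y : Finset ℤ) :
    (Y.image (· + c)).image (· + -c) = Y := by
  rw [Finset.image_image]
  refine (Finset.image_congr fun y _ => ?_).trans Finset.image_id
  simp

theorem move_move {c : ℤ} {X Y : Finset ℤ} (hY : Y ⊆ X) (h : (move c X Y).card = X.card) :
    move (-c) (move c X Y) (Y.image (· + c)) = X := by
  rw [move, move_sdiff hY h, image_add_image_neg, Finset.sdiff_union_of_subset hY]

/-- The number of pairs of a bead `y` moved downwards and an unmoved bead that it passes. -/
def crossingsDown (n : ℕ) (X Y : Finset ℤ) : ℕ :=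
  (((X \ Y) ×ˢ Y).filter fun p : ℤ × ℤ => p.1 < p.2 ∧ p.2 < p.1 + n).card

theorem crossingsDown_move {n : ℕ} {X Y : Finset ℤ} (hY : Y ⊆ X)
    (h : (move n X Y).card = X.card) :
    crossingsDown n (move n X Y) (Y.image (· + (n : ℤ))) = crossings n X Y := by
  unfold crossings crossingsDown
  rw [move_sdiff hY h]
  symm
  refine Finset.card_bij (fun p _ => (p.1, p.2 + n)) ?_ ?_ ?_
  · rintro ⟨x, y⟩ hp
    simp only [Finset.mem_filter, Finset.mem_product, Finset.mem_image] at hp ⊢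
    exact ⟨⟨hp.1.1, y, hp.1.2, rfl⟩, by omega, by omega⟩
  · rintro ⟨x, y⟩ _ ⟨x', y'⟩ _ he
    simp only [Prod.mk.injEq] at he ⊢
    omega
  · rintro ⟨x, y⟩ hp
    simp only [Finset.mem_filter, Finset.mem_product, Finset.mem_image] at hp
    obtain ⟨⟨h1, y, h2, rfl⟩, h3⟩ := hp
    refine ⟨(x, y), ?_, rfl⟩
    simp only [Finset.mem_filter, Finset.mem_product]
    exact ⟨⟨h1, h2⟩, by omega, by omega⟩

theorem mem_filter_move {c : ℤ} {k : ℕ} {X X' Y : Finset ℤ} (hX : X'.card = X.card)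
    (hY : Y ∈ (X.powersetCard k).filter fun Y => move c X Y = X') :
    Y.image (· + c) ∈ (X'.powersetCard k).filter fun Z => move (-c) X' Z = X := by
  obtain ⟨h1, rfl⟩ := Finset.mem_filter.1 hY
  obtain ⟨h2, h3⟩ := Finset.mem_powersetCard.1 h1
  refine Finset.mem_filter.2 ⟨Finset.mem_powersetCard.2 ⟨Finset.subset_union_right, ?_⟩,
    move_move h2 hX⟩
  rw [card_image_add, h3]

/-- The downward moves from `lam` to `nu` are inverse to the upward moves from `nu` to `lam`,
through `Y ↦ Y + n`; the unmoved beads, and hence the crossings, are the same. -/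
theorem ribbonCoeff_eq_down (q : K) {n : ℕ} (hn : 1 ≤ n) (k : ℕ) {M : ℕ} {lam nu : YoungDiagram}
    (hlam : lam.colLen 0 ≤ M) (hnu : nu.colLen 0 ≤ M) :
    ribbonCoeff q n k lam nu =
      ∑ Z ∈ ((beads lam M).powersetCard k).filter
          fun Z => move (-n) (beads lam M) Z = beads nu M,
        (-q) ^ (-(crossingsDown n (beads lam M) Z : ℤ)) := by
  rw [ribbonCoeff_eq q hn k hnu hlam]
  have hc : (beads lam M).card = (beads nu M).card := by rw [card_beads, card_beads]
  refine Finset.sum_bij' (fun Y _ => Y.image (· + (n : ℤ))) (fun Z _ => Z.image (· + -(n : ℤ)))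
    (fun Y hY => mem_filter_move hc hY) (fun Z hZ => ?_) (fun Y _ => image_add_image_neg _ Y)
    (fun Z _ => ?_) fun Y hY => ?_
  · have := mem_filter_move hc.symm hZ
    rwa [neg_neg] at this
  · have := image_add_image_neg (-(n : ℤ)) Z
    rwa [neg_neg] at this
  · obtain ⟨h1, h2⟩ := Finset.mem_filter.1 hY
    rw [← crossingsDown_move (Finset.mem_powersetCard.1 h1).1 (by rw [h2, hc]), h2]

/-! ### Straightening of shifted bead sequences -/

theorem ket_eq_seqFock (q : K) (n : ℕ) {M : ℕ} {lam : YoungDiagram} (hlam : lam.colLen 0 ≤ M) :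
    seqFock q n M (bead lam) = ket q n lam := by
  obtain ⟨d, rfl⟩ := Nat.exists_eq_add_of_le hlam
  exact seqFock_add q n (fun i hi => bead_eq_neg hi) d

/-- Two entries of a strictly decreasing sequence change their difference by at most `n`, so a pair
that gets out of order does so by less than `n`. -/
theorem isClose_shiftSeq {ε : ℤ} (hε : ε = 1 ∨ ε = -1) (n a b : ℕ) (S : Finset ℕ)
    (lam : YoungDiagram) : IsClose n a b (shiftSeq n ε S (bead lam)) := by
  intro i j _ hij _ hle
  have := bead_lt_bead lam hij
  unfold shiftSeq at *
  rcases hε with rfl | rfl <;> split_ifs at * <;> omega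

theorem image_shiftSeq (n : ℕ) (ε : ℤ) {M : ℕ} {S : Finset ℕ} (hS : S ⊆ Finset.range M)
    (lam : YoungDiagram) :
    (Finset.range M).image (shiftSeq n ε S (bead lam)) =
      move (n * ε) (beads lam M) (S.image (bead lam)) := by
  have h : (Finset.range M).image (shiftSeq n ε S (bead lam)) =
      (Finset.range M \ S ∪ S).image (shiftSeq n ε S (bead lam)) := by
    rw [Finset.sdiff_union_of_subset hS]
  rw [h, move, beads, ← Finset.image_sdiff _ _ (bead_injective lam), Finset.image_image,
    Finset.image_union]
  congr 1
  · exact Finset.image_congr fun i hi => if_neg (Finset.mem_sdiff.1 (Finset.mem_coe.1 hi)).2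
  · exact Finset.image_congr fun i hi => if_pos (Finset.mem_coe.1 hi)

/-- A pair `i < j` turns into an ascent only if the later, smaller entry is raised past an unmoved
one. -/
theorem ascents_shiftSeq_one (n : ℕ) {M : ℕ} {S : Finset ℕ} (hS : S ⊆ Finset.range M)
    (lam : YoungDiagram) :
    ascents 0 M (shiftSeq n 1 S (bead lam)) =
      crossings n (beads lam M) (S.image (bead lam)) := by
  unfold ascents crossings beads
  rw [← Finset.image_sdiff _ _ (bead_injective lam)]
  refine Finset.card_bij (fun p _ => (bead lam p.1, bead lam p.2)) ?_ ?_ ?_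
  · rintro ⟨i, j⟩ hp
    simp only [Finset.mem_filter, Finset.mem_product, Finset.mem_Ico] at hp
    obtain ⟨h1, h2, h3⟩ := hp
    have h4 := bead_lt_bead lam h2
    have h5 : i ∉ S ∧ j ∈ S ∧ bead lam i < bead lam j + n := by
      unfold shiftSeq at h3
      split_ifs at h3 with hi hj hj
      · omega
      · omega
      · exact ⟨hi, hj, by omega⟩
      · omega
    simp only [Finset.mem_filter, Finset.mem_product]
    refine ⟨⟨Finset.mem_image_of_mem _ ?_, Finset.mem_image_of_mem _ h5.2.1⟩, h4, h5.2.2⟩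
    exact Finset.mem_sdiff.2 ⟨Finset.mem_range.2 h1.1.2, h5.1⟩
  · rintro ⟨i, j⟩ _ ⟨i', j'⟩ _ he
    simp only [Prod.mk.injEq] at he ⊢
    exact ⟨bead_injective lam he.1, bead_injective lam he.2⟩
  · rintro ⟨x, y⟩ hp
    simp only [Finset.mem_filter, Finset.mem_product, Finset.mem_image, Finset.mem_sdiff] at hp
    obtain ⟨⟨⟨i, ⟨h1, h2⟩, rfl⟩, j, h3, rfl⟩, h4, h5⟩ := hp
    refine ⟨(i, j), ?_, rfl⟩
    have h6 : i < j := by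
      by_contra hcon
      rcases (not_lt.1 hcon).lt_or_eq with h | h
      · have := bead_lt_bead lam h
        omega
      · subst h
        omega
    have h7 := Finset.mem_range.1 (hS h3)
    have h8 := Finset.mem_range.1 h1
    refine Finset.mem_filter.2 ⟨Finset.mem_product.2 ⟨Finset.mem_Ico.2 ⟨Nat.zero_le i, by omega⟩,
      Finset.mem_Ico.2 ⟨Nat.zero_le j, by omega⟩⟩, h6, ?_⟩
    dsimp only
    rw [shiftSeq, shiftSeq, if_neg h2, if_pos h3]
    omega

theorem ascents_shiftSeq_neg_one (n : ℕ) {M : ℕ} {S : Finset ℕ} (hS : S ⊆ Finset.range M)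
    (lam : YoungDiagram) :
    ascents 0 M (shiftSeq n (-1) S (bead lam)) =
      crossingsDown n (beads lam M) (S.image (bead lam)) := by
  unfold ascents crossingsDown beads
  rw [← Finset.image_sdiff _ _ (bead_injective lam)]
  refine Finset.card_bij (fun p _ => (bead lam p.2, bead lam p.1)) ?_ ?_ ?_
  · rintro ⟨i, j⟩ hp
    simp only [Finset.mem_filter, Finset.mem_product, Finset.mem_Ico] at hp
    obtain ⟨h1, h2, h3⟩ := hp
    have h4 := bead_lt_bead lam h2
    have h5 : i ∈ S ∧ j ∉ S ∧ bead lam i < bead lam j + n := by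
      unfold shiftSeq at h3
      split_ifs at h3 with hi hj hj
      · omega
      · exact ⟨hi, hj, by omega⟩
      · omega
      · omega
    simp only [Finset.mem_filter, Finset.mem_product]
    refine ⟨⟨Finset.mem_image_of_mem _ ?_, Finset.mem_image_of_mem _ h5.1⟩, h4, h5.2.2⟩
    exact Finset.mem_sdiff.2 ⟨Finset.mem_range.2 h1.2.2, h5.2.1⟩
  · rintro ⟨i, j⟩ _ ⟨i', j'⟩ _ he
    simp only [Prod.mk.injEq] at he ⊢
    exact ⟨bead_injective lam he.2, bead_injective lam he.1⟩
  · rintro ⟨x, y⟩ hp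
    simp only [Finset.mem_filter, Finset.mem_product, Finset.mem_image, Finset.mem_sdiff] at hp
    obtain ⟨⟨⟨j, ⟨h1, h2⟩, rfl⟩, i, h3, rfl⟩, h4, h5⟩ := hp
    refine ⟨(i, j), ?_, rfl⟩
    have h6 : i < j := by
      by_contra hcon
      rcases (not_lt.1 hcon).lt_or_eq with h | h
      · have := bead_lt_bead lam h
        omega
      · subst h
        omega
    have h7 := Finset.mem_range.1 h1
    have h8 := Finset.mem_range.1 (hS h3)
    refine Finset.mem_filter.2 ⟨Finset.mem_product.2 ⟨Finset.mem_Ico.2 ⟨Nat.zero_le i, by omega⟩,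
      Finset.mem_Ico.2 ⟨Nat.zero_le j, by omega⟩⟩, h6, ?_⟩
    dsimp only
    rw [shiftSeq, shiftSeq, if_pos h3, if_neg h2]
    omega

/-- Three cases: the shifted beads are those of a partition and are sorted; a bead falls to `-M` or
below and collides with the vacuum; or two shifted beads coincide. The last two give zero. -/
theorem seqFock_shiftSeq [CharZero K] {q : K} (hq : q ≠ 0) {n : ℕ} (hn : 1 ≤ n) {ε : ℤ}
    (hε : ε = 1 ∨ ε = -1) {M : ℕ} {S : Finset ℕ} (hS : S ⊆ Finset.range M) {lam : YoungDiagram}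
    (hlam : lam.colLen 0 ≤ M) (P : Finset YoungDiagram) (hP : ∀ mu ∈ P, mu.colLen 0 ≤ M)
    (hP' : ∀ mu : YoungDiagram, mu.colLen 0 ≤ M →
      move (n * ε) (beads lam M) (S.image (bead lam)) = beads mu M → mu ∈ P) :
    seqFock q n M (shiftSeq n ε S (bead lam)) =
      ∑ mu ∈ P, if move (n * ε) (beads lam M) (S.image (bead lam)) = beads mu M then
        ((-q) ^ (-(ascents 0 M (shiftSeq n ε S (bead lam)) : ℤ))) • ket q n mu else 0 := by
  have himage := image_shiftSeq n ε hS lam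
  by_cases hex : ∃ mu : YoungDiagram, mu.colLen 0 ≤ M ∧
      move (n * ε) (beads lam M) (S.image (bead lam)) = beads mu M
  · obtain ⟨mu, h1, h2⟩ := hex
    rw [Finset.sum_eq_single_of_mem mu (hP' mu h1 h2), if_pos h2, ← ket_eq_seqFock q n h1]
    · exact seqFock_straighten hq hn (isClose_shiftSeq hε n 0 M S lam)
        (fun i j h _ => bead_lt_bead mu h) (himage.trans h2)
    · intro mu' h3 h4
      refine if_neg fun h5 => h4 (ext_of_beads_eq (hP mu' h3) h1 (h5.symm.trans h2))
  · rw [Finset.sum_eq_zero fun mu hmu => if_neg fun h => hex ⟨mu, hP mu hmu, h⟩]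
    by_cases hcard : (move (n * ε) (beads lam M) (S.image (bead lam))).card = M
    · have hlow : ¬∀ x ∈ move (n * ε) (beads lam M) (S.image (bead lam)), -(M : ℤ) < x := by
        intro h
        obtain ⟨mu, h1, h2⟩ := exists_beads_eq hcard h
        exact hex ⟨mu, h1, h2.symm⟩
      push Not at hlow
      obtain ⟨x, hx, hxM⟩ := hlow
      rw [← himage] at hx
      obtain ⟨i, hi, rfl⟩ := Finset.mem_image.1 hx
      have hi := Finset.mem_range.1 hi
      set J := shiftSeq n ε S (bead lam) with hJ
      have hout : ∀ j, M ≤ j → J j = -(j : ℤ) := fun j hj => by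
        rw [hJ, shiftSeq, if_neg, bead_eq_neg (hlam.trans hj)]
        intro h
        have := Finset.mem_range.1 (hS h)
        omega
      -- Since `J i ≤ -M`, the vacuum entry at position `-J i ≥ M` equals `J i`. The sequence is
      -- lengthened just enough to include that position.
      rw [← seqFock_add q n hout ((-J i).toNat + 1 - M)]
      refine seqFock_eq_zero q hn le_rfl (isClose_shiftSeq hε n 0 _ S lam) (i := i)
        (j := (-J i).toNat) (Nat.zero_le i) (by omega) (by omega) ?_
      rw [hout (-J i).toNat (by omega)]
      omega
    · rw [← himage] at hcard
      have hinj : ¬Set.InjOn (shiftSeq n ε S (bead lam)) (Finset.range M) := fun h =>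
        hcard (by rw [Finset.card_image_of_injOn h, Finset.card_range])
      rw [Set.InjOn] at hinj
      push Not at hinj
      obtain ⟨i, hi, j, hj, he, hne⟩ := hinj
      have hi := Finset.mem_range.1 (Finset.mem_coe.1 hi)
      have hj := Finset.mem_range.1 (Finset.mem_coe.1 hj)
      have hc := isClose_shiftSeq hε n 0 M S lam
      rcases lt_or_gt_of_ne hne with h | h
      · exact seqFock_eq_zero q hn le_rfl hc (Nat.zero_le i) h hj he
      · exact seqFock_eq_zero q hn le_rfl hc (Nat.zero_le j) h hi he.symm

/-- The weight `w` is `crossings` or `crossingsDown` according to the direction. The finite set `P`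
is any set that contains all partitions reached. -/
theorem esymmFock_bead [CharZero K] {q : K} (hq : q ≠ 0) {n : ℕ} (hn : 1 ≤ n) (k : ℕ) {ε : ℤ}
    (hε : ε = 1 ∨ ε = -1) {M : ℕ} {lam : YoungDiagram} (hlam : lam.colLen 0 ≤ M)
    (w : Finset ℤ → ℕ) (hw : ∀ S ⊆ Finset.range M,
      ascents 0 M (shiftSeq n ε S (bead lam)) = w (S.image (bead lam)))
    (P : Finset YoungDiagram) (hP : ∀ mu ∈ P, mu.colLen 0 ≤ M)
    (hP' : ∀ mu : YoungDiagram, mu.colLen 0 ≤ M → ∀ Y ∈ (beads lam M).powersetCard k,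
      move (n * ε) (beads lam M) Y = beads mu M → mu ∈ P) :
    esymmFock q n k ε M (bead lam) =
      ∑ mu ∈ P, (∑ Y ∈ ((beads lam M).powersetCard k).filter
          fun Y => move (n * ε) (beads lam M) Y = beads mu M, (-q) ^ (-(w Y : ℤ))) •
        ket q n mu := by
  have hb : beads lam M = (Finset.range M).map ⟨bead lam, bead_injective lam⟩ :=
    (Finset.map_eq_image ⟨bead lam, bead_injective lam⟩ _).symm
  have hpow : (beads lam M).powersetCard k = ((Finset.range M).powersetCard k).map
      (Finset.mapEmbedding ⟨bead lam, bead_injective lam⟩).toEmbedding := by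
    rw [hb, Finset.powersetCard_map]
  have hY : ∀ S : Finset ℕ, (Finset.mapEmbedding ⟨bead lam, bead_injective lam⟩).toEmbedding S =
      S.image (bead lam) := fun S => Finset.map_eq_image _ _
  have hsum : ∀ F : Finset ℤ → FockSpace q n, ∑ Y ∈ (beads lam M).powersetCard k, F Y =
      ∑ S ∈ (Finset.range M).powersetCard k, F (S.image (bead lam)) := by
    intro F
    rw [hpow, Finset.sum_map]
    exact Finset.sum_congr rfl fun S _ => by rw [hY]
  simp only [Finset.sum_smul, Finset.sum_filter]
  rw [Finset.sum_comm]
  simp only [ite_smul, zero_smul]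
  rw [hsum, esymmFock]
  refine Finset.sum_congr rfl fun S hS => ?_
  have hS' := Finset.mem_powersetCard.1 hS
  rw [seqFock_shiftSeq hq hn hε hS'.1 hlam P hP, hw S hS'.1]
  intro mu h1 h2
  refine hP' mu h1 _ ?_ h2
  rw [hpow, ← hY]
  exact Finset.mem_map_of_mem _ hS

end QFock
end

noncomputable section

namespace QFock

variable {K : Type*} [Field K]

/-! ### The action on the vectors `|λ⟩` -/

theorem esymmY_apply_ket [CharZero K] {q : K} (hq : q ≠ 0) {n : ℕ} (hn : 1 ≤ n) {k : ℕ}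
    {E : FockSpace q n →ₗ[K] FockSpace q n} (hE : IsThermodynamicLimit q n (esymmY K n k) E)
    (lam : YoungDiagram) :
    (Function.support fun mu => ribbonCoeff q n k mu lam).Finite ∧
      E (ket q n lam) = ∑ᶠ mu : YoungDiagram, ribbonCoeff q n k mu lam • ket q n mu := by
  -- A strip of `k` ribbons has at most `k * n` cells, so only finitely many `mu` occur. Taking at
  -- least `m` tensor factors ensures that all of them have at most `M` rows.
  set m := lam.transpose.cells.card + k * n with hm
  have hmem : ∀ {mu : YoungDiagram} {T}, IsHorizontalStripTiling n k mu.transpose lam.transpose T →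
      mu ∈ partitionsLE m := fun hT => mem_partitionsLE.2 hT.card_le
  have hsupp : (Function.support fun mu => ribbonCoeff q n k mu lam) ⊆ partitionsLE m := by
    intro mu hmu
    obtain ⟨T, hT⟩ := exists_tiling_of_ribbonCoeff_ne_zero hmu
    exact Finset.mem_coe.2 (hmem hT)
  refine ⟨(partitionsLE m).finite_toSet.subset hsupp, ?_⟩
  have hE' : IsThermodynamicLimit q n (esymmPow K n k 1) E := hE
  obtain ⟨M, hM, hlam, hEM⟩ :=
    hE'.apply_seqFock (N := lam.colLen 0) (fun i hi => bead_eq_neg (lam := lam) hi) m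
  have hP : ∀ mu ∈ partitionsLE m, mu.colLen 0 ≤ M := fun mu hmu =>
    (colLen_le_of_mem_partitionsLE hmu).trans hM
  rw [← ket_eq_seqFock q n (le_refl (lam.colLen 0)), hEM,
    esymmFock_bead hq hn k (Or.inl rfl) hlam (crossings n (beads lam M))
      (fun S hS => ascents_shiftSeq_one n hS lam) (partitionsLE m) hP]
  · rw [finsum_eq_sum_of_support_subset (fun mu => ribbonCoeff q n k mu lam • ket q n mu)
      ((Function.support_smul_subset_left _ (ket q n)).trans hsupp)]
    refine Finset.sum_congr rfl fun mu hmu => ?_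
    rw [ribbonCoeff_eq q hn k hlam (hP mu hmu), mul_one]
  · intro mu hmu Y hY h
    rw [mul_one] at h
    obtain ⟨h1, rfl⟩ := Finset.mem_powersetCard.1 hY
    exact hmem (isHorizontalStripTiling_image hn hlam hmu h1 h)

theorem esymmYInv_apply_ket [CharZero K] {q : K} (hq : q ≠ 0) {n : ℕ} (hn : 1 ≤ n) {k : ℕ}
    {E : FockSpace q n →ₗ[K] FockSpace q n} (hE : IsThermodynamicLimit q n (esymmYInv K n k) E)
    (lam : YoungDiagram) :
    (Function.support fun nu => ribbonCoeff q n k lam nu).Finite ∧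
      E (ket q n lam) = ∑ᶠ nu : YoungDiagram, ribbonCoeff q n k lam nu • ket q n nu := by
  set m := lam.transpose.cells.card with hm
  have hmem : ∀ {nu : YoungDiagram} {T}, IsHorizontalStripTiling n k lam.transpose nu.transpose T →
      nu ∈ partitionsLE m := fun hT => mem_partitionsLE.2 (Finset.card_le_card hT.le)
  have hsupp : (Function.support fun nu => ribbonCoeff q n k lam nu) ⊆ partitionsLE m := by
    intro nu hnu
    obtain ⟨T, hT⟩ := exists_tiling_of_ribbonCoeff_ne_zero hnu
    exact Finset.mem_coe.2 (hmem hT)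
  refine ⟨(partitionsLE m).finite_toSet.subset hsupp, ?_⟩
  have hE' : IsThermodynamicLimit q n (esymmPow K n k (-1)) E := hE
  obtain ⟨M, hM, hlam, hEM⟩ :=
    hE'.apply_seqFock (N := lam.colLen 0) (fun i hi => bead_eq_neg (lam := lam) hi) m
  have hP : ∀ nu ∈ partitionsLE m, nu.colLen 0 ≤ M := fun nu hnu =>
    (colLen_le_of_mem_partitionsLE hnu).trans hM
  rw [← ket_eq_seqFock q n (le_refl (lam.colLen 0)), hEM,
    esymmFock_bead hq hn k (Or.inr rfl) hlam (crossingsDown n (beads lam M))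
      (fun S hS => ascents_shiftSeq_neg_one n hS lam) (partitionsLE m) hP]
  · rw [finsum_eq_sum_of_support_subset (fun nu => ribbonCoeff q n k lam nu • ket q n nu)
      ((Function.support_smul_subset_left _ (ket q n)).trans hsupp)]
    refine Finset.sum_congr rfl fun nu hnu => ?_
    rw [ribbonCoeff_eq_down q hn k hlam (hP nu hnu), mul_neg_one]
  · intro nu hnu Z hZ h
    rw [mul_neg_one] at h
    -- Reversing the downward move gives a strip of shape `lam' / nu'`, whence `nu` is among the
    -- finitely many partitions considered.
    have hc : (beads nu M).card = (beads lam M).card := by rw [card_beads, card_beads]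
    have hY := mem_filter_move hc (Finset.mem_filter.2 ⟨hZ, h⟩)
    rw [neg_neg] at hY
    obtain ⟨h1, h2⟩ := Finset.mem_filter.1 hY
    obtain ⟨h3, h4⟩ := Finset.mem_powersetCard.1 h1
    have hT := isHorizontalStripTiling_image hn hnu hlam h3 h2
    rw [h4] at hT
    exact hmem hT

end QFock
end

/-! ### The two limit operators and their action -/

theorem mainTheorem11 {K : Type*} [Field K] [CharZero K] (q : K) (hq : Transcendental ℚ q)
    (n : ℕ) (hn : 1 ≤ n) (k : ℕ) :
    ((∃! U : QFock.FockSpace q n →ₗ[K] QFock.FockSpace q n,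
        QFock.IsThermodynamicLimit q n (QFock.esymmYInv K n k) U) ∧
      ∀ U : QFock.FockSpace q n →ₗ[K] QFock.FockSpace q n,
        QFock.IsThermodynamicLimit q n (QFock.esymmYInv K n k) U →
        ∀ lam : YoungDiagram,
          (Function.support fun nu => QFock.ribbonCoeff q n k lam nu).Finite ∧
          U (QFock.ket q n lam) =
            ∑ᶠ nu : YoungDiagram, QFock.ribbonCoeff q n k lam nu • QFock.ket q n nu) ∧
    ((∃! V : QFock.FockSpace q n →ₗ[K] QFock.FockSpace q n,
        QFock.IsThermodynamicLimit q n (QFock.esymmY K n k) V) ∧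
      ∀ V : QFock.FockSpace q n →ₗ[K] QFock.FockSpace q n,
        QFock.IsThermodynamicLimit q n (QFock.esymmY K n k) V →
        ∀ lam : YoungDiagram,
          (Function.support fun mu => QFock.ribbonCoeff q n k mu lam).Finite ∧
          V (QFock.ket q n lam) =
            ∑ᶠ mu : YoungDiagram, QFock.ribbonCoeff q n k mu lam • QFock.ket q n mu) := by
  have hq0 : q ≠ 0 := fun h => hq (h ▸ isAlgebraic_zero)
  obtain ⟨U, hU⟩ := QFock.exists_isThermodynamicLimit_neg_one q hn k
  obtain ⟨V, hV⟩ := QFock.exists_isThermodynamicLimit_one q hn k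
  exact ⟨⟨⟨U, hU, fun _ h => h.unique hU⟩,
      fun _ hE lam => QFock.esymmYInv_apply_ket hq0 hn hE lam⟩,
    ⟨V, hV, fun _ h => h.unique hV⟩, fun _ hE lam => QFock.esymmY_apply_ket hq0 hn hE lam⟩
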